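/- Let $d\ge 1$, let $0<\alpha=\beta\le 1$, and let $u_0\in\mathcal S(\mathbb R^d)$ be a (complex-valued) Schwartz function. Consider the time-fractional Schrödinger equation $$-i^{\beta}\,\partial_t^{\alpha}u+H_0u=0\ \text{ in }\mathbb R^d\times(0,\infty),\qquad u(\cdot,0)=u_0,\qquad H_0=-\Delta,\quad D(H_0)=H^2(\mathbb R^d),\quad i^\beta=e^{i\pi\beta/2},$$ where $\partial_t^\alpha u(t)=\frac1{\Gamma(1-\alpha)}\int_0^t\frac{u'(s)}{(t-s)^\alpha}\,ds$ is the Caputo derivative if $\alpha<1$ and $\partial_t^1=\partial_t$. A solution is a function $u\in L^1_{\rm loc}((0,\infty);D(H_0))\cap W^{1,1}_{\rm loc}((0,\infty);L^2(\mathbb R^d))$ (identified with its continuous representative $(0,\infty)\to L^2(\mathbb R^d)$) for which, for almost every $t>0$, the integral defining $\partial_t^\alpha u(t)$ converges absolutely in $L^2(\mathbb R^d)$ (no condition if $\alpha=1$) and the equation holds in $L^2(\mathbb R^d)$, and such that $\lim_{t\downarrow0}\|u(\cdot,t)-u_0\|=0$, with $\|\cdot\|$ the norm of $L^2(\mathbb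 R^d)$. Write $\hat u_0(\xi)=(2\pi)^{-d/2}\int_{\mathbb R^d}e^{-ix\cdot\xi}u_0(x)\,dx$. Then there is a unique solution $u$, its mean-square displacement $$D_2(u_0,t)=\int_{\mathbb R^d}|x|^2|u(x,t)|^2\,dx$$ is finite for every $t>0$, and $$D_2(u_0,t)=\frac{4}{\alpha^4}\,\bigl\||\xi|^{\frac{2-\alpha}{\alpha}}\hat u_0\bigr\|^2\,t^2+O(t),\qquad t\to\infty.$$ If $u_0\ne0$, the coefficient of $t^2$ is strictly positive, so the motion is ballistic. -/

import Mathlib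

open MeasureTheory Set Filter Topology Asymptotics
open scoped SchwartzMap Laplacian

noncomputable section

namespace TFSE

/-- The Euclidean space `ℝ^d`. -/
abbrev Space (d : ℕ) : Type := EuclideanSpace ℝ (Fin d)

/-- The complex Hilbert space `L²(ℝ^d)` for the Lebesgue measure. -/
abbrev L2 (d : ℕ) : Type := Lp ℂ 2 (volume : Measure (Space d))

/-- `f` belongs to the domain `D(H₀) = H²(ℝ^d)` of `H₀ = -Δ`, and `H₀ f = g`. The Laplacian is taken
in the sense of (tempered) distributions. -/
def FreeHamiltonian {d : ℕ} (f g : L2 d) : Prop :=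
  TemperedDistribution.MemSobolev 2 2 (Lp.toTemperedDistribution f) ∧
    -(Δ (Lp.toTemperedDistribution f)) = Lp.toTemperedDistribution g

/-- For a function of time with derivative `v`, its Caputo derivative of order `α ∈ (0, 1]` exists at
time `t` and equals `w`: for `α < 1` it is
`Γ(1 - α)⁻¹ ∫₀ᵗ (t - s)^(-α) v(s) ds`, where the integral has to converge absolutely;
for `α = 1` it is the usual derivative. -/
def HasCaputo {d : ℕ} (α : ℝ) (v : ℝ → L2 d) (t : ℝ) (w : L2 d) : Prop :=
  if α = 1 then v t = w
  else IntegrableOn (fun s : ℝ => ((t - s) ^ (-α) : ℝ) • v s) (Ioo 0 t) ∧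
    (Real.Gamma (1 - α))⁻¹ • (∫ s in Ioo 0 t, ((t - s) ^ (-α) : ℝ) • v s) = w

/-- `u` is a solution on `(0, ∞)` of `-i^β ∂_t^α u + H₀ u = 0`, `u(0) = u₀`, that is,
* `u ∈ L¹_loc(ℝ₊; D(H₀))`, where `w(t) = H₀ u(t)` for almost every `t > 0`;
* `u ∈ W^{1,1}_loc(ℝ₊; L²)` with derivative `v`, and `u` is the continuous representative;
* the equation holds in `L²(ℝ^d)` for almost every `t > 0`, with `i^β = exp(iπβ/2)`;
* `‖u(t) - u₀‖ → 0` as `t ↓ 0`. -/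
def IsSolution {d : ℕ} (α β : ℝ) (u₀ : L2 d) (u : ℝ → L2 d) : Prop :=
  ∃ v w : ℝ → L2 d,
    LocallyIntegrableOn u (Ioi 0) ∧
    LocallyIntegrableOn w (Ioi 0) ∧
    (∀ᵐ t : ℝ, 0 < t → FreeHamiltonian (u t) (w t)) ∧
    LocallyIntegrableOn v (Ioi 0) ∧
    (∀ s t : ℝ, 0 < s → s ≤ t → u t - u s = ∫ r in s..t, v r) ∧
    (∀ᵐ t : ℝ, 0 < t → ∃ c : L2 d, HasCaputo α v t c ∧ -(Complex.I ^ (β : ℂ)) • c + w t = 0) ∧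
    Tendsto (fun t : ℝ => ‖u t - u₀‖) (𝓝[>] 0) (𝓝 0)

/-- The unitary Fourier transform `(2π)^(-d/2) ∫ e^{-i x·ξ} f(x) dx`. -/
def fourier {d : ℕ} (f : Space d → ℂ) (ξ : Space d) : ℂ :=
  (((2 * Real.pi) ^ (-(d : ℝ) / 2) : ℝ) : ℂ) *
    ∫ x : Space d, Complex.exp (-Complex.I * ((inner ℝ x ξ : ℝ) : ℂ)) * f x

/-- `|x|² |f(x)|²` is integrable, i.e. `f` has a finite mean-square displacement. -/
def FiniteMSD {d : ℕ} (f : L2 d) : Prop :=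
  Integrable (fun x : Space d => ‖x‖ ^ 2 * ‖f x‖ ^ 2)

/-- The mean-square displacement `∫ |x|² |f(x)|² dx`. -/
def msd {d : ℕ} (f : L2 d) : ℝ := ∫ x : Space d, ‖x‖ ^ 2 * ‖f x‖ ^ 2

/-- The ballistic coefficient `(4 / α⁴) ‖ |ξ|^((2-α)/α) û₀ ‖²`. -/
def ballisticCoeff {d : ℕ} (α : ℝ) (u₀ : 𝓢(Space d, ℂ)) : ℝ :=
  4 / α ^ 4 * ∫ ξ : Space d, (‖ξ‖ ^ ((2 - α) / α) * ‖fourier u₀ ξ‖) ^ 2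

end TFSE

end

/-
After a Fourier transform the equation decouples into scalar fractional equations, one for each
frequency `ξ`, solved by `relax α (ω t)` with `ω = ‖2πξ‖^(2/α)`. The function `relax α` is a
Mittag-Leffler function on a critical ray: its Laplace transform `s^(α-1) / (s^α - (-i)^α)` has a
single pole, at `s = -i`, and a cut along the negative axis, so that
`relax α τ = α⁻¹ e^{-iτ} + ∫₀^∞ e^{-rτ} ρ(r) dr` with an explicit density `ρ`. Uniqueness follows by
cutting off the frequencies, which makes `H₀` bounded, and inverting the fractional integral: the
difference of two solutions satisfies a homogeneous Volterra equation.

The weight `|x|²` becomes the gradient in `ξ`. Differentiating the phase `e^{-iωt}` produces a term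
of size exactly `t |∇ω| / α`, which gives the coefficient of `t²`. The gradient of the integral term
and that of `û₀` contribute a remainder whose product with the main term is `O(t)`: the decay of the
integral term in `τ = ω t` absorbs the derivative of `ω t`.
-/

noncomputable section

namespace TFSE

open Complex (I)
open scoped Real

section Contour

lemma eq_of_exp_eq_exp_of_abs_im_sub_lt {z w : ℂ} (him : |(w - z).im| < 2 * π)
    (h : Complex.exp w = Complex.exp z) : w = z := by
  obtain ⟨n, hn⟩ := Complex.exp_eq_exp_iff_exists_int.1 h
  have hsub : (w - z).im = n * (2 * π) := by simp [hn]
  have hn1 : |(n : ℝ)| < 1 := by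
    rw [hsub, abs_mul, abs_of_pos Real.two_pi_pos] at him
    exact lt_of_mul_lt_mul_right (by simpa using him) Real.two_pi_pos.le
  have hn0 : n = 0 := Int.abs_lt_one_iff.1 (by exact_mod_cast hn1)
  simpa [hn0] using hn

lemma exp_sub_exp_eq_mul_dslope (z w : ℂ) :
    Complex.exp w - Complex.exp z = (w - z) * dslope Complex.exp z w :=
  (sub_smul_dslope Complex.exp z w).symm

lemma differentiable_dslope_exp (z : ℂ) : Differentiable ℂ (dslope Complex.exp z) :=
  differentiableOn_univ.1 <|
    (Complex.differentiableOn_dslope univ_mem).2 Complex.differentiable_exp.differentiableOn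

lemma dslope_exp_ne_zero {z w : ℂ} (him : |(w - z).im| < 2 * π) :
    dslope Complex.exp z w ≠ 0 := by
  rcases eq_or_ne w z with rfl | hne
  · simp [dslope_same, Complex.exp_ne_zero]
  · intro h0
    refine hne (eq_of_exp_eq_exp_of_abs_im_sub_lt him (sub_eq_zero.1 ?_))
    rw [exp_sub_exp_eq_mul_dslope, h0, mul_zero]

lemma tendsto_intervalIntegral_vertical {g : ℂ → ℂ} {c : ℂ} {l : Filter ℝ}
    [l.IsCountablyGenerated] (hg : Tendsto g (comap Complex.re l) (𝓝 c)) {a b : ℝ}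
    (hcont : ∀ x : ℝ, ContinuousOn (fun y : ℝ => g (x + y * I)) (uIcc a b)) :
    Tendsto (fun x : ℝ => ∫ y in a..b, g (x + y * I)) l (𝓝 ((b - a) • c)) := by
  have hbound : ∀ᶠ x in l, ∀ w : ℂ, w.re = x → ‖g w‖ ≤ ‖c‖ + 1 :=
    eventually_comap.1 (hg.norm.eventually_le_const (lt_add_one _))
  have hline (y : ℝ) : Tendsto (fun x : ℝ => (x + y * I : ℂ)) l (comap Complex.re l) := by
    rw [tendsto_comap_iff]
    exact tendsto_id.congr fun x => by simp
  rw [← intervalIntegral.integral_const]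
  refine intervalIntegral.tendsto_integral_filter_of_dominated_convergence (fun _ => ‖c‖ + 1)
    (.of_forall fun x => ?_) ?_ intervalIntegrable_const
    (ae_of_all _ fun y _ => hg.comp (hline y))
  · exact ((hcont x).mono uIoc_subset_uIcc).aestronglyMeasurable measurableSet_uIoc
  · filter_upwards [hbound] with x hx
    exact ae_of_all _ fun y _ => hx _ (by simp)

/-- The horizontal strip `|Im w| < b`, a chart for the slit plane under `w ↦ e^w` when `b = π`. -/
def strip (b : ℝ) : Set ℂ := {w | |w.im| < b}

lemma isOpen_strip (b : ℝ) : IsOpen (strip b) :=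
  isOpen_lt (by fun_prop) continuous_const

lemma reProdIm_subset_strip {b : ℝ} (hb : π < b) (s : Set ℝ) :
    s ×ℂ uIcc (-π) π ⊆ strip b := by
  intro w hw
  have him := (Complex.mem_reProdIm.1 hw).2
  rw [uIcc_of_le (by linarith [Real.pi_pos])] at him
  exact (abs_le.2 him).trans_lt hb

lemma add_mul_I_mem_strip {b : ℝ} (hb : π < b) (x : ℝ) {y : ℝ} (hy : y ∈ uIcc (-π) π) :
    (x + y * I : ℂ) ∈ strip b :=
  reProdIm_subset_strip hb univ (Complex.mem_reProdIm.2 ⟨mem_univ _, by simpa using hy⟩)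

lemma exp_add_pi_mul_I (w : ℂ) : Complex.exp (w + π * I) = -Complex.exp w := by
  simp [Complex.exp_add]

lemma exp_sub_pi_mul_I (w : ℂ) : Complex.exp (w - π * I) = -Complex.exp w := by
  simp [Complex.exp_sub, div_neg]

lemma exp_add_exp_ofReal_ne_zero (x σ : ℝ) : Complex.exp x + Complex.exp σ ≠ 0 := by
  have : (0 : ℝ) < Real.exp x + Real.exp σ := by positivity
  exact_mod_cast this.ne'

lemma tendsto_intervalIntegral_sub_of_differentiableOn_strip {b : ℝ} (hb : π < b) {g : ℂ → ℂ}
    (hg : DifferentiableOn ℂ g (strip b)) {cl cr : ℂ}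
    (hl : Tendsto g (comap Complex.re atBot) (𝓝 cl))
    (hr : Tendsto g (comap Complex.re atTop) (𝓝 cr)) :
    Tendsto (fun X : ℝ => ∫ x in -X..X, (g (x - π * I) - g (x + π * I))) atTop
      (𝓝 (2 * π * I * (cl - cr))) := by
  have hvert (x : ℝ) : ContinuousOn (fun y : ℝ => g (x + y * I)) (uIcc (-π) π) :=
    hg.continuousOn.comp (by fun_prop) fun y hy => add_mul_I_mem_strip hb x hy
  have hhor {y : ℝ} (hy : y ∈ uIcc (-π) π) : Continuous fun x : ℝ => g (x + y * I) :=
    hg.continuousOn.comp_continuous (by fun_prop) fun x => add_mul_I_mem_strip hb x hy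
  have hrect (X : ℝ) : ∫ x in -X..X, (g (x - π * I) - g (x + π * I)) =
      I * (∫ y in -π..π, g ((-X : ℝ) + y * I)) - I * ∫ y in -π..π, g (X + y * I) := by
    have h := Complex.integral_boundary_rect_eq_zero_of_differentiableOn g ⟨-X, -π⟩ ⟨X, π⟩
      (hg.mono (reProdIm_subset_strip hb _))
    have hbot := (hhor left_mem_uIcc).intervalIntegrable (μ := volume) (-X) X
    have htop := (hhor right_mem_uIcc).intervalIntegrable (μ := volume) (-X) X
    simp only [smul_eq_mul] at h
    simp only [Complex.ofReal_neg, neg_mul, ← sub_eq_add_neg] at h hbot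
    rw [intervalIntegral.integral_sub hbot htop, Complex.ofReal_neg]
    linear_combination h
  simp_rw [hrect]
  have hleft := (tendsto_intervalIntegral_vertical hl hvert).comp tendsto_neg_atTop_atBot
  have hright := tendsto_intervalIntegral_vertical hr hvert
  have hval : 2 * π * I * (cl - cr) = I * ((π - -π) • cl) - I * ((π - -π) • cr) := by
    simp only [Complex.real_smul]
    push_cast
    ring
  rw [hval]
  exact (hleft.const_mul I).sub (hright.const_mul I)

lemma dslope_div_dslope_exp_of_ne (E : ℂ → ℂ) {z w : ℂ} (hw : w ≠ z) :
    dslope E z w / dslope Complex.exp z w = (E w - E z) / (Complex.exp w - Complex.exp z) := by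
  rw [exp_sub_exp_eq_mul_dslope, ← sub_smul_dslope E, smul_eq_mul,
    mul_div_mul_left _ _ (sub_ne_zero.2 hw)]

lemma div_exp_sub_exp_eventuallyEq_comap_re (E : ℂ → ℂ) {σ : ℝ} {l : Filter ℝ}
    (hl : ∀ᶠ x in l, x ≠ σ) :
    (fun w => (E w - E σ) / (Complex.exp w - Complex.exp σ)) =ᶠ[comap Complex.re l]
      fun w => dslope E σ w / dslope Complex.exp σ w :=
  eventually_comap.2 <| hl.mono fun x hx w hw =>
    (dslope_div_dslope_exp_of_ne E fun h => hx (by rw [← hw, h, Complex.ofReal_re])).symm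

lemma tendsto_dslope_div_dslope_exp_atBot {E : ℂ → ℂ}
    (hE : Tendsto E (comap Complex.re atBot) (𝓝 0)) (σ : ℝ) :
    Tendsto (fun w => dslope E σ w / dslope Complex.exp σ w) (comap Complex.re atBot)
      (𝓝 (E σ / Complex.exp σ)) := by
  have hquot := (hE.sub_const (E σ)).div (Complex.tendsto_exp_comap_re_atBot.sub_const _)
    (by simp [Complex.exp_ne_zero] : 0 - Complex.exp σ ≠ 0)
  simpa [neg_div_neg_eq] using
    hquot.congr' (div_exp_sub_exp_eventuallyEq_comap_re E (eventually_ne_atBot σ))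

lemma tendsto_dslope_div_dslope_exp_atTop {E : ℂ → ℂ} {c : ℂ}
    (hE : Tendsto E (comap Complex.re atTop) (𝓝 c)) (σ : ℝ) :
    Tendsto (fun w => dslope E σ w / dslope Complex.exp σ w) (comap Complex.re atTop) (𝓝 0) := by
  have hexp : Tendsto (fun w => (Complex.exp w - Complex.exp σ)⁻¹) (comap Complex.re atTop)
      (𝓝 0) := by
    simpa [sub_eq_add_neg, Function.comp_def] using tendsto_inv₀_cobounded.comp
      ((tendsto_add_const_cobounded _).comp Complex.tendsto_exp_comap_re_atTop)
  simpa [div_eq_mul_inv] using ((hE.sub_const (E σ)).mul hexp).congr'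
    (div_exp_sub_exp_eventuallyEq_comap_re E (eventually_ne_atTop σ))

-- Cauchy's theorem for `(E w - E σ) / (e^w - e^σ)`: subtracting the constant `E σ` removes the pole
-- at `σ` and does not change the jump across the strip, as `e^w` is `2πi`-periodic.
theorem tendsto_intervalIntegral_jump_div_exp_add_exp {b : ℝ} (hb : π < b) (hb' : b ≤ 2 * π)
    {E : ℂ → ℂ} (hE : DifferentiableOn ℂ E (strip b))
    (hl : Tendsto E (comap Complex.re atBot) (𝓝 0)) {c : ℂ}
    (hr : Tendsto E (comap Complex.re atTop) (𝓝 c)) (σ : ℝ) :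
    Tendsto (fun X : ℝ => ∫ x in -X..X,
        (E (x + π * I) - E (x - π * I)) / (Complex.exp x + Complex.exp σ)) atTop
      (𝓝 (2 * π * I * (E σ / Complex.exp σ))) := by
  have hσ : (σ : ℂ) ∈ strip b := by simpa [strip] using Real.pi_pos.trans hb
  have hdiff : DifferentiableOn ℂ (fun w => dslope E σ w / dslope Complex.exp σ w) (strip b) :=
    ((Complex.differentiableOn_dslope ((isOpen_strip b).mem_nhds hσ)).2 hE).div
      (differentiable_dslope_exp σ).differentiableOn
      fun w hw => dslope_exp_ne_zero (by simpa using hw.trans_le hb')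
  have hjump (x : ℝ) : (E (x + π * I) - E (x - π * I)) / (Complex.exp x + Complex.exp σ) =
      dslope E σ (x - π * I) / dslope Complex.exp σ (x - π * I) -
        dslope E σ (x + π * I) / dslope Complex.exp σ (x + π * I) := by
    have hne := exp_add_exp_ofReal_ne_zero x σ
    have hne' : -Complex.exp x - Complex.exp σ ≠ 0 := by
      rwa [← neg_add', neg_ne_zero]
    have hπ : π ≠ 0 := Real.pi_ne_zero
    rw [dslope_div_dslope_exp_of_ne E fun h => hπ (by simpa using congrArg Complex.im h),
      dslope_div_dslope_exp_of_ne E fun h => hπ (by simpa using congrArg Complex.im h),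
      exp_add_pi_mul_I, exp_sub_pi_mul_I]
    field_simp
    ring
  simp_rw [hjump]
  simpa using tendsto_intervalIntegral_sub_of_differentiableOn_strip hb hdiff
    (tendsto_dslope_div_dslope_exp_atBot hl σ) (tendsto_dslope_div_dslope_exp_atTop hr σ)

end Contour

section StieltjesRepresentation

lemma tendsto_div_sub_cobounded (p : ℂ) :
    Tendsto (fun z : ℂ => z / (z - p)) (Bornology.cobounded ℂ) (𝓝 1) := by
  have hinv : Tendsto (fun z : ℂ => 1 + p * (z - p)⁻¹) (Bornology.cobounded ℂ) (𝓝 1) := by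
    simpa using ((tendsto_inv₀_cobounded.comp (tendsto_sub_const_cobounded p)).const_mul
      p).const_add (1 : ℂ)
  refine hinv.congr' ?_
  filter_upwards [Bornology.isBounded_def.1 (Bornology.isBounded_singleton (x := p))] with z hz
  have : z - p ≠ 0 := sub_ne_zero.2 hz
  field_simp
  ring

lemma tendsto_div_sub_zero {p : ℂ} (hp : p ≠ 0) :
    Tendsto (fun z : ℂ => z / (z - p)) (𝓝 0) (𝓝 0) := by
  have h : ContinuousAt (fun z : ℂ => z / (z - p)) 0 :=
    continuousAt_id.div (by fun_prop) (by simpa using hp)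
  simpa [ContinuousAt] using h

/-- `s ↦ s^a / (s^a - z^a) - a⁻¹ s / (s - z)` in the logarithmic coordinates `s = e^w`,
`z = e^{z₀}`. The second fraction cancels the pole of the first at `s = z`. -/
def logResolvent (a : ℝ) (z₀ w : ℂ) : ℂ :=
  Complex.exp (a * w) / (Complex.exp (a * w) - Complex.exp (a * z₀)) -
    (a : ℂ)⁻¹ * (Complex.exp w / (Complex.exp w - Complex.exp z₀))

lemma tendsto_ofReal_mul_comap_re {a : ℝ} {l : Filter ℝ} (hl : Tendsto (a * ·) l l) :
    Tendsto (fun w : ℂ => a * w) (comap Complex.re l) (comap Complex.re l) := by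
  rw [tendsto_comap_iff]
  exact (hl.comp tendsto_comap).congr fun w => by simp

lemma tendsto_logResolvent_atBot {a : ℝ} (ha : 0 < a) (z₀ : ℂ) :
    Tendsto (logResolvent a z₀) (comap Complex.re atBot) (𝓝 0) := by
  have hlin := tendsto_ofReal_mul_comap_re (tendsto_id.const_mul_atBot ha)
  have h := ((tendsto_div_sub_zero (Complex.exp_ne_zero (a * z₀))).comp
    (Complex.tendsto_exp_comap_re_atBot.comp hlin)).sub
    (((tendsto_div_sub_zero (Complex.exp_ne_zero z₀)).comp
      Complex.tendsto_exp_comap_re_atBot).const_mul (a : ℂ)⁻¹)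
  rwa [mul_zero, sub_zero] at h

lemma tendsto_logResolvent_atTop {a : ℝ} (ha : 0 < a) (z₀ : ℂ) :
    Tendsto (logResolvent a z₀) (comap Complex.re atTop) (𝓝 (1 - (a : ℂ)⁻¹)) := by
  have hlin := tendsto_ofReal_mul_comap_re (tendsto_id.const_mul_atTop ha)
  have h := ((tendsto_div_sub_cobounded (Complex.exp (a * z₀))).comp
    (Complex.tendsto_exp_comap_re_atTop.comp hlin)).sub
    (((tendsto_div_sub_cobounded (Complex.exp z₀)).comp
      Complex.tendsto_exp_comap_re_atTop).const_mul (a : ℂ)⁻¹)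
  rwa [mul_one] at h

lemma exists_differentiableOn_eq_logResolvent {a b : ℝ} (ha : 0 < a) (ha1 : a ≤ 1) {z₀ : ℂ}
    (hz₀ : z₀ ∈ strip b) (hb : b + |z₀.im| ≤ 2 * π) :
    ∃ E : ℂ → ℂ, DifferentiableOn ℂ E (strip b) ∧ ∀ w ≠ z₀, E w = logResolvent a z₀ w := by
  have ha0 : (a : ℂ) ≠ 0 := by exact_mod_cast ha.ne'
  have him {w : ℂ} (hw : w ∈ strip b) : |(w - z₀).im| < 2 * π :=
    (abs_sub w.im z₀.im).trans_lt (by linarith [show |w.im| < b from hw])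
  have hima {w : ℂ} (hw : w ∈ strip b) : |(a * w - a * z₀).im| < 2 * π := by
    rw [← mul_sub, Complex.im_ofReal_mul, abs_mul, abs_of_pos ha]
    exact (mul_le_of_le_one_left (abs_nonneg _) ha1).trans_lt (him hw)
  set M : ℂ → ℂ := fun w => (a : ℂ)⁻¹ * (Complex.exp (a * w) /
    dslope Complex.exp (a * z₀) (a * w) - Complex.exp w / dslope Complex.exp z₀ w) with hM
  have hdiff : DifferentiableOn ℂ M (strip b) := by
    refine ((DifferentiableOn.div (by fun_prop) ?_ fun w hw => dslope_exp_ne_zero (hima hw)).sub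
      (DifferentiableOn.div (by fun_prop) ?_ fun w hw => dslope_exp_ne_zero (him hw))).const_mul _
    · exact ((differentiable_dslope_exp _).comp (by fun_prop)).differentiableOn
    · exact (differentiable_dslope_exp _).differentiableOn
  have hM0 : M z₀ = 0 := by simp [hM, dslope_same, Complex.exp_ne_zero]
  refine ⟨Function.update (logResolvent a z₀) z₀ (dslope M z₀ z₀), ?_,
    fun w hw => Function.update_of_ne hw _ _⟩
  refine ((Complex.differentiableOn_dslope ((isOpen_strip b).mem_nhds hz₀)).2 hdiff).congr
    fun w hw => ?_
  rcases eq_or_ne w z₀ with rfl | hne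
  · rw [Function.update_self]
  · have hsub : w - z₀ ≠ 0 := sub_ne_zero.2 hne
    have h1 := dslope_exp_ne_zero (him hw)
    have h2 := dslope_exp_ne_zero (hima hw)
    rw [Function.update_of_ne hne, dslope_of_ne _ hne, slope_def_field, hM0, sub_zero,
      logResolvent, exp_sub_exp_eq_mul_dslope, exp_sub_exp_eq_mul_dslope, ← mul_sub]
    simp only [hM]
    field_simp

end StieltjesRepresentation

section RelaxDensity

/-- The number `(-i)^α`. -/
def phase (α : ℝ) : ℂ := Complex.exp (-(π * α / 2 : ℝ) * I)

/-- The number `(-i)^α e^{-iπα}`, the pole in `r^α` of the boundary value of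
`s^{α-1} / (s^α - (-i)^α)` at `s = e^{iπ} r`. -/
def lowerPhase (α : ℝ) : ℂ := Complex.exp (-(3 * π * α / 2 : ℝ) * I)

/-- The number `(-i)^α e^{iπα}`, the pole in `r^α` of the boundary value of
`s^{α-1} / (s^α - (-i)^α)` at `s = e^{-iπ} r`. -/
def upperPhase (α : ℝ) : ℂ := Complex.exp ((π * α / 2 : ℝ) * I)

/-- The spectral density of the relaxation function `relax`: the jump of
`s^{α-1} / (s^α - (-i)^α)` across the negative half-line at `s = -r`, divided by `2πi`. -/
def relaxDensity (α r : ℝ) : ℂ :=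
  (lowerPhase α - upperPhase α) / (2 * π * I) * (r ^ (α - 1) : ℝ) /
    (((r ^ α : ℝ) - lowerPhase α) * ((r ^ α : ℝ) - upperPhase α))

lemma norm_phase (α : ℝ) : ‖phase α‖ = 1 := by
  rw [phase, ← Complex.ofReal_neg, Complex.norm_exp_ofReal_mul_I]

lemma norm_lowerPhase (α : ℝ) : ‖lowerPhase α‖ = 1 := by
  rw [lowerPhase, ← Complex.ofReal_neg, Complex.norm_exp_ofReal_mul_I]

lemma norm_upperPhase (α : ℝ) : ‖upperPhase α‖ = 1 := by
  rw [upperPhase, Complex.norm_exp_ofReal_mul_I]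

lemma exp_ofReal_mul_I_ne_one {θ : ℝ} (hθ0 : θ ≠ 0) (hθ : |θ| < 2 * π) :
    Complex.exp (θ * I) ≠ 1 := fun h => by
  have : (θ * I : ℂ) = 0 :=
    eq_of_exp_eq_exp_of_abs_im_sub_lt (by simpa using hθ) (h.trans Complex.exp_zero.symm)
  simp_all

variable {α : ℝ}

lemma phase_ne_one (hα : 0 < α) (hα1 : α ≤ 1) : phase α ≠ 1 := by
  have hpos : 0 < π * α / 2 := by positivity
  rw [phase, ← Complex.ofReal_neg]
  exact exp_ofReal_mul_I_ne_one (neg_ne_zero.2 hpos.ne')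
    (by rw [abs_neg, abs_of_pos hpos]; nlinarith [Real.pi_pos])

lemma lowerPhase_ne_one (hα : 0 < α) (hα1 : α ≤ 1) : lowerPhase α ≠ 1 := by
  have hpos : 0 < 3 * π * α / 2 := by positivity
  rw [lowerPhase, ← Complex.ofReal_neg]
  exact exp_ofReal_mul_I_ne_one (neg_ne_zero.2 hpos.ne')
    (by rw [abs_neg, abs_of_pos hpos]; nlinarith [Real.pi_pos])

lemma upperPhase_ne_one (hα : 0 < α) (hα1 : α ≤ 1) : upperPhase α ≠ 1 := by
  have hpos : 0 < π * α / 2 := by positivity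
  exact exp_ofReal_mul_I_ne_one hpos.ne' (by rw [abs_of_pos hpos]; nlinarith [Real.pi_pos])

lemma norm_sub_one_mul_le_norm_ofReal_sub {z : ℂ} (hz : ‖z‖ = 1) {x : ℝ} (hx : 0 ≤ x) :
    ‖z - 1‖ * (1 + x) ≤ 6 * ‖(x : ℂ) - z‖ := by
  have hx1 : |x - 1| ≤ ‖(x : ℂ) - z‖ := by
    simpa [hz, abs_of_nonneg hx] using abs_norm_sub_norm_le (x : ℂ) z
  have hz1 : ‖z - 1‖ ≤ ‖(x : ℂ) - z‖ + |x - 1| := by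
    have := norm_sub_le_norm_sub_add_norm_sub z x 1
    rwa [norm_sub_rev z x, ← Complex.ofReal_one, ← Complex.ofReal_sub, Complex.norm_real,
      Real.norm_eq_abs, Complex.ofReal_one] at this
  have hz2 : ‖z - 1‖ ≤ 2 := by
    simpa [hz, one_add_one_eq_two] using norm_sub_le z 1
  nlinarith [norm_nonneg (z - 1), norm_nonneg ((x : ℂ) - z), (abs_le.1 hx1).2]

lemma ofReal_sub_ne_zero {z : ℂ} (hz : ‖z‖ = 1) (hz1 : z ≠ 1) {x : ℝ} (hx : 0 ≤ x) :
    (x : ℂ) - z ≠ 0 := fun h => by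
  have := norm_sub_one_mul_le_norm_ofReal_sub hz hx
  rw [h, norm_zero, mul_zero] at this
  nlinarith [norm_pos_iff.2 (sub_ne_zero.2 hz1)]

lemma exists_norm_relaxDensity_le (hα : 0 < α) (hα1 : α ≤ 1) :
    ∃ C : ℝ, 0 < C ∧ ∀ r : ℝ, 0 < r →
      ‖relaxDensity α r‖ ≤ C * (r ^ (α - 1) / (1 + r ^ α) ^ 2) := by
  have hl : 0 < ‖lowerPhase α - 1‖ := norm_pos_iff.2 (sub_ne_zero.2 (lowerPhase_ne_one hα hα1))
  have hu : 0 < ‖upperPhase α - 1‖ := norm_pos_iff.2 (sub_ne_zero.2 (upperPhase_ne_one hα hα1))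
  set c := ‖(lowerPhase α - upperPhase α) / (2 * π * I)‖ with hc
  refine ⟨(c + 1) * (36 / (‖lowerPhase α - 1‖ * ‖upperPhase α - 1‖)), by positivity,
    fun r hr => ?_⟩
  have hra : 0 < r ^ α := Real.rpow_pos_of_pos hr _
  have hra1 : 0 < r ^ (α - 1) := Real.rpow_pos_of_pos hr _
  have hden := mul_le_mul
    (norm_sub_one_mul_le_norm_ofReal_sub (norm_lowerPhase α) hra.le)
    (norm_sub_one_mul_le_norm_ofReal_sub (norm_upperPhase α) hra.le) (by positivity) (by positivity)
  have hden' : ‖lowerPhase α - 1‖ * ‖upperPhase α - 1‖ * (1 + r ^ α) ^ 2 / 36 ≤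
      ‖((r ^ α : ℝ) : ℂ) - lowerPhase α‖ * ‖((r ^ α : ℝ) : ℂ) - upperPhase α‖ := by
    linarith
  calc ‖relaxDensity α r‖ = c * r ^ (α - 1) /
        (‖((r ^ α : ℝ) : ℂ) - lowerPhase α‖ * ‖((r ^ α : ℝ) : ℂ) - upperPhase α‖) := by
        rw [relaxDensity, norm_div, norm_mul, norm_mul, ← hc, Complex.norm_real,
          Real.norm_of_nonneg hra1.le]
    _ ≤ (c + 1) * r ^ (α - 1) /
        (‖lowerPhase α - 1‖ * ‖upperPhase α - 1‖ * (1 + r ^ α) ^ 2 / 36) := by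
        gcongr; linarith
    _ = _ := by field_simp

lemma relaxDensity_one (r : ℝ) : relaxDensity 1 r = 0 := by
  have : lowerPhase 1 = upperPhase 1 :=
    Complex.exp_eq_exp_iff_exists_int.2 ⟨-1, by push_cast; ring⟩
  simp [relaxDensity, this]

lemma measurable_relaxDensity (α : ℝ) : Measurable (relaxDensity α) := by
  unfold relaxDensity; fun_prop

lemma integrableOn_rpow_div_one_add_rpow_sq (hα : 0 < α) :
    IntegrableOn (fun r : ℝ => r ^ (α - 1) / (1 + r ^ α) ^ 2) (Ioi 0) := by
  have hderiv (r : ℝ) (hr : r ∈ Ioi (0 : ℝ)) : HasDerivAt (fun r : ℝ => -α⁻¹ * (1 + r ^ α)⁻¹)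
      (r ^ (α - 1) / (1 + r ^ α) ^ 2) r := by
    have hne : 1 + r ^ α ≠ 0 := (add_pos one_pos (Real.rpow_pos_of_pos hr α)).ne'
    refine ((((Real.hasDerivAt_rpow_const (p := α) (Or.inl (ne_of_gt hr))).const_add
      1).fun_inv hne).const_mul (-α⁻¹)).congr_deriv ?_
    field_simp
  refine integrableOn_Ioi_deriv_of_nonneg (l := -α⁻¹ * 0) ?_ hderiv (fun r hr => ?_) ?_
  · have h0 : (1 : ℝ) + 0 ^ α ≠ 0 := by simp [Real.zero_rpow hα.ne']
    exact (continuousAt_const.mul ((continuousAt_const.add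
      (Real.continuousAt_rpow_const 0 α (Or.inr hα.le))).inv₀ h0)).continuousWithinAt
  · have : (0 : ℝ) < r := hr
    positivity
  · exact (tendsto_atTop_add_const_left _ 1 (tendsto_rpow_atTop hα)).inv_tendsto_atTop.const_mul _

lemma integrableOn_relaxDensity (hα : 0 < α) (hα1 : α ≤ 1) :
    IntegrableOn (relaxDensity α) (Ioi 0) := by
  obtain ⟨C, -, hC⟩ := exists_norm_relaxDensity_le hα hα1
  exact Integrable.mono' ((integrableOn_rpow_div_one_add_rpow_sq hα).const_mul C)
    (measurable_relaxDensity α).aestronglyMeasurable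
    ((ae_restrict_iff' measurableSet_Ioi).2 (ae_of_all _ hC))

lemma logResolvent_jump (hα : 0 < α) (hα1 : α ≤ 1) (x : ℝ) :
    logResolvent α (-(π / 2 : ℝ) * I) (x + π * I) - logResolvent α (-(π / 2 : ℝ) * I) (x - π * I) =
      2 * π * I * (Real.exp x • relaxDensity α (Real.exp x)) := by
  have hpow : Complex.exp (α * x) = ((Real.exp x ^ α : ℝ) : ℂ) := by
    rw [← Real.exp_mul, mul_comm]; push_cast; rfl
  have hadd : Complex.exp (α * (x + π * I)) = Complex.exp (α * x) * Complex.exp (π * α * I) := by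
    rw [← Complex.exp_add]; ring_nf
  have hsub : Complex.exp (α * (x - π * I)) = Complex.exp (α * x) / Complex.exp (π * α * I) := by
    rw [← Complex.exp_sub]; ring_nf
  have hlower : Complex.exp (α * (-(π / 2 : ℝ) * I)) =
      lowerPhase α * Complex.exp (π * α * I) := by
    rw [lowerPhase, ← Complex.exp_add]; push_cast; ring_nf
  have hupper : upperPhase α = lowerPhase α * Complex.exp (π * α * I) ^ 2 := by
    rw [lowerPhase, upperPhase, ← Complex.exp_nat_mul, ← Complex.exp_add]; push_cast; ring_nf
  have hra : 0 ≤ Real.exp x ^ α := by positivity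
  have hl := ofReal_sub_ne_zero (norm_lowerPhase α) (lowerPhase_ne_one hα hα1) hra
  have hu := ofReal_sub_ne_zero (norm_upperPhase α) (upperPhase_ne_one hα hα1) hra
  have hrot := Complex.exp_ne_zero (π * α * I)
  have hexp := Complex.exp_ne_zero x
  rw [logResolvent, logResolvent, exp_add_pi_mul_I, exp_sub_pi_mul_I, sub_sub_sub_cancel_right,
    hadd, hsub, hlower, hpow, relaxDensity, Complex.real_smul,
    Real.rpow_sub_one (Real.exp_ne_zero x), Complex.ofReal_div, Complex.ofReal_exp]
  rw [hupper] at hu ⊢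
  generalize ((Real.exp x ^ α : ℝ) : ℂ) = R at *
  generalize Complex.exp (π * α * I) = e at *
  have h1 : R * e - lowerPhase α * e = e * (R - lowerPhase α) := by ring
  have h2 : R / e - lowerPhase α * e = (R - lowerPhase α * e ^ 2) / e := by field_simp
  have hπ : (π : ℂ) ≠ 0 := by exact_mod_cast Real.pi_ne_zero
  have h3 : lowerPhase α - lowerPhase α * e ^ 2 =
      (R - lowerPhase α * e ^ 2) - (R - lowerPhase α) := by ring
  rw [h1, h2, h3]
  generalize R - lowerPhase α = A at *
  generalize R - lowerPhase α * e ^ 2 = B at *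
  field_simp [Complex.I_ne_zero]

lemma integrable_exp_smul_comp_exp_iff {F : Type*} [NormedAddCommGroup F] [NormedSpace ℝ F]
    {g : ℝ → F} : Integrable (fun x => Real.exp x • g (Real.exp x)) ↔ IntegrableOn g (Ioi 0) := by
  simpa [Real.range_exp, Real.abs_exp] using (integrableOn_image_iff_integrableOn_abs_deriv_smul
    MeasurableSet.univ (fun x _ => (Real.hasDerivAt_exp x).hasDerivWithinAt)
    Real.exp_injective.injOn g).symm

lemma integral_exp_smul_comp_exp {F : Type*} [NormedAddCommGroup F] [NormedSpace ℝ F]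
    (g : ℝ → F) : ∫ x, Real.exp x • g (Real.exp x) = ∫ r in Ioi 0, g r := by
  simpa [Real.range_exp, Real.abs_exp] using (integral_image_eq_integral_abs_deriv_smul
    MeasurableSet.univ (fun x _ => (Real.hasDerivAt_exp x).hasDerivWithinAt)
    Real.exp_injective.injOn g).symm

lemma integrableOn_relaxDensity_div (hα : 0 < α) (hα1 : α ≤ 1) {s : ℝ} (hs : 0 < s) :
    IntegrableOn (fun r => relaxDensity α r / (r + s)) (Ioi 0) := by
  refine ((integrableOn_relaxDensity hα hα1).norm.mul_const s⁻¹).mono'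
    ((measurable_relaxDensity α).div (by fun_prop)).aestronglyMeasurable
    ((ae_restrict_iff' measurableSet_Ioi).2 (ae_of_all _ fun r (hr : 0 < r) => ?_))
  rw [norm_div, ← Complex.ofReal_add, Complex.norm_real, Real.norm_of_nonneg (by positivity),
    div_eq_mul_inv]
  gcongr
  linarith

theorem integral_relaxDensity_div (hα : 0 < α) (hα1 : α ≤ 1) {s : ℝ} (hs : 0 < s) :
    ∫ r in Ioi (0 : ℝ), relaxDensity α r / (r + s) =
      (s ^ (α - 1) : ℝ) / ((s ^ α : ℝ) - phase α) - 1 / (α * (s + I)) := by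
  obtain ⟨σ, rfl⟩ : ∃ σ, Real.exp σ = s := ⟨_, Real.exp_log hs⟩
  set z₀ : ℂ := -(π / 2 : ℝ) * I with hz₀
  have hexpz₀ : Complex.exp z₀ = -I := by
    rw [hz₀, neg_mul, Complex.exp_neg, Complex.ofReal_div, Complex.ofReal_ofNat,
      Complex.exp_pi_div_two_mul_I, Complex.inv_I]
  have hexpαz₀ : Complex.exp (α * z₀) = phase α := by
    rw [phase, hz₀]; push_cast; ring_nf
  have him : |z₀.im| = π / 2 := by simp [hz₀, div_nonneg Real.pi_pos.le]
  obtain ⟨E, hE, hE_eq⟩ := exists_differentiableOn_eq_logResolvent (b := 3 * π / 2) hα hα1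
    (z₀ := z₀) (him.trans_lt (by linarith [Real.pi_pos])) (by linarith)
  have hE_re {l : Filter ℝ} (hl : ∀ᶠ x in l, x ≠ 0) :
      logResolvent α z₀ =ᶠ[comap Complex.re l] E :=
    eventually_comap.2 <| hl.mono fun x hx w hw =>
      (hE_eq w fun h => hx (by simp [← hw, h, hz₀])).symm
  have hne_z₀ {w : ℂ} (hw : w.im ≠ -(π / 2)) : w ≠ z₀ := fun h => hw (by simp [h, hz₀])
  have hjump (x : ℝ) : (E (x + π * I) - E (x - π * I)) / (Complex.exp x + Complex.exp σ) =
      2 * π * I * (Real.exp x • (relaxDensity α (Real.exp x) / (Real.exp x + Real.exp σ))) := by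
    have hπ := Real.pi_pos
    rw [hE_eq _ (hne_z₀ (by simp; linarith)), hE_eq _ (hne_z₀ (by simp; linarith)),
      logResolvent_jump hα hα1, mul_div_assoc, smul_div_assoc]
    push_cast
    rfl
  have hcontour := tendsto_intervalIntegral_jump_div_exp_add_exp (by linarith [Real.pi_pos])
    (by linarith [Real.pi_pos]) hE
    ((tendsto_logResolvent_atBot hα z₀).congr' (hE_re (eventually_ne_atBot 0)))
    ((tendsto_logResolvent_atTop hα z₀).congr' (hE_re (eventually_ne_atTop 0))) σ
  simp_rw [hjump, intervalIntegral.integral_const_mul] at hcontour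
  have hlim := (intervalIntegral_tendsto_integral
    (integrable_exp_smul_comp_exp_iff.2 (integrableOn_relaxDensity_div hα hα1 hs))
    tendsto_neg_atTop_atBot tendsto_id).const_mul (2 * π * I : ℂ)
  rw [integral_exp_smul_comp_exp (fun r => relaxDensity α r / (r + Real.exp σ))] at hlim
  rw [mul_left_cancel₀ Complex.two_pi_I_ne_zero (tendsto_nhds_unique hlim hcontour),
    hE_eq _ (hne_z₀ (by simp [Real.pi_ne_zero])), logResolvent, hexpz₀, hexpαz₀,
    Real.rpow_sub_one (Real.exp_ne_zero σ), ← Real.exp_mul, sub_neg_eq_add, mul_comm σ α]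
  push_cast
  have := Complex.exp_ne_zero σ
  field_simp

end RelaxDensity

section AbelIntegral

variable {F : Type*} [NormedAddCommGroup F] [NormedSpace ℝ F] {a b t : ℝ}

/-- The Abel integral `∫₀ᵗ (t - s)^a f(s) ds`. -/
def abelIntegral (a : ℝ) (f : ℝ → F) (t : ℝ) : F := ∫ s in Ioo 0 t, ((t - s) ^ a : ℝ) • f s

lemma integrableOn_Icc_rpow (ha : -1 < a) (ht : 0 ≤ t) :
    IntegrableOn (fun s : ℝ => s ^ a) (Icc 0 t) := by
  rw [integrableOn_Icc_iff_integrableOn_Ioc, ← intervalIntegrable_iff_integrableOn_Ioc_of_le ht]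
  exact intervalIntegral.intervalIntegrable_rpow' ha

lemma integrableOn_Icc_sub_rpow {r : ℝ} (ha : -1 < a) (hr : r ≤ t) :
    IntegrableOn (fun s : ℝ => (t - s) ^ a) (Icc r t) := by
  rw [integrableOn_Icc_iff_integrableOn_Ioc, ← intervalIntegrable_iff_integrableOn_Ioc_of_le hr]
  simpa using (intervalIntegral.intervalIntegrable_rpow' (a := 0) (b := t - r) ha).comp_sub_left
    t |>.symm

lemma integrableOn_Ioo_sub_rpow_mul_rpow (ha : -1 < a) (hb : -1 < b) :
    IntegrableOn (fun s : ℝ => (t - s) ^ a * s ^ b) (Ioo 0 t) := by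
  rcases le_or_gt t 0 with ht | ht
  · simp [Ioo_eq_empty ht.not_gt]
  have hleft : IntegrableOn (fun s : ℝ => (t - s) ^ a * s ^ b) (Icc 0 (t / 2)) :=
    (integrableOn_Icc_rpow hb (by positivity)).continuousOn_mul
      (ContinuousOn.rpow_const (by fun_prop) fun s hs => Or.inl (by linarith [hs.2])) isCompact_Icc
  have hright : IntegrableOn (fun s : ℝ => (t - s) ^ a * s ^ b) (Icc (t / 2) t) :=
    (integrableOn_Icc_sub_rpow ha (by linarith)).mul_continuousOn
      (ContinuousOn.rpow_const (by fun_prop) fun s hs => Or.inl (by linarith [hs.1])) isCompact_Icc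
  refine (hleft.union hright).mono_set ?_
  rw [Icc_union_Icc_eq_Icc (show (0 : ℝ) ≤ t / 2 by positivity) (half_le_self ht.le)]
  exact Ioo_subset_Icc_self

lemma abelIntegral_eq_smul_integral (f : ℝ → F) (ht : 0 < t) :
    abelIntegral a f t = t ^ (a + 1) • ∫ x in Ioo (0 : ℝ) 1, ((1 - x) ^ a : ℝ) • f (t * x) := by
  have hscale := intervalIntegral.integral_comp_mul_left (a := 0) (b := 1)
    (fun s => ((t - s) ^ a : ℝ) • f s) ht.ne'
  rw [mul_zero, mul_one, intervalIntegral.integral_of_le zero_le_one,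
    intervalIntegral.integral_of_le ht.le, integral_Ioc_eq_integral_Ioo,
    integral_Ioc_eq_integral_Ioo, eq_inv_smul_iff₀ ht.ne'] at hscale
  rw [abelIntegral, ← hscale, Real.rpow_add_one ht.ne', mul_comm, mul_smul, ← integral_smul (t ^ a)]
  congr 1
  refine setIntegral_congr_fun measurableSet_Ioo fun x hx => ?_
  simp only [smul_smul]
  rw [← Real.mul_rpow ht.le (by linarith [hx.2]), mul_sub, mul_one]

lemma continuousOn_abelIntegral {C : ℝ} {f : ℝ → F} (ha : -1 < a) (hb : -1 < b) (hb0 : b ≤ 0)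
    (hf : ContinuousOn f (Ioi 0)) (hfb : ∀ s, 0 < s → ‖f s‖ ≤ C * (1 + s ^ b)) :
    ContinuousOn (abelIntegral a f) (Ioi 0) := by
  refine ContinuousOn.congr (fun τ (hτ : 0 < τ) => ContinuousAt.continuousWithinAt ?_)
    fun τ hτ => abelIntegral_eq_smul_integral f hτ
  refine (Real.continuousAt_rpow_const _ _ (Or.inl hτ.ne')).smul ?_
  refine continuousAt_of_dominated (bound := fun x => C * ((1 - x) ^ a * x ^ (0 : ℝ)) +
    C * (τ / 2) ^ b * ((1 - x) ^ a * x ^ b)) ?_ ?_ ?_ ?_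
  · filter_upwards [Ioi_mem_nhds hτ] with t (ht : 0 < t)
    refine (Measurable.aestronglyMeasurable (by fun_prop)).smul
      (ContinuousOn.aestronglyMeasurable ?_ measurableSet_Ioo)
    exact hf.comp (by fun_prop) fun x hx => mul_pos ht hx.1
  · filter_upwards [Ioi_mem_nhds (by linarith : τ / 2 < τ)] with t (ht : τ / 2 < t)
    refine (ae_restrict_iff' measurableSet_Ioo).2 (ae_of_all _ fun x hx => ?_)
    have hweight : 0 ≤ (1 - x) ^ a := Real.rpow_nonneg (by linarith [hx.2]) _
    have hC : 0 ≤ C := by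
      have := (norm_nonneg _).trans (hfb 1 one_pos)
      rw [Real.one_rpow] at this
      linarith
    have hpow : (t * x) ^ b ≤ (τ / 2) ^ b * x ^ b := by
      rw [← Real.mul_rpow (by positivity) hx.1.le]
      exact Real.rpow_le_rpow_of_nonpos (mul_pos (by positivity) hx.1)
        (mul_le_mul_of_nonneg_right ht.le hx.1.le) hb0
    rw [norm_smul, Real.norm_of_nonneg hweight, Real.rpow_zero]
    calc (1 - x) ^ a * ‖f (t * x)‖
        ≤ (1 - x) ^ a * (C * (1 + (τ / 2) ^ b * x ^ b)) := by
          gcongr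
          exact (hfb _ (mul_pos (by linarith) hx.1)).trans (by gcongr)
      _ = _ := by ring
  · exact ((integrableOn_Ioo_sub_rpow_mul_rpow ha (by norm_num)).const_mul _).add
      ((integrableOn_Ioo_sub_rpow_mul_rpow ha hb).const_mul _)
  · refine (ae_restrict_iff' measurableSet_Ioo).2 (ae_of_all _ fun x hx => ?_)
    refine ContinuousAt.fun_const_smul ?_ _
    exact (hf.continuousAt (Ioi_mem_nhds (mul_pos hτ hx.1))).comp (f := fun t : ℝ => t * x)
      (by fun_prop)

end AbelIntegral

section Laplace

variable {F : Type*} [NormedAddCommGroup F] [NormedSpace ℝ F] {f : ℝ → F} {s s₀ t : ℝ}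

/-- The Laplace transform `s ↦ ∫₀^∞ e^{-st} f(t) dt`. -/
def laplace (f : ℝ → F) (s : ℝ) : F := ∫ t in Ioi (0 : ℝ), Real.exp (-(s * t)) • f t

lemma ae_restrict_Ioi_of_forall_pos {p : ℝ → Prop} (h : ∀ t, 0 < t → p t) :
    ∀ᵐ t ∂volume.restrict (Ioi (0 : ℝ)), p t :=
  (ae_restrict_iff' measurableSet_Ioi).2 (ae_of_all _ h)

lemma norm_exp_neg_smul_le (hs : s₀ ≤ s) (ht : 0 ≤ t) (x : F) :
    ‖Real.exp (-(s * t)) • x‖ ≤ ‖Real.exp (-(s₀ * t)) • x‖ := by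
  rw [norm_smul, norm_smul, Real.norm_of_nonneg (Real.exp_pos _).le,
    Real.norm_of_nonneg (Real.exp_pos _).le]
  gcongr

lemma integrableOn_exp_neg_smul (hf : IntegrableOn (fun t => Real.exp (-(s₀ * t)) • f t) (Ioi 0))
    (hs : s₀ ≤ s) : IntegrableOn (fun t => Real.exp (-(s * t)) • f t) (Ioi 0) := by
  refine Integrable.mono hf ?_
    (ae_restrict_Ioi_of_forall_pos fun t ht => norm_exp_neg_smul_le hs ht.le _)
  have hshift (t : ℝ) : Real.exp (-(s * t)) • f t =
      Real.exp (-((s - s₀) * t)) • Real.exp (-(s₀ * t)) • f t := by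
    rw [smul_smul, ← Real.exp_add]; ring_nf
  simp_rw [hshift]
  exact (Continuous.aestronglyMeasurable (by fun_prop)).smul hf.aestronglyMeasurable

lemma integrableOn_exp_neg_smul_of_integrableOn (hf : IntegrableOn f (Ioi 0)) (hs : 0 ≤ s) :
    IntegrableOn (fun t => Real.exp (-(s * t)) • f t) (Ioi 0) :=
  integrableOn_exp_neg_smul (s₀ := 0) (by simpa using hf) hs

lemma integrableOn_exp_neg_mul_rpow {a : ℝ} (ha : -1 < a) (hs : 0 < s) :
    IntegrableOn (fun t : ℝ => Real.exp (-(s * t)) * t ^ a) (Ioi 0) := by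
  simpa [mul_comm] using integrableOn_rpow_mul_exp_neg_mul_rpow ha one_pos hs

lemma integrableOn_exp_neg_smul_of_norm_le {a C : ℝ} (ha : -1 < a)
    (hfm : AEStronglyMeasurable f (volume.restrict (Ioi 0)))
    (hfb : ∀ t, 0 < t → ‖f t‖ ≤ C * (1 + t ^ a)) (hs : 0 < s) :
    IntegrableOn (fun t => Real.exp (-(s * t)) • f t) (Ioi 0) := by
  have hone := integrableOn_exp_neg_mul_rpow (a := 0) (by norm_num) hs
  refine Integrable.mono' ((hone.add (integrableOn_exp_neg_mul_rpow ha hs)).const_mul C)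
    ((Continuous.aestronglyMeasurable (by fun_prop)).smul hfm)
    (ae_restrict_Ioi_of_forall_pos fun t ht => ?_)
  rw [norm_smul, Real.norm_of_nonneg (Real.exp_pos _).le, Pi.add_apply, Real.rpow_zero]
  calc Real.exp (-(s * t)) * ‖f t‖ ≤ Real.exp (-(s * t)) * (C * (1 + t ^ a)) := by
        gcongr; exact hfb t ht
    _ = _ := by ring

lemma norm_laplace_le (hf : IntegrableOn f (Ioi 0)) (hs : 0 ≤ s) :
    ‖laplace f s‖ ≤ ∫ t in Ioi (0 : ℝ), ‖f t‖ :=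
  norm_integral_le_of_norm_le hf.norm (ae_restrict_Ioi_of_forall_pos fun t ht => by
    simpa using norm_exp_neg_smul_le hs ht.le (f t))

lemma laplace_const (F : Type*) [NormedAddCommGroup F] [NormedSpace ℝ F] [CompleteSpace F]
    (x : F) (hs : 0 < s) : laplace (fun _ => x) s = s⁻¹ • x := by
  have h := integral_exp_mul_Ioi (neg_lt_zero.2 hs) 0
  simp only [mul_zero, Real.exp_zero, neg_mul, neg_div_neg_eq, one_div] at h
  rw [laplace, integral_smul_const, h]

lemma laplace_add {g : ℝ → F} (hf : IntegrableOn (fun t => Real.exp (-(s * t)) • f t) (Ioi 0))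
    (hg : IntegrableOn (fun t => Real.exp (-(s * t)) • g t) (Ioi 0)) :
    laplace (fun t => f t + g t) s = laplace f s + laplace g s := by
  simp_rw [laplace, smul_add]
  exact integral_add hf hg

lemma laplace_const_smul {𝕜 : Type*} [RCLike 𝕜] [NormedSpace 𝕜 F] [SMulCommClass ℝ 𝕜 F]
    (c : 𝕜) (f : ℝ → F) (s : ℝ) : laplace (fun t => c • f t) s = c • laplace f s := by
  simp_rw [laplace, smul_comm _ c]
  exact integral_smul c _

lemma norm_exp_neg_smul_smul_le (hs : 0 < s) (ht : 0 ≤ t) (x : F) :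
    ‖Real.exp (-(s * t)) • t • x‖ ≤ s⁻¹ * ‖x‖ := by
  have hexp : Real.exp (-(s * t)) * t ≤ s⁻¹ := by
    rw [Real.exp_neg, inv_mul_le_iff₀ (Real.exp_pos _), ← div_eq_mul_inv, le_div_iff₀ hs]
    linarith [Real.add_one_le_exp (s * t)]
  rw [smul_smul, norm_smul, Real.norm_of_nonneg (by positivity)]
  gcongr

lemma norm_laplace_smul_le (hf : IntegrableOn f (Ioi 0)) (hs : 0 < s) :
    ‖laplace (fun t => t • f t) s‖ ≤ s⁻¹ * ∫ t in Ioi (0 : ℝ), ‖f t‖ := by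
  rw [← integral_const_mul]
  exact norm_integral_le_of_norm_le (hf.norm.const_mul _)
    (ae_restrict_Ioi_of_forall_pos fun t ht => norm_exp_neg_smul_smul_le hs ht.le _)

lemma integrableOn_exp_neg_smul_smul (hf : IntegrableOn f (Ioi 0)) (hs : 0 < s) :
    IntegrableOn (fun t => Real.exp (-(s * t)) • t • f t) (Ioi 0) :=
  Integrable.mono' (hf.norm.const_mul s⁻¹)
    ((Continuous.aestronglyMeasurable (by fun_prop)).smul
      ((Continuous.aestronglyMeasurable (by fun_prop)).smul hf.aestronglyMeasurable))
    (ae_restrict_Ioi_of_forall_pos fun t ht => norm_exp_neg_smul_smul_le hs ht.le _)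

lemma continuousOn_laplace (hf : IntegrableOn (fun t => Real.exp (-(s₀ * t)) • f t) (Ioi 0)) :
    ContinuousOn (laplace f) (Ici s₀) :=
  continuousOn_of_dominated (fun _ hs => (integrableOn_exp_neg_smul hf hs).aestronglyMeasurable)
    (fun _ hs => ae_restrict_Ioi_of_forall_pos fun t ht => norm_exp_neg_smul_le hs ht.le (f t))
    hf.norm (ae_of_all _ fun t => by fun_prop)

lemma hasDerivAt_laplace (hf : IntegrableOn f (Ioi 0)) (hs : 0 < s) :
    HasDerivAt (laplace f) (-laplace (fun t => t • f t) s) s := by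
  have hderiv := hasDerivAt_integral_of_dominated_loc_of_deriv_le
    (μ := volume.restrict (Ioi (0 : ℝ))) (F := fun s t => Real.exp (-(s * t)) • f t)
    (F' := fun s t => -(Real.exp (-(s * t)) • t • f t)) (x₀ := s) (s := Ioi (s / 2))
    (bound := fun t => (s / 2)⁻¹ * ‖f t‖) (Ioi_mem_nhds (by linarith))
    (Eventually.of_forall fun _ => (Continuous.aestronglyMeasurable (by fun_prop)).smul
      hf.aestronglyMeasurable)
    (integrableOn_exp_neg_smul_of_integrableOn hf hs.le)
    (integrableOn_exp_neg_smul_smul hf hs).aestronglyMeasurable.neg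
    (ae_restrict_Ioi_of_forall_pos fun t ht σ (hσ : s / 2 < σ) => ?_) (hf.norm.const_mul _)
    (ae_of_all _ fun t σ _ => ?_)
  · rw [laplace, ← integral_neg]
    exact hderiv.2
  · rw [norm_neg]
    refine (norm_exp_neg_smul_smul_le (by linarith) ht.le _).trans ?_
    gcongr
  · refine ((((hasDerivAt_id σ).mul_const t).neg.exp).smul_const (f t)).congr_deriv ?_
    simp [smul_smul]

lemma laplace_laplace [CompleteSpace F] (hf : IntegrableOn f (Ioi 0)) (hs : 0 < s) :
    laplace (laplace f) s = ∫ r in Ioi (0 : ℝ), (r + s)⁻¹ • f r := by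
  have hprod : Integrable (Function.uncurry fun t r : ℝ =>
      Real.exp (-(s * t)) • Real.exp (-(t * r)) • f r)
      ((volume.restrict (Ioi 0)).prod (volume.restrict (Ioi 0))) := by
    have hexp : IntegrableOn (fun t : ℝ => Real.exp (-(s * t))) (Ioi 0) := by
      simpa using integrableOn_exp_neg_mul_rpow (a := 0) (by norm_num) hs
    refine Integrable.mono (Integrable.smul_prod hexp hf) ?_ ?_
    · exact (Continuous.aestronglyMeasurable (by fun_prop)).smul
        ((Continuous.aestronglyMeasurable (by fun_prop)).smul hf.aestronglyMeasurable.comp_snd)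
    · rw [Measure.prod_restrict]
      refine (ae_restrict_iff' (measurableSet_Ioi.prod measurableSet_Ioi)).2
        (ae_of_all _ fun p hp => ?_)
      simp only [Function.uncurry, norm_smul (Real.exp (-(s * p.1)))]
      gcongr
      simpa using norm_exp_neg_smul_le (le_of_lt hp.1) (le_of_lt hp.2) (f p.2)
  simp_rw [laplace, ← integral_smul]
  rw [integral_integral_swap hprod]
  refine setIntegral_congr_fun measurableSet_Ioi fun r (hr : 0 < r) => ?_
  rw [← laplace_const F (f r) (add_pos hr hs), laplace]
  refine integral_congr_ae (ae_of_all _ fun t => ?_)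
  simp only [smul_smul, ← Real.exp_add]
  ring_nf

lemma tendsto_integral_div_add_smul (hf : IntegrableOn f (Ioi 0)) :
    Tendsto (fun s => ∫ r in Ioi (0 : ℝ), (s / (r + s)) • f r) atTop
      (𝓝 (∫ r in Ioi (0 : ℝ), f r)) := by
  refine tendsto_integral_filter_of_dominated_convergence (fun r => ‖f r‖)
    (Eventually.of_forall fun s =>
      (Measurable.aestronglyMeasurable (by fun_prop)).smul hf.aestronglyMeasurable) ?_ hf.norm
    (ae_restrict_Ioi_of_forall_pos fun r hr => ?_)
  · filter_upwards [eventually_gt_atTop 0] with s hs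
    refine ae_restrict_Ioi_of_forall_pos fun r hr => ?_
    rw [norm_smul, Real.norm_of_nonneg (by positivity)]
    exact mul_le_of_le_one_left (norm_nonneg _) ((div_le_one (by positivity)).2 (by linarith))
  · have hratio : Tendsto (fun s : ℝ => 1 - r / (r + s)) atTop (𝓝 1) := by
      simpa using (tendsto_const_nhds.div_atTop
        (tendsto_atTop_add_const_left _ r tendsto_id)).const_sub (1 : ℝ)
    have hcongr : (fun s : ℝ => 1 - r / (r + s)) =ᶠ[atTop] fun s => s / (r + s) := by
      filter_upwards [eventually_gt_atTop 0] with s hs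
      field_simp
      ring
    simpa only [one_smul] using (hratio.congr' hcongr).smul_const (f r)

lemma laplace_deriv [CompleteSpace F] {f' : ℝ → F} (hcont : ContinuousWithinAt f (Ici 0) 0)
    (hderiv : ∀ t, 0 < t → HasDerivAt f (f' t) t)
    (hf : IntegrableOn (fun t => Real.exp (-(s * t)) • f t) (Ioi 0))
    (hf' : IntegrableOn (fun t => Real.exp (-(s * t)) • f' t) (Ioi 0))
    (hlim : Tendsto (fun t => Real.exp (-(s * t)) • f t) atTop (𝓝 0)) :
    laplace f' s = s • laplace f s - f 0 := by
  have hsf : IntegrableOn (fun t => s • Real.exp (-(s * t)) • f t) (Ioi 0) := hf.smul s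
  have h := integral_Ioi_of_hasDerivAt_of_tendsto (a := 0)
    (f := fun t => Real.exp (-(s * t)) • f t)
    (f' := fun t => Real.exp (-(s * t)) • f' t - s • Real.exp (-(s * t)) • f t)
    (ContinuousWithinAt.smul (by fun_prop) hcont) (fun t ht => ?_) (hf'.sub hsf) hlim
  · rw [integral_sub hf' hsf, integral_smul] at h
    simp only [mul_zero, neg_zero, Real.exp_zero, one_smul, zero_sub] at h
    rw [laplace, laplace, sub_eq_add_neg, add_comm, sub_eq_iff_eq_add.1 h]
  · refine ((((hasDerivAt_id t).const_mul s).neg.exp).smul (hderiv t ht)).congr_deriv ?_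
    simp [smul_smul, mul_comm s, sub_eq_add_neg]

lemma exp_neg_smul_abelIntegral (a s : ℝ) (f : ℝ → F) (ht : 0 < t) :
    Real.exp (-(s * t)) • abelIntegral a f t = ∫ σ in (0 : ℝ)..t,
      (ContinuousLinearMap.lsmul ℝ ℝ).flip (Real.exp (-(s * σ)) • f σ)
        (Real.exp (-(s * (t - σ))) * (t - σ) ^ a) := by
  rw [intervalIntegral.integral_of_le ht.le, integral_Ioc_eq_integral_Ioo, abelIntegral,
    ← integral_smul]
  refine setIntegral_congr_fun measurableSet_Ioo fun σ _ => ?_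
  simp only [ContinuousLinearMap.flip_apply, ContinuousLinearMap.lsmul_apply, smul_smul]
  rw [mul_right_comm, ← Real.exp_add]
  ring_nf

lemma integrableOn_exp_neg_smul_abelIntegral {a : ℝ} (ha : -1 < a) (hs : 0 < s)
    (hf : IntegrableOn (fun t => Real.exp (-(s * t)) • f t) (Ioi 0)) :
    IntegrableOn (fun t => Real.exp (-(s * t)) • abelIntegral a f t) (Ioi 0) := by
  have hconv := integrable_posConvolution hf (integrableOn_exp_neg_mul_rpow ha hs)
    (ContinuousLinearMap.lsmul ℝ ℝ).flip (ν := volume) (μ := volume)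
  refine hconv.integrableOn.congr_fun (s := Ioi 0) (fun t ht => ?_) measurableSet_Ioi
  rw [posConvolution, indicator_of_mem ht, exp_neg_smul_abelIntegral a s f ht]

lemma laplace_rpow {a : ℝ} (ha : -1 < a) (hs : 0 < s) :
    laplace (fun t : ℝ => t ^ a) s = Real.Gamma (a + 1) * s ^ (-(a + 1)) := by
  have h := Real.integral_rpow_mul_exp_neg_mul_Ioi (a := a + 1) (by linarith) hs
  rw [add_sub_cancel_right, one_div, Real.inv_rpow hs.le, ← Real.rpow_neg hs.le] at h
  simpa only [laplace, smul_eq_mul, mul_comm] using h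

lemma laplace_abelIntegral [CompleteSpace F] {a : ℝ} (ha : -1 < a) (hs : 0 < s)
    (hf : IntegrableOn (fun t => Real.exp (-(s * t)) • f t) (Ioi 0)) :
    laplace (abelIntegral a f) s = (Real.Gamma (a + 1) * s ^ (-(a + 1))) • laplace f s := by
  have hconv := integral_posConvolution hf (integrableOn_exp_neg_mul_rpow ha hs)
    (ContinuousLinearMap.lsmul ℝ ℝ).flip (ν := volume) (μ := volume)
  rw [← laplace_rpow ha hs]
  refine Eq.trans ?_ hconv
  exact setIntegral_congr_fun measurableSet_Ioi fun t ht => exp_neg_smul_abelIntegral a s f ht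

end Laplace

section LaplaceInjectivity

variable {F : Type*} [NormedAddCommGroup F] [NormedSpace ℝ F] {k : ℝ → F} {φ : ℝ → ℝ}

lemma integrableOn_comp_exp_neg_smul (hk : IntegrableOn k (Ioi 0))
    (hφ : ContinuousOn φ (Icc 0 1)) : IntegrableOn (fun t => φ (Real.exp (-t)) • k t) (Ioi 0) := by
  have hmaps : MapsTo (fun t : ℝ => Real.exp (-t)) (Ioi 0) (Icc 0 1) := fun t (ht : 0 < t) =>
    ⟨(Real.exp_pos _).le, Real.exp_le_one_iff.2 (by linarith)⟩
  obtain ⟨C, hC⟩ := isCompact_Icc.exists_bound_of_continuousOn hφ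
  exact hk.bdd_smul C
    ((hφ.comp (by fun_prop) hmaps).aestronglyMeasurable measurableSet_Ioi)
    (ae_restrict_Ioi_of_forall_pos fun t ht => hC _ (hmaps ht))

lemma integral_polynomial_exp_neg_smul_eq_zero (hk : IntegrableOn k (Ioi 0))
    (hz : ∀ n : ℕ, laplace k n = 0) (p : Polynomial ℝ) :
    ∫ t in Ioi (0 : ℝ), p.eval (Real.exp (-t)) • k t = 0 := by
  induction p using Polynomial.induction_on' with
  | add p q hp hq =>
    simp_rw [Polynomial.eval_add, add_smul]
    rw [integral_add (integrableOn_comp_exp_neg_smul hk p.continuous.continuousOn)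
      (integrableOn_comp_exp_neg_smul hk q.continuous.continuousOn), hp, hq, add_zero]
  | monomial n a =>
    simp_rw [Polynomial.eval_monomial, mul_smul, ← Real.exp_nat_mul, mul_neg]
    rw [integral_smul, ← laplace, hz, smul_zero]

lemma integral_comp_exp_neg_smul_eq_zero (hk : IntegrableOn k (Ioi 0))
    (hz : ∀ n : ℕ, laplace k n = 0) (hφ : ContinuousOn φ (Icc 0 1)) :
    ∫ t in Ioi (0 : ℝ), φ (Real.exp (-t)) • k t = 0 := by
  set M := ∫ t in Ioi (0 : ℝ), ‖k t‖ with hM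
  have : 0 ≤ M := integral_nonneg fun _ => norm_nonneg _
  refine norm_le_zero_iff.1 (le_of_forall_pos_le_add fun ε hε => ?_)
  obtain ⟨p, hp⟩ := exists_polynomial_near_of_continuousOn 0 1 φ hφ (ε / (M + 1)) (by positivity)
  have hdiff : ∫ t in Ioi (0 : ℝ), φ (Real.exp (-t)) • k t =
      ∫ t in Ioi (0 : ℝ), (φ (Real.exp (-t)) - p.eval (Real.exp (-t))) • k t := by
    simp_rw [sub_smul]
    rw [integral_sub (integrableOn_comp_exp_neg_smul hk hφ)
      (integrableOn_comp_exp_neg_smul hk p.continuous.continuousOn),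
      integral_polynomial_exp_neg_smul_eq_zero hk hz, sub_zero]
  have hbound : ‖∫ t in Ioi (0 : ℝ), (φ (Real.exp (-t)) - p.eval (Real.exp (-t))) • k t‖ ≤
      ∫ t in Ioi (0 : ℝ), ε / (M + 1) * ‖k t‖ := by
    refine norm_integral_le_of_norm_le (hk.norm.const_mul _)
      (ae_restrict_Ioi_of_forall_pos fun t ht => ?_)
    rw [norm_smul, Real.norm_eq_abs, abs_sub_comm]
    gcongr
    exact (hp _ ⟨(Real.exp_pos _).le, Real.exp_le_one_iff.2 (by linarith)⟩).le
  rw [integral_const_mul, ← hM] at hbound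
  rw [hdiff, zero_add]
  refine hbound.trans ?_
  rw [div_mul_eq_mul_div, div_le_iff₀ (by positivity)]
  nlinarith

lemma continuous_comp_neg_log {g : ℝ → ℝ} (hg : Continuous g) (hgc : HasCompactSupport g)
    (hg0 : g 0 = 0) : Continuous fun x => g (-Real.log x) := by
  refine continuous_iff_continuousAt.2 fun x => ?_
  rcases eq_or_ne x 0 with rfl | hx
  · obtain ⟨R, hR⟩ := hgc.isCompact.bddAbove
    have hfar : ∀ᶠ x : ℝ in 𝓝[≠] 0, R < -Real.log x :=
      (tendsto_neg_atBot_atTop.comp Real.tendsto_log_nhdsNE_zero).eventually_gt_atTop R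
    have hzero : (fun x => g (-Real.log x)) =ᶠ[𝓝 0] fun _ => 0 := by
      filter_upwards [eventually_nhdsWithin_iff.1 hfar] with x hx
      rcases eq_or_ne x 0 with rfl | hx0
      · simpa using hg0
      · exact image_eq_zero_of_notMem_tsupport fun hmem => (hR hmem).not_gt (hx hx0)
    exact continuousAt_const.congr hzero.symm
  · exact hg.continuousAt.comp (Real.continuousAt_log hx).neg

-- Lerch's theorem: with `x = e^{-t}`, the integers `s₀ + n` give the moments of a density on
-- `(0, 1)`, and polynomials are dense.
theorem eq_zero_of_laplace_eq_zero [CompleteSpace F] {h : ℝ → F} {s₀ : ℝ}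
    (hc : ContinuousOn h (Ioi 0))
    (hi : IntegrableOn (fun t => Real.exp (-(s₀ * t)) • h t) (Ioi 0))
    (hz : ∀ n : ℕ, laplace h (s₀ + n) = 0) {t : ℝ} (ht : 0 < t) : h t = 0 := by
  have hmoment (n : ℕ) : laplace (fun t => Real.exp (-(s₀ * t)) • h t) n = 0 := by
    rw [← hz n, laplace, laplace]
    refine setIntegral_congr_fun measurableSet_Ioi fun t _ => ?_
    simp only [smul_smul, ← Real.exp_add]
    ring_nf
  have hae : ∀ᵐ t : ℝ, t ∈ Ioi (0 : ℝ) → h t = 0 := by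
    refine isOpen_Ioi.ae_eq_zero_of_integral_contDiff_smul_eq_zero
      (hc.locallyIntegrableOn measurableSet_Ioi) fun g hg hgc hgs => ?_
    have hg0 (t : ℝ) (ht : t ∉ Ioi (0 : ℝ)) : g t = 0 :=
      image_eq_zero_of_notMem_tsupport fun hmem => ht (hgs hmem)
    have hφ := continuous_comp_neg_log (g := fun t => g t * Real.exp (s₀ * t))
      (hg.continuous.mul (by fun_prop)) hgc.mul_right (by simp [hg0 0 self_notMem_Ioi])
    rw [← setIntegral_eq_integral_of_forall_compl_eq_zero (s := Ioi 0)
      fun t ht => by rw [hg0 t ht, zero_smul],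
      ← integral_comp_exp_neg_smul_eq_zero hi hmoment hφ.continuousOn]
    refine setIntegral_congr_fun measurableSet_Ioi fun t _ => ?_
    simp only [Real.log_exp, neg_neg, smul_smul, mul_assoc, ← Real.exp_add]
    simp
  refine Measure.eqOn_of_ae_eq (μ := volume) ((ae_restrict_iff' measurableSet_Ioi).2 hae) hc
    continuousOn_const ?_ ht
  rw [interior_Ioi]
  exact subset_closure

end LaplaceInjectivity

section Relaxation

variable {α τ s : ℝ}

/-- The relaxation function `τ ↦ E_α((-i)^α τ^α)` of the fractional Schrödinger mode of frequency
one, in the form of an oscillating exponential plus the Laplace transform of a density. -/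
def relax (α τ : ℝ) : ℂ := 1 / α * Complex.exp (-(τ * I)) + laplace (relaxDensity α) τ

/-- Minus the derivative of the non-oscillating part of `relax`. -/
def relaxRem (α : ℝ) : ℝ → ℂ := laplace fun r => r • relaxDensity α r

/-- The derivative of `relax`. -/
def relaxDeriv (α τ : ℝ) : ℂ := -(I / α) * Complex.exp (-(τ * I)) - relaxRem α τ

lemma norm_exp_neg_mul_I (τ : ℝ) : ‖Complex.exp (-(τ * I))‖ = 1 := by
  rw [← neg_mul, ← Complex.ofReal_neg, Complex.norm_exp_ofReal_mul_I]

lemma continuousOn_relax (hα : 0 < α) (hα1 : α ≤ 1) : ContinuousOn (relax α) (Ici 0) :=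
  ContinuousOn.add (by fun_prop) (continuousOn_laplace (s₀ := 0)
    (integrableOn_exp_neg_smul_of_integrableOn (integrableOn_relaxDensity hα hα1) le_rfl))

lemma exists_norm_relax_le (hα : 0 < α) (hα1 : α ≤ 1) :
    ∃ C : ℝ, 0 < C ∧ ∀ τ : ℝ, 0 ≤ τ → ‖relax α τ‖ ≤ C := by
  have : 0 ≤ ∫ r in Ioi (0 : ℝ), ‖relaxDensity α r‖ := integral_nonneg fun _ => norm_nonneg _
  refine ⟨1 / α + ∫ r in Ioi (0 : ℝ), ‖relaxDensity α r‖, by positivity, fun τ hτ =>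
    (norm_add_le _ _).trans (add_le_add ?_ (norm_laplace_le (integrableOn_relaxDensity hα hα1) hτ))⟩
  simp [norm_exp_neg_mul_I, abs_of_pos hα]

lemma hasDerivAt_relax (hα : 0 < α) (hα1 : α ≤ 1) (hτ : 0 < τ) :
    HasDerivAt (relax α) (relaxDeriv α τ) τ := by
  have hosc : HasDerivAt (fun τ : ℝ => 1 / (α : ℂ) * Complex.exp (-(τ * I)))
      (-(I / α) * Complex.exp (-(τ * I))) τ := by
    refine (((Complex.ofRealCLM.hasDerivAt.mul_const I).neg.cexp).const_mul
      (1 / (α : ℂ))).congr_deriv ?_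
    simp only [Pi.neg_apply, Complex.ofRealCLM_apply, Complex.ofReal_one]
    ring
  exact hosc.add (hasDerivAt_laplace (integrableOn_relaxDensity hα hα1) hτ)

lemma exists_norm_smul_relaxDensity_le (hα : 0 < α) (hα1 : α ≤ 1) :
    ∃ C : ℝ, 0 < C ∧ ∀ r : ℝ, 0 < r → ‖r • relaxDensity α r‖ ≤ C * r ^ (-α) := by
  obtain ⟨C, hC, hbound⟩ := exists_norm_relaxDensity_le hα hα1
  refine ⟨C, hC, fun r hr => ?_⟩
  have : 0 < r ^ α := Real.rpow_pos_of_pos hr α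
  rw [norm_smul, Real.norm_of_nonneg hr.le]
  calc r * ‖relaxDensity α r‖ ≤ r * (C * (r ^ (α - 1) / (r ^ α) ^ 2)) := by
        refine mul_le_mul_of_nonneg_left ((hbound r hr).trans ?_) hr.le
        gcongr
        linarith
    _ = C * r ^ (-α) := by
        rw [Real.rpow_sub_one hr.ne', Real.rpow_neg hr.le]
        field_simp

lemma exists_norm_relaxRem_le_rpow (hα : 0 < α) (hα1 : α ≤ 1) :
    ∃ C : ℝ, 0 ≤ C ∧ ∀ τ : ℝ, 0 < τ → ‖relaxRem α τ‖ ≤ C * τ ^ (α - 1) := by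
  rcases hα1.eq_or_lt with rfl | hlt
  · refine ⟨0, le_rfl, fun τ _ => ?_⟩
    simp [relaxRem, laplace, relaxDensity_one]
  obtain ⟨C, hC, hbound⟩ := exists_norm_smul_relaxDensity_le hα hα1
  have hΓ : 0 < Real.Gamma (-α + 1) := Real.Gamma_pos_of_pos (by linarith)
  refine ⟨C * Real.Gamma (-α + 1), by positivity, fun τ hτ => ?_⟩
  have hfi := (integrableOn_exp_neg_mul_rpow (a := -α) (by linarith) hτ).const_mul C
  refine (norm_integral_le_of_norm_le hfi (ae_restrict_Ioi_of_forall_pos fun r hr => ?_)).trans_eq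
    ?_
  · rw [norm_smul, Real.norm_of_nonneg (Real.exp_pos _).le, mul_left_comm]
    gcongr
    exact hbound r hr
  · have hlaplace := laplace_rpow (a := -α) (by linarith) hτ
    simp only [laplace, smul_eq_mul] at hlaplace
    rw [integral_const_mul, hlaplace, ← mul_assoc, neg_add_rev, neg_neg, add_comm (-1),
      ← sub_eq_add_neg]

lemma exists_norm_relaxRem_le (hα : 0 < α) (hα1 : α ≤ 1) :
    ∃ C : ℝ, 0 < C ∧ ∀ τ : ℝ, 0 < τ →
      ‖relaxRem α τ‖ ≤ C * τ⁻¹ ∧ ‖relaxRem α τ‖ ≤ C * τ ^ (α - 1) := by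
  obtain ⟨C, hC, hbound⟩ := exists_norm_relaxRem_le_rpow hα hα1
  have hpos : 0 ≤ ∫ r in Ioi (0 : ℝ), ‖relaxDensity α r‖ := integral_nonneg fun _ => norm_nonneg _
  refine ⟨(∫ r in Ioi (0 : ℝ), ‖relaxDensity α r‖) + C + 1, by positivity, fun τ hτ => ⟨?_, ?_⟩⟩
  · refine (norm_laplace_smul_le (integrableOn_relaxDensity hα hα1) hτ).trans ?_
    rw [mul_comm]
    gcongr
    linarith
  · refine (hbound τ hτ).trans ?_
    gcongr
    linarith

lemma measurable_relaxRem (α : ℝ) : Measurable (relaxRem α) := by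
  have hdensity : Measurable (relaxDensity α) := measurable_relaxDensity α
  refine (StronglyMeasurable.integral_prod_right (f := fun (τ r : ℝ) =>
    Real.exp (-(τ * r)) • r • relaxDensity α r) (Measurable.stronglyMeasurable ?_)).measurable
  fun_prop

lemma tendsto_ofReal_inv_atTop : Tendsto (fun s : ℝ => (s : ℂ)⁻¹) atTop (𝓝 0) := by
  simpa [Function.comp_def] using
    (Complex.continuous_ofReal.tendsto 0).comp tendsto_inv_atTop_zero

lemma relax_zero (hα : 0 < α) (hα1 : α ≤ 1) : relax α 0 = 1 := by
  have hα' : (α : ℂ) ≠ 0 := Complex.ofReal_ne_zero.2 hα.ne'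
  have hstieltjes := tendsto_integral_div_add_smul (integrableOn_relaxDensity hα hα1)
  have hvalue : Tendsto (fun s : ℝ => 1 / (1 - phase α * ((s ^ α : ℝ) : ℂ)⁻¹) -
      1 / (α * (1 + I * (s : ℂ)⁻¹))) atTop (𝓝 (1 - 1 / α)) := by
    have hone := ((tendsto_ofReal_inv_atTop.comp (tendsto_rpow_atTop hα)).const_mul
      (phase α)).const_sub 1
    have htwo := ((tendsto_ofReal_inv_atTop.const_mul I).const_add 1).const_mul (α : ℂ)
    simp only [mul_zero, sub_zero, add_zero, mul_one] at hone htwo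
    simpa using (hone.inv₀ one_ne_zero).sub (htwo.inv₀ hα')
  have heq : (fun s : ℝ => ∫ r in Ioi (0 : ℝ), (s / (r + s)) • relaxDensity α r) =ᶠ[atTop]
      fun s : ℝ => 1 / (1 - phase α * ((s ^ α : ℝ) : ℂ)⁻¹) - 1 / (α * (1 + I * (s : ℂ)⁻¹)) := by
    filter_upwards [eventually_gt_atTop 0] with s hs
    have hs' : (s : ℂ) ≠ 0 := Complex.ofReal_ne_zero.2 hs.ne'
    have hsα : ((s ^ α : ℝ) : ℂ) ≠ 0 := Complex.ofReal_ne_zero.2 (Real.rpow_pos_of_pos hs α).ne'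
    have hscale (r : ℝ) :
        (s / (r + s)) • relaxDensity α r = s * (relaxDensity α r / (r + s)) := by
      rw [Complex.real_smul]; push_cast; ring
    simp_rw [hscale]
    rw [integral_const_mul, integral_relaxDensity_div hα hα1 hs, Real.rpow_sub_one hs.ne',
      Complex.ofReal_div, mul_sub]
    congr 1 <;> field_simp
  have hmass := tendsto_nhds_unique (hstieltjes.congr' heq) hvalue
  simp [relax, laplace, hmass]

lemma continuousOn_relaxDeriv (hα : 0 < α) (hα1 : α ≤ 1) :
    ContinuousOn (relaxDeriv α) (Ioi 0) := by
  refine ContinuousOn.sub (by fun_prop) fun τ (hτ : 0 < τ) => ?_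
  have hcont := continuousOn_laplace (s₀ := τ / 2)
    (integrableOn_exp_neg_smul_smul (integrableOn_relaxDensity hα hα1) (half_pos hτ))
  exact (hcont.continuousAt (Ici_mem_nhds (half_lt_self hτ))).continuousWithinAt

lemma exists_norm_relaxDeriv_le (hα : 0 < α) (hα1 : α ≤ 1) :
    ∃ C : ℝ, 0 < C ∧ ∀ τ : ℝ, 0 < τ → ‖relaxDeriv α τ‖ ≤ C * (1 + τ ^ (α - 1)) := by
  obtain ⟨C, hC, hbound⟩ := exists_norm_relaxRem_le hα hα1
  refine ⟨1 / α + C, by positivity, fun τ hτ => ?_⟩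
  have hosc : ‖-(I / α) * Complex.exp (-(τ * I))‖ = 1 / α := by
    simp [norm_exp_neg_mul_I, abs_of_pos hα]
  refine (norm_sub_le _ _).trans ((add_le_add hosc.le (hbound τ hτ).2).trans ?_)
  have hpow : 0 ≤ τ ^ (α - 1) := by positivity
  have hαinv : 0 ≤ 1 / α := by positivity
  nlinarith [mul_nonneg hαinv hpow]

lemma integrableOn_exp_neg_smul_relax (hα : 0 < α) (hα1 : α ≤ 1) (hs : 0 < s) :
    IntegrableOn (fun t => Real.exp (-(s * t)) • relax α t) (Ioi 0) := by
  obtain ⟨C, hC, hbound⟩ := exists_norm_relax_le hα hα1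
  refine integrableOn_exp_neg_smul_of_norm_le (a := 0) (C := C) (by norm_num)
    (((continuousOn_relax hα hα1).mono Ioi_subset_Ici_self).aestronglyMeasurable measurableSet_Ioi)
    (fun t ht => (hbound t ht.le).trans ?_) hs
  rw [Real.rpow_zero]
  linarith

lemma integrableOn_exp_neg_smul_relaxDeriv (hα : 0 < α) (hα1 : α ≤ 1) (hs : 0 < s) :
    IntegrableOn (fun t => Real.exp (-(s * t)) • relaxDeriv α t) (Ioi 0) := by
  obtain ⟨C, -, hbound⟩ := exists_norm_relaxDeriv_le hα hα1
  exact integrableOn_exp_neg_smul_of_norm_le (by linarith)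
    ((continuousOn_relaxDeriv hα hα1).aestronglyMeasurable measurableSet_Ioi) hbound hs

lemma exp_neg_smul_exp_neg_mul_I (s t : ℝ) :
    Real.exp (-(s * t)) • Complex.exp (-(t * I)) = Complex.exp (-(s + I) * t) := by
  rw [Complex.real_smul, Complex.ofReal_exp, ← Complex.exp_add]
  push_cast
  ring_nf

lemma laplace_relax (hα : 0 < α) (hα1 : α ≤ 1) (hs : 0 < s) :
    laplace (relax α) s = (s ^ (α - 1) : ℝ) / ((s ^ α : ℝ) - phase α) := by
  have hre : (-((s : ℂ) + I)).re < 0 := by simpa using hs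
  have hoscInt : IntegrableOn (fun t : ℝ => Real.exp (-(s * t)) • Complex.exp (-(t * I)))
      (Ioi 0) := by
    simpa only [exp_neg_smul_exp_neg_mul_I] using integrableOn_exp_mul_complex_Ioi hre 0
  have hosc : laplace (fun t : ℝ => Complex.exp (-(t * I))) s = 1 / (s + I) := by
    simp_rw [laplace, exp_neg_smul_exp_neg_mul_I]
    rw [integral_exp_mul_complex_Ioi hre 0, Complex.ofReal_zero, mul_zero, Complex.exp_zero,
      neg_div_neg_eq]
  have hrem : laplace (laplace (relaxDensity α)) s =
      ∫ r in Ioi (0 : ℝ), relaxDensity α r / (r + s) := by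
    rw [laplace_laplace (integrableOn_relaxDensity hα hα1) hs]
    congr 1 with r
    rw [Complex.real_smul]
    push_cast
    ring
  have hremInt : IntegrableOn (fun t => Real.exp (-(s * t)) • laplace (relaxDensity α) t)
      (Ioi 0) := by
    have hsub := (integrableOn_exp_neg_smul_relax hα hα1 hs).sub (hoscInt.smul (1 / α : ℂ))
    refine hsub.congr (ae_of_all _ fun t => ?_)
    simp only [relax, Pi.sub_apply, Pi.smul_apply, Complex.real_smul, smul_eq_mul]
    ring
  have hoscInt' : IntegrableOn (fun t : ℝ => Real.exp (-(s * t)) •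
      (1 / α : ℂ) • Complex.exp (-(t * I))) (Ioi 0) := by
    exact (hoscInt.smul (1 / α : ℂ)).congr
      (ae_of_all _ fun t => smul_comm (1 / α : ℂ) (Real.exp (-(s * t))) (Complex.exp (-(t * I))))
  have hsum := laplace_add hoscInt' hremInt
  rw [laplace_const_smul, hosc, hrem, integral_relaxDensity_div hα hα1 hs, smul_eq_mul,
    one_div_mul_one_div, add_sub_cancel] at hsum
  exact hsum

lemma laplace_relaxDeriv (hα : 0 < α) (hα1 : α ≤ 1) (hs : 0 < s) :
    laplace (relaxDeriv α) s = phase α / ((s ^ α : ℝ) - phase α) := by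
  obtain ⟨C, -, hbound⟩ := exists_norm_relax_le hα hα1
  have hlim : Tendsto (fun t => Real.exp (-(s * t)) • relax α t) atTop (𝓝 0) := by
    have hexp : Tendsto (fun t : ℝ => Real.exp (-(s * t)) * C) atTop (𝓝 0) := by
      simpa using (Real.tendsto_exp_neg_atTop_nhds_zero.comp
        (tendsto_id.const_mul_atTop hs)).mul_const C
    refine squeeze_zero_norm' ?_ hexp
    filter_upwards [eventually_gt_atTop 0] with t ht
    rw [norm_smul, Real.norm_of_nonneg (Real.exp_pos _).le]
    gcongr
    exact hbound t ht.le
  have hne : ((s ^ α : ℝ) : ℂ) - phase α ≠ 0 :=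
    ofReal_sub_ne_zero (norm_phase α) (phase_ne_one hα hα1) (Real.rpow_nonneg hs.le _)
  have hs' : (s : ℂ) ≠ 0 := Complex.ofReal_ne_zero.2 hs.ne'
  rw [laplace_deriv (continuousOn_relax hα hα1 0 self_mem_Ici)
    (fun t ht => hasDerivAt_relax hα hα1 ht) (integrableOn_exp_neg_smul_relax hα hα1 hs)
    (integrableOn_exp_neg_smul_relaxDeriv hα hα1 hs) hlim, laplace_relax hα hα1 hs,
    relax_zero hα hα1, Complex.real_smul, Real.rpow_sub_one hs.ne', Complex.ofReal_div]
  field_simp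
  ring

/- Both sides are continuous and, by `laplace_relax` and `laplace_relaxDeriv`, have the Laplace
transform `Γ(1 - α) s^(α - 1) phase α / (s^α - phase α)`. -/
theorem abelIntegral_relaxDeriv (hα : 0 < α) (hα1 : α < 1) (hτ : 0 < τ) :
    abelIntegral (-α) (relaxDeriv α) τ = Real.Gamma (1 - α) * (phase α * relax α τ) := by
  obtain ⟨C, -, hbound⟩ := exists_norm_relaxDeriv_le hα hα1.le
  set c : ℂ := -(Real.Gamma (1 - α) * phase α) with hc
  have hcont : ContinuousOn (fun t => abelIntegral (-α) (relaxDeriv α) t + c • relax α t)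
      (Ioi 0) :=
    (continuousOn_abelIntegral (by linarith) (by linarith) (by linarith)
      (continuousOn_relaxDeriv hα hα1.le) hbound).add
      (((continuousOn_relax hα hα1.le).mono Ioi_subset_Ici_self).const_smul c)
  have hA {s : ℝ} (hs : 0 < s) : IntegrableOn
      (fun t => Real.exp (-(s * t)) • abelIntegral (-α) (relaxDeriv α) t) (Ioi 0) :=
    integrableOn_exp_neg_smul_abelIntegral (by linarith) hs
      (integrableOn_exp_neg_smul_relaxDeriv hα hα1.le hs)
  have hR {s : ℝ} (hs : 0 < s) :
      IntegrableOn (fun t => Real.exp (-(s * t)) • c • relax α t) (Ioi 0) := by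
    exact ((integrableOn_exp_neg_smul_relax hα hα1.le hs).smul c).congr
      (ae_of_all _ fun t => smul_comm c (Real.exp (-(s * t))) (relax α t))
  have hzero := eq_zero_of_laplace_eq_zero (s₀ := 1) hcont ?_ (fun n => ?_) hτ
  · rw [add_eq_zero_iff_eq_neg, hc, neg_smul, neg_neg, smul_eq_mul, mul_assoc] at hzero
    exact hzero
  · simp only [smul_add]
    exact (hA one_pos).add (hR one_pos)
  · have hs : 0 < (1 + n : ℝ) := by positivity
    rw [laplace_add (hA hs) (hR hs), laplace_const_smul, laplace_abelIntegral (by linarith) hs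
      (integrableOn_exp_neg_smul_relaxDeriv hα hα1.le hs), laplace_relaxDeriv hα hα1.le hs,
      laplace_relax hα hα1.le hs, hc, Complex.real_smul, smul_eq_mul, neg_add_eq_sub, neg_sub]
    push_cast
    ring

end Relaxation

section FourierMultiplier

open scoped FourierTransform LineDeriv

variable {d : ℕ}

lemma locallyIntegrable_L2 (f : L2 d) : LocallyIntegrable f (volume : Measure (Space d)) :=
  (Lp.memLp f).locallyIntegrable (by norm_num)

lemma smulLeftCLM_toTemperedDistribution_iff {m : Space d → ℂ} (hm : m.HasTemperateGrowth)
    (f g : L2 d) :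
    TemperedDistribution.smulLeftCLM ℂ m (Lp.toTemperedDistribution f) =
      Lp.toTemperedDistribution g ↔ (g : Space d → ℂ) =ᵐ[volume] fun x => m x * f x := by
  constructor
  · intro heq
    refine ae_eq_of_integral_contDiff_smul_eq (locallyIntegrable_L2 g) ?_ fun φ hφ hφc => ?_
    · rw [← locallyIntegrableOn_univ]
      exact (locallyIntegrable_L2 f).locallyIntegrableOn univ |>.continuousOn_mul
        hm.1.continuous.continuousOn isOpen_univ.isLocallyClosed
    · have hsupp : HasCompactSupport (Complex.ofRealCLM ∘ φ) := hφc.comp_left rfl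
      have hsmooth : ContDiff ℝ ((⊤ : ℕ∞) : WithTop ℕ∞) (Complex.ofRealCLM ∘ φ) := by fun_prop
      have htest := congrArg (fun T => T (hsupp.toSchwartzMap hsmooth)) heq
      simp only [TemperedDistribution.smulLeftCLM_apply_apply, Lp.toTemperedDistribution_apply,
        SchwartzMap.smulLeftCLM_apply_apply hm, HasCompactSupport.toSchwartzMap_toFun,
        Function.comp_apply, smul_eq_mul, Complex.ofRealCLM_apply] at htest
      simp only [Complex.real_smul]
      rw [← htest]
      congr 1 with x
      ring
  · intro hae
    ext φ
    simp only [TemperedDistribution.smulLeftCLM_apply_apply, Lp.toTemperedDistribution_apply,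
      SchwartzMap.smulLeftCLM_apply_apply hm]
    refine integral_congr_ae ?_
    filter_upwards [hae] with x hx
    rw [hx, smul_eq_mul, smul_eq_mul, smul_eq_mul]
    ring

/-- The Fourier symbol of `-Δ` for the kernel `e^{-2πi x·ξ}` of Mathlib's Fourier transform. -/
def symbol (ξ : Space d) : ℝ := (2 * π * ‖ξ‖) ^ 2

lemma ofReal_symbol : (fun ξ : Space d => (symbol ξ : ℂ)) =
    ((2 * π) ^ 2 : ℂ) • fun ξ : Space d => Complex.ofReal (‖ξ‖ ^ 2) := by
  ext ξ
  simp [symbol, mul_pow]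

lemma hasTemperateGrowth_symbol : (fun ξ : Space d => (symbol ξ : ℂ)).HasTemperateGrowth := by
  rw [ofReal_symbol]
  exact (Function.HasTemperateGrowth.const _).mul (by fun_prop)

lemma fourier_neg_laplacian (f : L2 d) :
    𝓕 (-(Δ (Lp.toTemperedDistribution f))) =
      TemperedDistribution.smulLeftCLM ℂ (fun ξ : Space d => (symbol ξ : ℂ))
        (Lp.toTemperedDistribution (𝓕 f)) := by
  have hnorm : (fun ξ : Space d => Complex.ofReal (‖ξ‖ ^ 2)).HasTemperateGrowth := by fun_prop
  rw [TemperedDistribution.laplacian_eq_fourierMultiplierCLM, ofReal_symbol,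
    TemperedDistribution.smulLeftCLM_smul hnorm, ← Lp.fourier_toTemperedDistribution_eq,
    TemperedDistribution.fourierMultiplierCLM_apply, neg_smul, neg_neg, ← Complex.coe_smul,
    FourierTransform.fourier_smul, FourierTransform.fourier_fourierInv_eq]
  simp

lemma neg_laplacian_eq_iff (f g : L2 d) :
    -(Δ (Lp.toTemperedDistribution f)) = Lp.toTemperedDistribution g ↔
      (𝓕 g : L2 d) =ᵐ[volume] fun ξ => (symbol ξ : ℂ) * (𝓕 f : L2 d) ξ := by
  rw [← smulLeftCLM_toTemperedDistribution_iff hasTemperateGrowth_symbol, ← fourier_neg_laplacian,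
    ← Lp.fourier_toTemperedDistribution_eq]
  refine ⟨fun h => by rw [h], fun h => ?_⟩
  simpa using congrArg (fun T => 𝓕⁻ T) h

lemma memSobolev_two_of_fourier_eq {f g : L2 d}
    (h : (𝓕 g : L2 d) =ᵐ[volume] fun ξ => (symbol ξ : ℂ) * (𝓕 f : L2 d) ξ) :
    TemperedDistribution.MemSobolev 2 2 (Lp.toTemperedDistribution f) := by
  rw [TemperedDistribution.memSobolev_iff_exists_smulLeftCLM_fourier]
  refine ⟨𝓕 f + (((2 * π) ^ 2)⁻¹ : ℂ) • 𝓕 g, ?_⟩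
  rw [Lp.fourier_toTemperedDistribution_eq, smulLeftCLM_toTemperedDistribution_iff (by fun_prop)]
  filter_upwards [h, Lp.coeFn_add (𝓕 f : L2 d) ((((2 * π) ^ 2)⁻¹ : ℂ) • 𝓕 g),
    Lp.coeFn_smul (((2 * π) ^ 2)⁻¹ : ℂ) (𝓕 g : L2 d)] with ξ hg hadd hsmul
  have hpi : (π : ℂ) ≠ 0 := by exact_mod_cast Real.pi_ne_zero
  rw [hadd, Pi.add_apply, hsmul, Pi.smul_apply, hg, smul_eq_mul, symbol, div_self two_ne_zero,
    Real.rpow_one]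
  push_cast
  field_simp

theorem freeHamiltonian_iff (f g : L2 d) : FreeHamiltonian f g ↔
    (𝓕 g : L2 d) =ᵐ[volume] fun ξ => (symbol ξ : ℂ) * (𝓕 f : L2 d) ξ := by
  rw [FreeHamiltonian, neg_laplacian_eq_iff]
  exact ⟨fun h => h.2, fun h => ⟨memSobolev_two_of_fourier_eq h, h⟩⟩

lemma fourierInv_lineDeriv_ae {f f' : L2 d} {m : Space d}
    (h : ∂_{m} (Lp.toTemperedDistribution f) = Lp.toTemperedDistribution f') :
    (𝓕⁻ f' : L2 d) =ᵐ[volume]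
      fun x => (-(2 * π * I) * (inner ℝ x m : ℝ)) * (𝓕⁻ f : L2 d) x := by
  have hinner : (fun x : Space d => ((inner ℝ x m : ℝ) : ℂ)).HasTemperateGrowth := by fun_prop
  have hfourier := TemperedDistribution.fourierInv_lineDerivOp_eq (Lp.toTemperedDistribution f) m
  rw [h, Lp.fourierInv_toTemperedDistribution_eq, Lp.fourierInv_toTemperedDistribution_eq]
    at hfourier
  have hsmul := congrArg (fun T => T (Lp.toTemperedDistribution (𝓕⁻ f : L2 d)))
    (TemperedDistribution.smulLeftCLM_smul (F := ℂ) hinner (-(2 * π * I)))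
  exact (smulLeftCLM_toTemperedDistribution_iff
    (m := fun x => -(2 * π * I) * (inner ℝ x m : ℝ)) (by fun_prop) _ _).1
    (hsmul.trans hfourier.symm)

end FourierMultiplier

section FractionalIntegration

variable {a b r t : ℝ} {E : Type*} [NormedAddCommGroup E] [NormedSpace ℝ E]

lemma integral_one_sub_rpow_mul_rpow (ha : -1 < a) (hb : -1 < b) :
    ∫ x in Ioo (0 : ℝ) 1, (1 - x) ^ a * x ^ b = ProbabilityTheory.beta (b + 1) (a + 1) := by
  rw [ProbabilityTheory.beta_eq_betaIntegralReal _ _ (by linarith) (by linarith),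
    Complex.betaIntegral, intervalIntegral.integral_of_le zero_le_one,
    integral_Ioc_eq_integral_Ioo, ← Complex.ofReal_re (∫ x in Ioo (0 : ℝ) 1, (1 - x) ^ a * x ^ b),
    ← integral_complex_ofReal]
  congr 1
  refine setIntegral_congr_fun measurableSet_Ioo fun x hx => ?_
  simp only [Complex.ofReal_mul, Complex.ofReal_cpow hx.1.le,
    Complex.ofReal_cpow (sub_nonneg.2 hx.2.le)]
  push_cast
  simp only [add_sub_cancel_right, mul_comm]

lemma integral_sub_rpow_mul_sub_rpow (ha : -1 < a) (hb : -1 < b) (hrt : r < t) :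
    ∫ s in Ioo r t, (t - s) ^ a * (s - r) ^ b =
      ProbabilityTheory.beta (b + 1) (a + 1) * (t - r) ^ (a + b + 1) := by
  have hlen : 0 < t - r := sub_pos.2 hrt
  have hshift := intervalIntegral.integral_comp_add_right (a := 0) (b := t - r)
    (fun s => (t - s) ^ a * (s - r) ^ b) r
  have hscale := abelIntegral_eq_smul_integral (a := a) (fun s : ℝ => s ^ b) hlen
  rw [zero_add, sub_add_cancel, intervalIntegral.integral_of_le hrt.le,
    intervalIntegral.integral_of_le hlen.le, integral_Ioc_eq_integral_Ioo,
    integral_Ioc_eq_integral_Ioo] at hshift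
  simp only [abelIntegral, smul_eq_mul] at hscale
  rw [← hshift, add_right_comm, Real.rpow_add hlen, ← integral_one_sub_rpow_mul_rpow ha hb,
    mul_left_comm, ← integral_mul_const]
  simp only [← sub_sub, sub_right_comm t _ r, add_sub_cancel_right]
  rw [hscale]
  congr 1
  refine setIntegral_congr_fun measurableSet_Ioo fun x hx => ?_
  simp only [Real.mul_rpow hlen.le hx.1.le]
  ring

lemma integrableOn_sub_rpow_mul_sub_rpow (ha : -1 < a) (hb : -1 < b) (hrt : r < t) :
    IntegrableOn (fun s => (t - s) ^ a * (s - r) ^ b) (Ioo r t) := by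
  refine Integrable.of_integral_ne_zero ?_
  rw [integral_sub_rpow_mul_sub_rpow ha hb hrt]
  exact (mul_pos (ProbabilityTheory.beta_pos (by linarith) (by linarith))
    (Real.rpow_pos_of_pos (sub_pos.2 hrt) _)).ne'

/-- The kernel `1_{r < s} (t - s)^a (s - r)^b` of the iterated Abel integral of orders `b` and `a`
at time `t`. -/
def abelKernel (a b t s r : ℝ) : ℝ := if r < s then (t - s) ^ a * (s - r) ^ b else 0

lemma measurable_abelKernel (a b t : ℝ) : Measurable fun p : ℝ × ℝ => abelKernel a b t p.1 p.2 :=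
  Measurable.ite (measurableSet_lt measurable_snd measurable_fst) (by fun_prop) measurable_const

lemma abelKernel_nonneg {s : ℝ} (hs : s ≤ t) : 0 ≤ abelKernel a b t s r := by
  unfold abelKernel
  split_ifs with hrs
  · exact mul_nonneg (Real.rpow_nonneg (sub_nonneg.2 hs) _) (Real.rpow_nonneg (sub_pos.2 hrs).le _)
  · exact le_rfl

lemma abelKernel_left_eq_indicator (a b t r : ℝ) :
    (fun s => abelKernel a b t s r) =
      (Ioi r).indicator fun s => (t - s) ^ a * (s - r) ^ b := by
  ext s
  simp [abelKernel, indicator_apply]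

lemma integrableOn_abelKernel (ha : -1 < a) (hb : -1 < b) (hr : r ∈ Ioo 0 t) :
    IntegrableOn (fun s => abelKernel a b t s r) (Ioo 0 t) := by
  rw [abelKernel_left_eq_indicator, integrableOn_indicator_iff measurableSet_Ioi, inter_comm,
    Ioo_inter_Ioi, sup_eq_right.2 hr.1.le]
  exact integrableOn_sub_rpow_mul_sub_rpow ha hb hr.2

lemma integral_abelKernel (ha : -1 < a) (hb : -1 < b) (hr : r ∈ Ioo 0 t) :
    ∫ s in Ioo 0 t, abelKernel a b t s r =
      ProbabilityTheory.beta (b + 1) (a + 1) * (t - r) ^ (a + b + 1) := by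
  rw [abelKernel_left_eq_indicator, setIntegral_indicator measurableSet_Ioi,
    Ioo_inter_Ioi, sup_eq_right.2 hr.1.le, integral_sub_rpow_mul_sub_rpow ha hb hr.2]

lemma integral_abelKernel_smul {s : ℝ} (hs : s ∈ Ioo 0 t) (v : ℝ → E) :
    ∫ r in Ioo 0 t, abelKernel a b t s r • v r = (t - s) ^ a • abelIntegral b v s := by
  have hind : (fun r => abelKernel a b t s r • v r) =
      (Iio s).indicator fun r => (t - s) ^ a • (s - r) ^ b • v r := by
    ext r
    by_cases hrs : r < s <;> simp [abelKernel, hrs, smul_smul]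
  rw [hind, setIntegral_indicator measurableSet_Iio, Ioo_inter_Iio, inf_eq_right.2 hs.2.le,
    integral_smul, abelIntegral]

lemma integrable_prod_abelKernel_smul (ha : -1 < a) (hb : -1 < b) {v : ℝ → E}
    (hvm : AEStronglyMeasurable v (volume.restrict (Ioo 0 t)))
    (hv : IntegrableOn (fun r => (t - r) ^ (a + b + 1) • v r) (Ioo 0 t)) :
    Integrable (fun p : ℝ × ℝ => abelKernel a b t p.1 p.2 • v p.2)
      ((volume.restrict (Ioo 0 t)).prod (volume.restrict (Ioo 0 t))) := by
  have hmeas : AEStronglyMeasurable (fun p : ℝ × ℝ => abelKernel a b t p.1 p.2 • v p.2)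
      ((volume.restrict (Ioo 0 t)).prod (volume.restrict (Ioo 0 t))) :=
    (measurable_abelKernel a b t).aestronglyMeasurable.smul hvm.comp_snd
  rw [integrable_prod_iff' hmeas]
  refine ⟨(ae_restrict_iff' measurableSet_Ioo).2 (ae_of_all _ fun r hr =>
    (integrableOn_abelKernel ha hb hr).smul_const (v r)),
    (hv.norm.const_mul (ProbabilityTheory.beta (b + 1) (a + 1))).congr ?_⟩
  refine (ae_restrict_iff' measurableSet_Ioo).2 (ae_of_all _ fun r hr => ?_)
  have hnorm : ∫ s in Ioo 0 t, ‖abelKernel a b t s r • v r‖ =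
      ∫ s in Ioo 0 t, abelKernel a b t s r * ‖v r‖ :=
    setIntegral_congr_fun measurableSet_Ioo fun s hs => by
      simp only [norm_smul, Real.norm_of_nonneg (abelKernel_nonneg hs.2.le)]
  simp only
  rw [hnorm, integral_mul_const, integral_abelKernel ha hb hr, norm_smul,
    Real.norm_of_nonneg (Real.rpow_nonneg (sub_pos.2 hr.2).le _), mul_assoc]

theorem abelIntegral_abelIntegral [CompleteSpace E] (ha : -1 < a) (hb : -1 < b) {v : ℝ → E}
    (hvm : AEStronglyMeasurable v (volume.restrict (Ioo 0 t)))
    (hv : IntegrableOn (fun r => (t - r) ^ (a + b + 1) • v r) (Ioo 0 t)) :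
    abelIntegral a (abelIntegral b v) t =
      ProbabilityTheory.beta (b + 1) (a + 1) • abelIntegral (a + b + 1) v t := by
  calc abelIntegral a (abelIntegral b v) t
      = ∫ s in Ioo 0 t, ∫ r in Ioo 0 t, abelKernel a b t s r • v r :=
        setIntegral_congr_fun measurableSet_Ioo fun s hs => (integral_abelKernel_smul hs v).symm
    _ = ∫ r in Ioo 0 t, ∫ s in Ioo 0 t, abelKernel a b t s r • v r :=
        integral_integral_swap (integrable_prod_abelKernel_smul ha hb hvm hv)
    _ = ∫ r in Ioo 0 t, ProbabilityTheory.beta (b + 1) (a + 1) • (t - r) ^ (a + b + 1) • v r :=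
        setIntegral_congr_fun measurableSet_Ioo fun r hr => by
          simp only [integral_smul_const, integral_abelKernel ha hb hr, mul_smul]
    _ = ProbabilityTheory.beta (b + 1) (a + 1) • abelIntegral (a + b + 1) v t := integral_smul _ _

lemma abelIntegral_exp_le {k : ℝ} (ha : -1 < a) (hk : 0 < k) (ht : 0 ≤ t) :
    abelIntegral a (fun s => Real.exp (k * s)) t ≤
      Real.exp (k * t) * ((1 / k) ^ (a + 1) * Real.Gamma (a + 1)) := by
  have hfactor (s : ℝ) : (t - s) ^ a • Real.exp (k * s) =
      Real.exp (k * t) * ((t - s) ^ a * Real.exp (-(k * (t - s)))) := by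
    rw [smul_eq_mul, mul_left_comm, ← Real.exp_add]
    ring_nf
  have hpos (x : ℝ) (hx : 0 < x) : 0 ≤ x ^ a * Real.exp (-(k * x)) := by positivity
  have hfi : IntegrableOn (fun x : ℝ => x ^ a * Real.exp (-(k * x))) (Ioi 0) := by
    simpa only [mul_comm] using integrableOn_exp_neg_mul_rpow ha hk
  simp_rw [abelIntegral, hfactor]
  rw [integral_const_mul]
  refine mul_le_mul_of_nonneg_left ?_ (Real.exp_pos _).le
  have hgamma := Real.integral_rpow_mul_exp_neg_mul_Ioi (a := a + 1) (by linarith) hk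
  rw [add_sub_cancel_right] at hgamma
  rw [← hgamma, ← integral_Ioc_eq_integral_Ioo, ← intervalIntegral.integral_of_le ht,
    intervalIntegral.integral_comp_sub_left (fun x => x ^ a * Real.exp (-(k * x))) t,
    sub_self, sub_zero, intervalIntegral.integral_of_le ht]
  exact setIntegral_mono_set hfi (ae_restrict_Ioi_of_forall_pos hpos)
    (ae_of_all _ Ioc_subset_Ioi_self)

lemma integrableOn_sub_rpow_smul_of_continuousOn (ha : -1 < a) {f : ℝ → E}
    (hf : ContinuousOn f (Icc 0 t)) :
    IntegrableOn (fun s => (t - s) ^ a • f s) (Ioo 0 t) := by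
  rcases lt_or_ge t 0 with ht | ht
  · simp [Ioo_eq_empty ht.not_gt]
  obtain ⟨M, hM⟩ := isCompact_Icc.exists_bound_of_continuousOn hf
  exact Integrable.smul_bdd (C := M)
    ((integrableOn_Icc_sub_rpow ha ht).mono_set Ioo_subset_Icc_self)
    ((hf.mono Ioo_subset_Icc_self).aestronglyMeasurable measurableSet_Ioo)
    ((ae_restrict_iff' measurableSet_Ioo).2 (ae_of_all _ fun s hs => hM s (Ioo_subset_Icc_self hs)))

lemma exists_pos_mul_rpow_mul_le_half (ha : 0 < a) (C : ℝ) :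
    ∃ k : ℝ, 0 < k ∧ C * ((1 / k) ^ a * Real.Gamma a) ≤ 1 / 2 := by
  have hlim : Tendsto (fun k : ℝ => C * ((1 / k) ^ a * Real.Gamma a)) atTop (𝓝 0) := by
    have hneg := (tendsto_rpow_neg_atTop ha).mul_const (Real.Gamma a) |>.const_mul C
    rw [zero_mul, mul_zero] at hneg
    refine hneg.congr' ?_
    filter_upwards [eventually_gt_atTop 0] with k hk
    rw [one_div, Real.inv_rpow hk.le, Real.rpow_neg hk.le]
  obtain ⟨k, hk, hkpos⟩ := ((hlim.eventually (ge_mem_nhds one_half_pos)).and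
    (eventually_gt_atTop 0)).exists
  exact ⟨k, hkpos, hk⟩

/- The weight `e^{-kt}` with `k` large makes the Abel integral operator a contraction. -/
theorem eq_zero_of_le_abelIntegral {T C : ℝ} (ha : -1 < a) (hC : 0 ≤ C) {φ : ℝ → ℝ}
    (hφ : ContinuousOn φ (Icc 0 T)) (hφ0 : ∀ t ∈ Icc 0 T, 0 ≤ φ t)
    (hle : ∀ t ∈ Icc 0 T, φ t ≤ C * abelIntegral a φ t) (ht : t ∈ Icc 0 T) : φ t = 0 := by
  obtain ⟨k, hk, hhalf⟩ := exists_pos_mul_rpow_mul_le_half (a := a + 1) (by linarith) C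
  obtain ⟨t₀, ht₀, hmax⟩ := isCompact_Icc.exists_isMaxOn ⟨t, ht⟩
    (f := fun s => Real.exp (-(k * s)) * φ s) (ContinuousOn.mul (by fun_prop) hφ)
  set N := Real.exp (-(k * t₀)) * φ t₀
  have hN0 : 0 ≤ N := mul_nonneg (Real.exp_pos _).le (hφ0 _ ht₀)
  have hφN (s : ℝ) : φ s = Real.exp (k * s) * (Real.exp (-(k * s)) * φ s) := by
    rw [← mul_assoc, ← Real.exp_add, add_neg_cancel, Real.exp_zero, one_mul]
  have hφle (s : ℝ) (hs : s ∈ Icc 0 T) : φ s ≤ N * Real.exp (k * s) := by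
    rw [hφN s, mul_comm N]
    exact mul_le_mul_of_nonneg_left (hmax hs) (Real.exp_pos _).le
  have hsub : Icc 0 t₀ ⊆ Icc 0 T := Icc_subset_Icc_right ht₀.2
  have habel : abelIntegral a φ t₀ ≤ N * abelIntegral a (fun s => Real.exp (k * s)) t₀ := by
    simp only [abelIntegral, ← integral_const_mul, smul_eq_mul, mul_left_comm N]
    refine setIntegral_mono_on (integrableOn_sub_rpow_smul_of_continuousOn ha (hφ.mono hsub))
      (integrableOn_sub_rpow_smul_of_continuousOn ha (by fun_prop)) measurableSet_Ioo fun s hs => ?_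
    exact mul_le_mul_of_nonneg_left (hφle s (hsub (Ioo_subset_Icc_self hs)))
      (Real.rpow_nonneg (sub_pos.2 hs.2).le _)
  have hcontract : φ t₀ ≤ Real.exp (k * t₀) * (N / 2) := by
    calc φ t₀ ≤ C * (N * (Real.exp (k * t₀) *
          ((1 / k) ^ (a + 1) * Real.Gamma (a + 1)))) := (hle t₀ ht₀).trans (by
            gcongr; exact habel.trans (by gcongr; exact abelIntegral_exp_le ha hk ht₀.1))
      _ = Real.exp (k * t₀) * N * (C * ((1 / k) ^ (a + 1) * Real.Gamma (a + 1))) := by ring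
      _ ≤ Real.exp (k * t₀) * N * (1 / 2) := by gcongr
      _ = Real.exp (k * t₀) * (N / 2) := by ring
  have hNzero : N = 0 := by
    rw [hφN t₀, mul_le_mul_iff_right₀ (Real.exp_pos _)] at hcontract
    linarith
  have hφt := hφle t ht
  rw [hNzero, zero_mul] at hφt
  exact le_antisymm hφt (hφ0 t ht)

lemma eq_zero_of_eq_smul_abelIntegral_clm {T c : ℝ} (ha : -1 < a) (B : E →L[ℝ] E) {y : ℝ → E}
    (hy : ContinuousOn y (Icc 0 T))
    (heq : ∀ t ∈ Icc 0 T, y t = c • abelIntegral a (fun s => B (y s)) t) (ht : t ∈ Icc 0 T) :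
    y t = 0 := by
  refine norm_eq_zero.1 (eq_zero_of_le_abelIntegral (φ := fun t => ‖y t‖) (C := |c| * ‖B‖) ha
    (by positivity) hy.norm (fun _ _ => norm_nonneg _) (fun t ht => ?_) ht)
  rw [heq t ht, norm_smul, Real.norm_eq_abs, mul_assoc]
  refine mul_le_mul_of_nonneg_left ?_ (abs_nonneg c)
  have hsub : Icc 0 t ⊆ Icc 0 T := Icc_subset_Icc_right ht.2
  rw [abelIntegral, abelIntegral, ← integral_const_mul]
  refine norm_integral_le_of_norm_le
    ((integrableOn_sub_rpow_smul_of_continuousOn ha (hy.norm.mono hsub)).const_mul _)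
    ((ae_restrict_iff' measurableSet_Ioo).2 (ae_of_all _ fun s hs => ?_))
  have hweight : 0 ≤ (t - s) ^ a := Real.rpow_nonneg (sub_pos.2 hs.2).le _
  rw [norm_smul, Real.norm_of_nonneg hweight, smul_eq_mul, mul_left_comm]
  exact mul_le_mul_of_nonneg_left (B.le_opNorm (y s)) hweight

end FractionalIntegration

section CaputoCauchyProblem

lemma integrableOn_Icc_of_locallyIntegrableOn_Ioi {E : Type*} [NormedAddCommGroup E] {v : ℝ → E}
    (hv : LocallyIntegrableOn v (Ioi 0)) {s t : ℝ} (hs : 0 < s) : IntegrableOn v (Icc s t) :=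
  hv.integrableOn_compact_subset (fun _ hx => hs.trans_le hx.1) isCompact_Icc

variable {E : Type*} [NormedAddCommGroup E] [NormedSpace ℝ E]

lemma integrableOn_of_rpow_neg_smul {α t : ℝ} (hα : 0 ≤ α) {v : ℝ → E}
    (hv : AEStronglyMeasurable v (volume.restrict (Ioo 0 t)))
    (h : IntegrableOn (fun s => (t - s) ^ (-α) • v s) (Ioo 0 t)) : IntegrableOn v (Ioo 0 t) := by
  refine Integrable.mono' (h.norm.const_mul (t ^ α)) hv
    ((ae_restrict_iff' measurableSet_Ioo).2 (ae_of_all _ fun s hs => ?_))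
  have hpos : 0 < t - s := sub_pos.2 hs.2
  have hle : (t - s) ^ α ≤ t ^ α := Real.rpow_le_rpow hpos.le (by linarith [hs.1]) hα
  rw [norm_smul, Real.norm_of_nonneg (Real.rpow_nonneg hpos.le _)]
  calc ‖v s‖ = (t - s) ^ α * ((t - s) ^ (-α) * ‖v s‖) := by
        rw [← mul_assoc, ← Real.rpow_add hpos, add_neg_cancel, Real.rpow_zero, one_mul]
    _ ≤ t ^ α * ((t - s) ^ (-α) * ‖v s‖) := by gcongr

lemma exists_norm_le_of_primitive {y v : ℝ → E} {y₀ : E} (hv : LocallyIntegrableOn v (Ioi 0))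
    (hyv : ∀ s t : ℝ, 0 < s → s ≤ t → y t - y s = ∫ r in s..t, v r)
    (hy0 : Tendsto y (𝓝[>] 0) (𝓝 y₀)) (T : ℝ) : ∃ M, ∀ t ∈ Ioo 0 T, ‖y t‖ ≤ M := by
  have hnear : ∀ᶠ t in 𝓝[>] (0 : ℝ), ‖y t‖ < ‖y₀‖ + 1 :=
    hy0.norm.eventually (gt_mem_nhds (by linarith))
  obtain ⟨δ, hδ : 0 < δ, hδ_near⟩ := (mem_nhdsGT_iff_exists_Ioo_subset).1 hnear
  have hη : 0 < δ / 2 := by positivity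
  refine ⟨max (‖y₀‖ + 1) (‖y (δ / 2)‖ + ∫ r in Icc (δ / 2) T, ‖v r‖), fun t ht => ?_⟩
  rcases lt_or_ge t (δ / 2) with hlt | hge
  · exact le_max_of_le_left (le_of_lt (hδ_near ⟨ht.1, by linarith⟩))
  · refine le_max_of_le_right ?_
    rw [← add_sub_cancel (y (δ / 2)) (y t), hyv _ t hη hge]
    refine (norm_add_le _ _).trans (add_le_add le_rfl ?_)
    refine (intervalIntegral.norm_integral_le_integral_norm hge).trans ?_
    rw [intervalIntegral.integral_of_le hge]
    exact setIntegral_mono_set (integrableOn_Icc_of_locallyIntegrableOn_Ioi hv hη).norm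
      (ae_of_all _ fun _ => norm_nonneg _) (ae_of_all _ fun r hr => ⟨hr.1.le, hr.2.trans ht.2.le⟩)

lemma continuousOn_integral_Icc {v : ℝ → E} {T : ℝ} (hT : 0 ≤ T) (hv : IntegrableOn v (Ioo 0 T)) :
    ContinuousOn (fun t => ∫ r in (0 : ℝ)..t, v r) (Icc 0 T) := by
  rw [← uIcc_of_le hT]
  refine intervalIntegral.continuousOn_primitive_interval ?_
  rwa [uIcc_of_le hT, integrableOn_Icc_iff_integrableOn_Ioo]

lemma eq_integral_of_primitive {y v : ℝ → E}
    (hyv : ∀ s t : ℝ, 0 < s → s ≤ t → y t - y s = ∫ r in s..t, v r)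
    (hy0 : Tendsto y (𝓝[>] 0) (𝓝 0)) {t : ℝ} (ht : 0 < t) (hv : IntegrableOn v (Ioo 0 t)) :
    y t = ∫ r in (0 : ℝ)..t, v r := by
  have hcont := intervalIntegral.continuousOn_primitive_interval_left (f := v) (μ := volume)
    (a := 0) (b := t) (by rwa [uIcc_of_le ht.le, integrableOn_Icc_iff_integrableOn_Ioo])
  rw [uIcc_of_le ht.le] at hcont
  have hlim : Tendsto (fun s => ∫ r in s..t, v r) (𝓝[>] 0) (𝓝 (∫ r in (0 : ℝ)..t, v r)) :=
    (hcont 0 (left_mem_Icc.2 ht.le)).mono_left (nhdsWithin_le_iff.2 (Icc_mem_nhdsGT ht))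
  have hsub : Tendsto (fun s => y t - y s) (𝓝[>] 0) (𝓝 (y t)) := by
    simpa using hy0.const_sub (y t)
  refine tendsto_nhds_unique (hsub.congr' ?_) hlim
  filter_upwards [Ioo_mem_nhdsGT ht] with s hs
  exact hyv s t hs.1 hs.2.le

variable {d : ℕ} {α : ℝ} {v w y : ℝ → L2 d}

lemma integrableOn_of_hasCaputo {T M : ℝ} (hα : 0 ≤ α) (hT : 0 < T)
    (hv : LocallyIntegrableOn v (Ioi 0)) (hw : ∀ t ∈ Ioo 0 T, ‖w t‖ ≤ M)
    (heq : ∀ᵐ t : ℝ, 0 < t → HasCaputo α v t (w t)) : IntegrableOn v (Ioo 0 T) := by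
  have hmeas (t : ℝ) : AEStronglyMeasurable v (volume.restrict (Ioo 0 t)) :=
    hv.aestronglyMeasurable.mono_set Ioo_subset_Ioi_self
  by_cases hone : α = 1
  · refine IntegrableOn.of_bound (C := M) (by simp) (hmeas T) ?_
    rw [ae_restrict_iff' measurableSet_Ioo]
    filter_upwards [heq] with t ht htT
    have hvw := ht htT.1
    rw [HasCaputo, if_pos hone] at hvw
    exact hvw ▸ hw t htT
  · have : NeBot (ae (volume.restrict (Ioi T))) := by
      rw [ae_neBot, Ne, Measure.restrict_eq_zero]
      simp
    obtain ⟨t, ht, hTt : T < t⟩ :=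
      ((ae_restrict_of_ae heq).and (ae_restrict_mem (measurableSet_Ioi (a := T)))).exists
    have hvw := ht (hT.trans hTt)
    rw [HasCaputo, if_neg hone] at hvw
    exact (integrableOn_of_rpow_neg_smul hα (hmeas t) hvw.1).mono_set
      (Ioo_subset_Ioo_right hTt.le)

theorem integral_eq_smul_abelIntegral_of_hasCaputo (hα : 0 < α) (hα1 : α ≤ 1) {t : ℝ}
    (hv : IntegrableOn v (Ioo 0 t)) (heq : ∀ᵐ s : ℝ, 0 < s → HasCaputo α v s (w s)) :
    ∫ r in Ioo 0 t, v r = (Real.Gamma α)⁻¹ • abelIntegral (α - 1) w t := by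
  rcases hα1.eq_or_lt with rfl | hlt
  · simp only [abelIntegral, sub_self, Real.rpow_zero, one_smul, Real.Gamma_one, inv_one]
    refine setIntegral_congr_ae measurableSet_Ioo ?_
    filter_upwards [heq] with s hs hst
    simpa [HasCaputo] using hs hst.1
  · have : 0 < Real.Gamma (1 - α) := Real.Gamma_pos_of_pos (sub_pos.2 hlt)
    have : 0 < Real.Gamma α := Real.Gamma_pos_of_pos hα
    have hw : abelIntegral (α - 1) w t =
        (Real.Gamma (1 - α))⁻¹ • abelIntegral (α - 1) (abelIntegral (-α) v) t := by
      rw [abelIntegral, abelIntegral, ← integral_smul]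
      refine setIntegral_congr_ae measurableSet_Ioo ?_
      filter_upwards [heq] with s hs hst
      have hvw := hs hst.1
      rw [HasCaputo, if_neg hlt.ne] at hvw
      rw [smul_comm, abelIntegral, hvw.2]
    have hexp : α - 1 + -α + 1 = 0 := by ring
    have hsemigroup := abelIntegral_abelIntegral (a := α - 1) (b := -α) (v := v) (t := t)
      (by linarith) (by linarith) hv.aestronglyMeasurable (by simpa [hexp] using hv)
    rw [hw, hsemigroup, hexp, ProbabilityTheory.beta, neg_add_eq_sub, sub_add_cancel,
      sub_add_cancel, Real.Gamma_one, div_one, smul_smul, smul_smul]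
    have hcancel : (Real.Gamma α)⁻¹ * (Real.Gamma (1 - α))⁻¹ *
        (Real.Gamma (1 - α) * Real.Gamma α) = 1 := by
      field_simp
    rw [hcancel, one_smul]
    simp [abelIntegral]

/- Inverting the Caputo derivative turns the equation into a Volterra equation with an Abel kernel,
to which the singular Gronwall inequality applies. -/
theorem eq_zero_of_hasCaputo_clm (hα : 0 < α) (hα1 : α ≤ 1) (B : L2 d →L[ℝ] L2 d)
    (hv : LocallyIntegrableOn v (Ioi 0))
    (hyv : ∀ s t : ℝ, 0 < s → s ≤ t → y t - y s = ∫ r in s..t, v r)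
    (hy0 : Tendsto y (𝓝[>] 0) (𝓝 0)) (heq : ∀ᵐ t : ℝ, 0 < t → HasCaputo α v t (B (y t)))
    {t : ℝ} (ht : 0 < t) : y t = 0 := by
  have hfi {T : ℝ} (hT : 0 < T) : IntegrableOn v (Ioo 0 T) := by
    obtain ⟨M, hM⟩ := exists_norm_le_of_primitive hv hyv hy0 T
    exact integrableOn_of_hasCaputo hα.le hT hv (fun s hs => (B.le_opNorm_of_le (hM s hs))) heq
  have hy {s : ℝ} (hs : 0 < s) : y s = ∫ r in (0 : ℝ)..s, v r :=
    eq_integral_of_primitive hyv hy0 hs (hfi hs)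
  rw [hy ht]
  refine eq_zero_of_eq_smul_abelIntegral_clm (c := (Real.Gamma α)⁻¹) (T := t) (a := α - 1)
    (by linarith) B
    (continuousOn_integral_Icc ht.le (hfi ht)) (fun s hs => ?_) (right_mem_Icc.2 ht.le)
  rcases hs.1.eq_or_lt with rfl | hspos
  · simp [abelIntegral]
  rw [intervalIntegral.integral_of_le hs.1, integral_Ioc_eq_integral_Ioo,
    integral_eq_smul_abelIntegral_of_hasCaputo hα hα1 (hfi hspos) heq]
  congr 1
  exact setIntegral_congr_fun measurableSet_Ioo fun r hr => by simp only [hy hr.1]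

end CaputoCauchyProblem

section Uniqueness

open scoped FourierTransform

variable {d : ℕ} {α β t : ℝ}

lemma exists_mulOp {m : Space d → ℂ} (hm : Measurable m) {C : ℝ} (hC : ∀ ξ, ‖m ξ‖ ≤ C) :
    ∃ B : L2 d →L[ℂ] L2 d, ∀ f : L2 d, (B f : Space d → ℂ) =ᵐ[volume] fun ξ => m ξ * f ξ := by
  have hmem : MemLp m ⊤ (volume : Measure (Space d)) :=
    memLp_top_of_bound hm.aestronglyMeasurable C (ae_of_all _ hC)
  refine ⟨(ContinuousLinearMap.mul ℂ ℂ).holderL volume ⊤ 2 2 (hmem.toLp m), fun f => ?_⟩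
  filter_upwards [ContinuousLinearMap.coeFn_holder (r := 2) (ContinuousLinearMap.mul ℂ ℂ)
    (hmem.toLp m) f, hmem.coeFn_toLp] with ξ hholder hm
  rw [ContinuousLinearMap.holderL_apply_apply, hholder, hm, ContinuousLinearMap.mul_apply']

lemma norm_symbol_mul_indicator_closedBall_le (R : ℝ) (ξ : Space d) :
    ‖(symbol ξ : ℂ) * (Metric.closedBall 0 R).indicator 1 ξ‖ ≤ (2 * π * R) ^ 2 := by
  by_cases hξ : ξ ∈ Metric.closedBall (0 : Space d) R
  · have hR : ‖ξ‖ ≤ R := mem_closedBall_zero_iff.1 hξ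
    have := Real.pi_pos
    rw [indicator_of_mem hξ, Pi.one_apply, mul_one, Complex.norm_real, symbol,
      Real.norm_of_nonneg (by positivity)]
    gcongr
  · rw [indicator_of_notMem hξ, mul_zero, norm_zero]
    positivity

/- On frequencies `‖ξ‖ ≤ R` the symbol of `H₀` is bounded, so after a frequency cutoff `H₀` acts as
a bounded operator. -/
lemma exists_bandLimited_freeHamiltonian (R : ℝ) : ∃ P B : L2 d →L[ℂ] L2 d,
    (∀ f, P f = 0 → ∀ᵐ ξ : Space d, ‖ξ‖ ≤ R → (𝓕 f : L2 d) ξ = 0) ∧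
    ∀ f g, FreeHamiltonian f g → P g = B (P f) := by
  let χ : Space d → ℂ := (Metric.closedBall 0 R).indicator 1
  have hχ_meas : Measurable χ :=
    measurable_const.indicator Metric.isClosed_closedBall.measurableSet
  have hχ_norm (ξ : Space d) : ‖χ ξ‖ ≤ 1 := by
    refine (norm_indicator_le_norm_self _ _).trans ?_
    simp
  have hsymbol_meas : Measurable fun ξ : Space d => (symbol ξ : ℂ) :=
    hasTemperateGrowth_symbol.1.continuous.measurable
  obtain ⟨cutoff, hcutoff⟩ := exists_mulOp hχ_meas hχ_norm
  obtain ⟨B, hB⟩ := exists_mulOp (hsymbol_meas.mul hχ_meas)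
    (norm_symbol_mul_indicator_closedBall_le R)
  refine ⟨cutoff ∘L (Lp.fourierTransformₗᵢ (Space d) ℂ : L2 d →L[ℂ] L2 d), B, fun f hf => ?_,
    fun f g hfg => ?_⟩
  · have hPf := hcutoff (𝓕 f)
    rw [show cutoff (𝓕 f : L2 d) = 0 from hf] at hPf
    filter_upwards [hPf, Lp.coeFn_zero ℂ 2 (volume : Measure (Space d))] with ξ hξ hzero hR
    rw [hzero, Pi.zero_apply, show χ ξ = 1 from indicator_of_mem (by simpa using hR) _,
      one_mul] at hξ
    exact hξ.symm
  · change cutoff (𝓕 g : L2 d) = B (cutoff (𝓕 f : L2 d))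
    refine Lp.ext ?_
    filter_upwards [hB (cutoff (𝓕 f)), hcutoff (𝓕 f), hcutoff (𝓕 g),
      (freeHamiltonian_iff f g).1 hfg] with ξ hBf hf hg hfg
    have hχ_idem : χ ξ * χ ξ = χ ξ := by
      by_cases h : ξ ∈ Metric.closedBall (0 : Space d) R <;> simp [χ, h]
    rw [hBf, hf, hg, hfg, Pi.mul_apply]
    linear_combination (-symbol ξ * (𝓕 f : L2 d) ξ) * hχ_idem

lemma FreeHamiltonian.sub {f f' g g' : L2 d} (h : FreeHamiltonian f g)
    (h' : FreeHamiltonian f' g') : FreeHamiltonian (f - f') (g - g') := by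
  have hsub (a b : L2 d) : (𝓕 (a - b) : L2 d) = 𝓕 a - 𝓕 b :=
    map_sub (Lp.fourierTransformₗᵢ (Space d) ℂ) a b
  rw [freeHamiltonian_iff] at h h' ⊢
  rw [hsub, hsub]
  filter_upwards [h, h', Lp.coeFn_sub (𝓕 f : L2 d) (𝓕 f'), Lp.coeFn_sub (𝓕 g : L2 d) (𝓕 g')]
    with ξ hg hg' hf_sub hg_sub
  rw [hg_sub, hf_sub, Pi.sub_apply, Pi.sub_apply, hg, hg', mul_sub]

lemma HasCaputo.sub {v v' : ℝ → L2 d} {c c' : L2 d} (h : HasCaputo α v t c)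
    (h' : HasCaputo α v' t c') : HasCaputo α (fun s => v s - v' s) t (c - c') := by
  by_cases hα : α = 1
  · rw [HasCaputo, if_pos hα] at *
    rw [h, h']
  · rw [HasCaputo, if_neg hα] at *
    simp_rw [smul_sub]
    exact ⟨h.1.sub h'.1, by rw [integral_sub h.1 h'.1, smul_sub, h.2, h'.2]⟩

lemma HasCaputo.clm_comp {v : ℝ → L2 d} {c : L2 d} (P : L2 d →L[ℝ] L2 d)
    (h : HasCaputo α v t c) : HasCaputo α (fun s => P (v s)) t (P c) := by
  by_cases hα : α = 1
  · rw [HasCaputo, if_pos hα] at *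
    rw [h]
  · rw [HasCaputo, if_neg hα] at *
    simp_rw [← map_smul]
    exact ⟨P.integrable_comp h.1, by rw [P.integral_comp_comm h.1, ← map_smul, h.2]⟩

lemma intervalIntegrable_of_locallyIntegrableOn_Ioi {E : Type*} [NormedAddCommGroup E] {v : ℝ → E}
    (hv : LocallyIntegrableOn v (Ioi 0)) {a b : ℝ} (ha : 0 < a) (hab : a ≤ b) :
    IntervalIntegrable v volume a b := by
  rw [intervalIntegrable_iff_integrableOn_Icc_of_le hab]
  exact integrableOn_Icc_of_locallyIntegrableOn_Ioi hv ha

lemma IsSolution.sub {u₀ u₀' : L2 d} {u u' : ℝ → L2 d} (hu : IsSolution α β u₀ u)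
    (hu' : IsSolution α β u₀' u') : IsSolution α β (u₀ - u₀') (fun t => u t - u' t) := by
  obtain ⟨v, w, hui, hwi, hw, hv, huv, heq, hlim⟩ := hu
  obtain ⟨v', w', hui', hwi', hw', hv', huv', heq', hlim'⟩ := hu'
  refine ⟨fun t => v t - v' t, fun t => w t - w' t, hui.sub hui', hwi.sub hwi', ?_, hv.sub hv',
    fun s t hs hst => ?_, ?_, ?_⟩
  · filter_upwards [hw, hw'] with t h h' ht using (h ht).sub (h' ht)
  · rw [intervalIntegral.integral_sub (intervalIntegrable_of_locallyIntegrableOn_Ioi hv hs hst)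
      (intervalIntegrable_of_locallyIntegrableOn_Ioi hv' hs hst), ← huv s t hs hst,
      ← huv' s t hs hst, sub_sub_sub_comm]
  · filter_upwards [heq, heq'] with t h h' ht
    obtain ⟨c, hc, hcw⟩ := h ht
    obtain ⟨c', hc', hcw'⟩ := h' ht
    refine ⟨c - c', hc.sub hc', ?_⟩
    rw [smul_sub, sub_add_sub_comm, hcw, hcw', sub_zero]
  · rw [← tendsto_iff_norm_sub_tendsto_zero] at hlim hlim' ⊢
    exact hlim.sub hlim'

lemma I_cpow_mul_phase (α : ℝ) : I ^ (α : ℂ) * phase α = 1 := by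
  rw [Complex.cpow_def_of_ne_zero Complex.I_ne_zero, Complex.log_I, phase, ← Complex.exp_add,
    ← Complex.exp_zero]
  congr 1
  push_cast
  ring

lemma neg_I_cpow_smul_add_eq_zero_iff (α : ℝ) (c w : L2 d) :
    -(I ^ (α : ℂ)) • c + w = 0 ↔ c = phase α • w := by
  rw [neg_smul, neg_add_eq_zero]
  constructor
  · rintro rfl
    rw [smul_smul, mul_comm, I_cpow_mul_phase, one_smul]
  · rintro rfl
    rw [smul_smul, I_cpow_mul_phase, one_smul]

lemma eq_zero_of_fourier_eq_zero_on_balls {f : L2 d}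
    (h : ∀ R : ℕ, ∀ᵐ ξ : Space d, ‖ξ‖ ≤ R → (𝓕 f : L2 d) ξ = 0) : f = 0 := by
  have hzero : (𝓕 f : L2 d) = 0 := by
    refine Lp.ext ?_
    filter_upwards [ae_all_iff.2 h, Lp.coeFn_zero ℂ 2 (volume : Measure (Space d))] with ξ hball h0
    obtain ⟨R, hR⟩ := exists_nat_ge ‖ξ‖
    rw [hball R hR, h0, Pi.zero_apply]
  rw [← norm_eq_zero, ← Lp.norm_fourier_eq, hzero, norm_zero]

lemma IsSolution.eq_zero (hα : 0 < α) (hα1 : α ≤ 1) {u : ℝ → L2 d} (hu : IsSolution α α 0 u)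
    (ht : 0 < t) : u t = 0 := by
  obtain ⟨v, w, -, -, hw, hv, huv, heq, hlim⟩ := hu
  refine eq_zero_of_fourier_eq_zero_on_balls fun R => ?_
  obtain ⟨P, B, hP, hPB⟩ := exists_bandLimited_freeHamiltonian (d := d) R
  refine hP (u t) (eq_zero_of_hasCaputo_clm (y := fun t => P (u t)) (v := fun t => P (v t))
    hα hα1 ((phase α • B).restrictScalars ℝ)
    ((P.restrictScalars ℝ).locallyIntegrableOn_comp hv) (fun r s hr hrs => ?_) ?_ ?_ ht)
  · rw [P.intervalIntegral_comp_comm (intervalIntegrable_of_locallyIntegrableOn_Ioi hv hr hrs),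
      ← huv r s hr hrs, map_sub]
  · rw [← tendsto_iff_norm_sub_tendsto_zero] at hlim
    have hP0 : Tendsto (fun s => P (u s)) (𝓝[>] 0) (𝓝 (P 0)) :=
      (P.continuous.tendsto 0).comp hlim
    rwa [map_zero] at hP0
  · filter_upwards [hw, heq] with s hs hcs hs0
    obtain ⟨c, hc, hcw⟩ := hcs hs0
    rw [neg_I_cpow_smul_add_eq_zero_iff] at hcw
    have hPc : (phase α • B) (P (u s)) = P c := by
      rw [hcw, map_smul, hPB _ _ (hs hs0), _root_.smul_apply]
    exact hPc ▸ hc.clm_comp (P.restrictScalars ℝ)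

theorem IsSolution.eqOn (hα : 0 < α) (hα1 : α ≤ 1) {u₀ : L2 d} {u u' : ℝ → L2 d}
    (hu : IsSolution α α u₀ u) (hu' : IsSolution α α u₀ u') : EqOn u u' (Ioi 0) := fun _ ht =>
  sub_eq_zero.1 ((sub_self u₀ ▸ hu.sub hu').eq_zero hα hα1 ht)

end Uniqueness

section SquareIntegrableFamilies

variable {X : Type*} [MeasurableSpace X] {μ : Measure X}

lemma norm_sq_eq_integral (f : Lp ℂ 2 μ) : ‖f‖ ^ 2 = ∫ x, ‖f x‖ ^ 2 ∂μ := by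
  have hinner := L2.inner_def (𝕜 := ℂ) f f
  simp only [inner_self_eq_norm_sq_to_K, ← RCLike.ofReal_pow] at hinner
  rw [integral_ofReal] at hinner
  exact Complex.ofReal_injective hinner

lemma integrable_norm_sq (f : Lp ℂ 2 μ) : Integrable (fun x => ‖f x‖ ^ 2) μ :=
  (memLp_two_iff_integrable_sq_norm (Lp.memLp f).1).1 (Lp.memLp f)

/-- The class in `L²` of a square integrable function; for all other functions it is `0`, so that
families of functions can be mapped to `L²` without carrying a proof of integrability. -/
def toL2 (f : X → ℂ) (μ : Measure X := by volume_tac) : Lp ℂ 2 μ :=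
  open Classical in if h : MemLp f 2 μ then h.toLp f else 0

lemma coeFn_toL2 {f : X → ℂ} (hf : MemLp f 2 μ) : (toL2 f μ : X → ℂ) =ᵐ[μ] f := by
  rw [toL2, dif_pos hf]
  exact hf.coeFn_toLp

lemma toL2_sub {f g : X → ℂ} (hf : MemLp f 2 μ) (hg : MemLp g 2 μ) :
    toL2 (fun x => f x - g x) μ = toL2 f μ - toL2 g μ := by
  simp only [toL2, dif_pos hf, dif_pos hg, dif_pos (show MemLp (fun x => f x - g x) 2 μ from
    hf.sub hg)]
  exact MemLp.toLp_sub hf hg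

lemma toL2_const_mul {f : X → ℂ} (hf : MemLp f 2 μ) (c : ℂ) :
    toL2 (fun x => c * f x) μ = c • toL2 f μ := by
  simp only [toL2, dif_pos hf, dif_pos (hf.const_mul c)]
  exact MemLp.toLp_const_smul c hf

lemma memLp_of_norm_le_mul {f : X → ℂ} {h : X → ℝ} {p : ENNReal} (hh : MemLp h p μ)
    (hf : AEStronglyMeasurable f μ) {b : ℝ} (hb : ∀ x, ‖f x‖ ≤ b * h x) : MemLp f p μ :=
  (hh.const_mul b).mono hf (ae_of_all _ fun x => (hb x).trans (le_abs_self _))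

lemma tendsto_integral_norm_sub_sq {l : Filter ℝ} [l.IsCountablyGenerated] {M : ℝ → X → ℂ}
    {f : X → ℂ} {g : X → ℝ} (hg : MemLp g 2 μ) (hM : ∀ t, AEStronglyMeasurable (M t) μ)
    (hf : AEStronglyMeasurable f μ) (hle : ∀ᶠ t in l, ∀ x, ‖M t x - f x‖ ≤ g x)
    (hlim : ∀ x, Tendsto (fun t => M t x) l (𝓝 (f x))) :
    Tendsto (fun t => ∫ x, ‖M t x - f x‖ ^ 2 ∂μ) l (𝓝 0) := by
  rw [← integral_zero X ℝ (μ := μ)]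
  refine tendsto_integral_filter_of_dominated_convergence (fun x => g x ^ 2)
    (Eventually.of_forall fun t => ((hM t).sub hf).norm.pow 2) ?_
    ((memLp_two_iff_integrable_sq hg.1).1 hg) (ae_of_all _ fun x => ?_)
  · filter_upwards [hle] with t ht
    refine ae_of_all _ fun x => ?_
    rw [norm_pow, norm_norm]
    gcongr
    exact ht x
  · simpa using ((hlim x).sub_const (f x)).norm.pow 2

lemma continuousOn_toL2 {M : ℝ → X → ℂ} {h : X → ℝ} {b : ℝ → ℝ} {S : Set ℝ}
    (hh : MemLp h 2 μ) (hM : ∀ t, AEStronglyMeasurable (M t) μ) (hb : ContinuousOn b S)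
    (hMb : ∀ t ∈ S, ∀ x, ‖M t x‖ ≤ b t * h x) (hMc : ∀ x, ContinuousOn (fun t => M t x) S) :
    ContinuousOn (fun t => toL2 (M t) μ) S := by
  intro t₀ ht₀
  have hmem (t : ℝ) (ht : t ∈ S) : MemLp (M t) 2 μ := memLp_of_norm_le_mul hh (hM t) (hMb t ht)
  have hdom : ∀ᶠ t in 𝓝[S] t₀, ∀ x, ‖M t x - M t₀ x‖ ≤ (|b t₀| + 1 + |b t₀|) * |h x| := by
    filter_upwards [(hb t₀ ht₀).abs.eventually (gt_mem_nhds (lt_add_one _)), self_mem_nhdsWithin]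
      with t ht htS x
    have habs (s : ℝ) : b s * h x ≤ |b s| * |h x| := (le_abs_self _).trans_eq (abs_mul _ _)
    rw [add_mul]
    refine (norm_sub_le _ _).trans (add_le_add ((hMb t htS x).trans ((habs t).trans ?_))
      ((hMb t₀ ht₀ x).trans (habs t₀)))
    gcongr
  have hsq : Tendsto (fun t => ‖toL2 (M t) μ - toL2 (M t₀) μ‖ ^ 2) (𝓝[S] t₀) (𝓝 0) := by
    refine (tendsto_integral_norm_sub_sq (hh.abs.const_mul _) hM (hM t₀) hdom
      fun x => hMc x t₀ ht₀).congr' ?_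
    filter_upwards [self_mem_nhdsWithin] with t ht
    rw [norm_sq_eq_integral, ← toL2_sub (hmem t ht) (hmem t₀ ht₀)]
    refine integral_congr_ae ?_
    have hsub : MemLp (fun x => M t x - M t₀ x) 2 μ := (hmem t ht).sub (hmem t₀ ht₀)
    filter_upwards [coeFn_toL2 hsub] with x hx
    rw [hx]
  rw [ContinuousWithinAt, tendsto_iff_norm_sub_tendsto_zero]
  simpa [Real.sqrt_sq (norm_nonneg _)] using hsq.sqrt

lemma integrableOn_toL2 {M : ℝ → X → ℂ} {h : X → ℝ} {b : ℝ → ℝ} {A : Set ℝ}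
    (hA : MeasurableSet A) (hh : MemLp h 2 μ) (hM : ∀ t, AEStronglyMeasurable (M t) μ)
    (hb : IntegrableOn b A) (hb0 : ∀ t ∈ A, 0 ≤ b t) (hMb : ∀ t ∈ A, ∀ x, ‖M t x‖ ≤ b t * h x)
    (hU : AEStronglyMeasurable (fun t => toL2 (M t) μ) (volume.restrict A)) :
    IntegrableOn (fun t => toL2 (M t) μ) A := by
  refine Integrable.mono' (hb.mul_const ‖hh.toLp h‖) hU
    ((ae_restrict_iff' hA).2 (ae_of_all _ fun t ht => ?_))
  refine Lp.norm_le_mul_norm_of_ae_le_mul ?_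
  filter_upwards [coeFn_toL2 (memLp_of_norm_le_mul hh (hM t) (hMb t ht)), hh.coeFn_toLp]
    with x hM hh
  rw [hM, hh]
  exact (hMb t ht x).trans (mul_le_mul_of_nonneg_left (Real.le_norm_self _) (hb0 t ht))

variable [SFinite μ]

lemma integral_integral_inner_swap {M : ℝ → X → ℂ} {h : X → ℝ} {b : ℝ → ℝ} {A : Set ℝ}
    (hA : MeasurableSet A) (hh : MemLp h 2 μ) (hM : Measurable (Function.uncurry M))
    (hb : IntegrableOn b A) (hMb : ∀ t ∈ A, ∀ x, ‖M t x‖ ≤ b t * h x) (ψ : Lp ℂ 2 μ) :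
    ∫ t in A, ∫ x, inner ℂ (ψ x) (M t x) ∂μ = ∫ x, (∫ t in A, inner ℂ (ψ x) (M t x)) ∂μ := by
  have hψ : Integrable (fun x => ‖ψ x‖ * h x) μ := (Lp.memLp ψ).norm.integrable_mul hh
  refine integral_integral_swap (Integrable.mono' (Integrable.mul_prod hb hψ)
    ((Lp.memLp ψ).1.comp_snd.inner hM.aestronglyMeasurable) ?_)
  have hfst : ∀ᵐ p ∂((volume.restrict A).prod μ), p.1 ∈ A :=
    Measure.quasiMeasurePreserving_fst.ae (ae_restrict_mem hA)
  filter_upwards [hfst] with p hp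
  calc ‖inner ℂ (ψ p.2) (M p.1 p.2)‖
      ≤ ‖ψ p.2‖ * ‖M p.1 p.2‖ := norm_inner_le_norm _ _
    _ ≤ ‖ψ p.2‖ * (b p.1 * h p.2) := by gcongr; exact hMb _ hp _
    _ = b p.1 * (‖ψ p.2‖ * h p.2) := by ring

theorem integral_toL2 {M : ℝ → X → ℂ} {h : X → ℝ} {b : ℝ → ℝ} {A : Set ℝ}
    (hA : MeasurableSet A) (hh : MemLp h 2 μ) (hM : Measurable (Function.uncurry M))
    (hb : IntegrableOn b A) (hMb : ∀ t ∈ A, ∀ x, ‖M t x‖ ≤ b t * h x)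
    (hU : IntegrableOn (fun t => toL2 (M t) μ) A) :
    ∫ t in A, toL2 (M t) μ = toL2 (fun x => ∫ t in A, M t x) μ := by
  have hmem (t : ℝ) (ht : t ∈ A) : MemLp (M t) 2 μ :=
    memLp_of_norm_le_mul hh (hM.comp measurable_prodMk_left).aestronglyMeasurable (hMb t ht)
  have hMb_ae (x : X) : ∀ᵐ t ∂volume.restrict A, ‖M t x‖ ≤ b t * h x :=
    (ae_restrict_iff' hA).2 (ae_of_all _ fun t ht => hMb t ht x)
  have hMi (x : X) : IntegrableOn (fun t => M t x) A := Integrable.mono' (hb.mul_const (h x))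
    (hM.comp measurable_prodMk_right).aestronglyMeasurable (hMb_ae x)
  have hVmem : MemLp (fun x => ∫ t in A, M t x) 2 μ := by
    refine memLp_of_norm_le_mul hh hM.stronglyMeasurable.integral_prod_left.aestronglyMeasurable
      (b := ∫ t in A, b t) fun x => ?_
    rw [← integral_mul_const]
    exact norm_integral_le_of_norm_le (hb.mul_const _) (hMb_ae x)
  refine ext_inner_left ℂ fun ψ => ?_
  calc inner ℂ ψ (∫ t in A, toL2 (M t) μ)
      = ∫ t in A, inner ℂ ψ (toL2 (M t) μ) := (integral_inner hU ψ).symm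
    _ = ∫ t in A, ∫ x, inner ℂ (ψ x) (M t x) ∂μ := by
        refine setIntegral_congr_fun hA fun t ht => ?_
        rw [L2.inner_def]
        refine integral_congr_ae ?_
        filter_upwards [coeFn_toL2 (hmem t ht)] with x hx
        rw [hx]
    _ = ∫ x, (∫ t in A, inner ℂ (ψ x) (M t x)) ∂μ :=
        integral_integral_inner_swap hA hh hM hb hMb ψ
    _ = inner ℂ ψ (toL2 (fun x => ∫ t in A, M t x) μ) := by
        rw [L2.inner_def]
        refine integral_congr_ae ?_
        filter_upwards [coeFn_toL2 hVmem] with x hx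
        rw [hx, integral_inner (hMi x)]

end SquareIntegrableFamilies

section Propagator

variable {d : ℕ} {α t : ℝ}

/-- The weight `(1 + ‖ξ‖²)^p`, which dominates all multipliers of polynomial growth. -/
def weight (p : ℝ) (ξ : Space d) : ℝ := (1 + ‖ξ‖ ^ 2) ^ p

lemma one_le_weight {p : ℝ} (hp : 0 ≤ p) (ξ : Space d) : 1 ≤ weight p ξ :=
  Real.one_le_rpow (by nlinarith [sq_nonneg ‖ξ‖]) hp

lemma weight_mono {p q : ℝ} (hpq : p ≤ q) (ξ : Space d) : weight p ξ ≤ weight q ξ :=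
  Real.rpow_le_rpow_of_exponent_le (by nlinarith [sq_nonneg ‖ξ‖]) hpq

lemma norm_rpow_le_weight {a p : ℝ} (ha : 0 ≤ a) (hap : a ≤ 2 * p) (ξ : Space d) :
    ‖ξ‖ ^ a ≤ weight p ξ := by
  calc ‖ξ‖ ^ a = (‖ξ‖ ^ 2) ^ (a / 2) := by
        rw [← Real.rpow_natCast, ← Real.rpow_mul (norm_nonneg _)]
        congr 1
        push_cast
        ring
    _ ≤ weight (a / 2) ξ := Real.rpow_le_rpow (by positivity) (by linarith) (by positivity)
    _ ≤ weight p ξ := weight_mono (by linarith) ξ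

lemma memLp_weight_mul (f : 𝓢(Space d, ℂ)) (p : ℝ) (q : ENNReal) :
    MemLp (fun ξ => weight p ξ * ‖f ξ‖) q volume := by
  have hgrowth : (fun ξ : Space d => (weight p ξ : ℂ)).HasTemperateGrowth := by
    have := Function.hasTemperateGrowth_one_add_norm_sq_rpow (Space d) p
    unfold weight
    fun_prop
  convert ((SchwartzMap.smulLeftCLM ℂ (fun ξ : Space d => (weight p ξ : ℂ)) f).memLp q
    (volume : Measure (Space d))).norm using 2 with ξ
  rw [SchwartzMap.smulLeftCLM_apply_apply hgrowth, norm_smul, Complex.norm_real,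
    Real.norm_of_nonneg]
  exact Real.rpow_nonneg (by positivity) _

/-- The frequency `‖2πξ‖^(2/α)` at which the mode `ξ` of the solution oscillates in time. -/
def freq (α : ℝ) (ξ : Space d) : ℝ := symbol ξ ^ (1 / α)

lemma symbol_nonneg (ξ : Space d) : 0 ≤ symbol ξ := sq_nonneg _

lemma freq_nonneg (α : ℝ) (ξ : Space d) : 0 ≤ freq α ξ := Real.rpow_nonneg (symbol_nonneg ξ) _

lemma continuous_symbol : Continuous (symbol : Space d → ℝ) := by
  unfold symbol
  fun_prop

lemma continuous_freq (hα : 0 < α) : Continuous (freq α : Space d → ℝ) :=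
  continuous_symbol.rpow_const fun _ => Or.inr (by positivity)

lemma freq_rpow (hα : 0 < α) (ξ : Space d) : freq α ξ ^ α = symbol ξ := by
  rw [freq, ← Real.rpow_mul (symbol_nonneg ξ), one_div, inv_mul_cancel₀ hα.ne', Real.rpow_one]

lemma symbol_le (ξ : Space d) : symbol ξ ≤ (2 * π) ^ 2 * (1 + ‖ξ‖ ^ 2) := by
  rw [symbol, mul_pow]
  gcongr
  linarith

lemma freq_le (hα : 0 < α) (ξ : Space d) :
    freq α ξ ≤ ((2 * π) ^ 2) ^ (1 / α) * weight (1 / α) ξ := by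
  rw [freq, weight, ← Real.mul_rpow (by positivity) (by positivity)]
  exact Real.rpow_le_rpow (symbol_nonneg ξ) (symbol_le ξ) (by positivity)

lemma exists_symbol_freq_le (hα : 0 < α) (hα1 : α ≤ 1) : ∃ C : ℝ, 1 ≤ C ∧
    ∀ ξ : Space d, symbol ξ ≤ C * weight (1 / α) ξ ∧ freq α ξ ≤ C * weight (1 / α) ξ := by
  have h1α : 1 ≤ 1 / α := (one_le_div hα).2 hα1
  have hone : (1 : ℝ) ≤ (2 * π) ^ 2 := by nlinarith [Real.pi_gt_three]
  have hC : (2 * π) ^ 2 ≤ ((2 * π) ^ 2) ^ (1 / α) :=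
    Real.self_le_rpow_of_one_le hone h1α
  refine ⟨((2 * π) ^ 2) ^ (1 / α), hone.trans hC, fun ξ => ⟨(symbol_le ξ).trans ?_,
    freq_le hα ξ⟩⟩
  have hweight : 1 + ‖ξ‖ ^ 2 ≤ weight (1 / α) ξ :=
    Real.self_le_rpow_of_one_le (by nlinarith [sq_nonneg ‖ξ‖]) h1α
  gcongr

/-- The multiplier of the solution operator at time `t`. -/
def propagator (α t : ℝ) (ξ : Space d) : ℂ := relax α (freq α ξ * t)

/-- The time derivative of `propagator`. -/
def propagatorDeriv (α t : ℝ) (ξ : Space d) : ℂ := freq α ξ * relaxDeriv α (freq α ξ * t)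

lemma hasDerivAt_propagator (hα : 0 < α) (hα1 : α ≤ 1) (ξ : Space d) (ht : 0 < t) :
    HasDerivAt (fun t => propagator α t ξ) (propagatorDeriv α t ξ) t := by
  rcases (freq_nonneg α ξ).eq_or_lt with hzero | hpos
  · simp only [propagator, propagatorDeriv, ← hzero, zero_mul, Complex.ofReal_zero]
    exact hasDerivAt_const _ _
  · refine ((hasDerivAt_relax hα hα1 (mul_pos hpos ht)).scomp t
      ((hasDerivAt_id t).const_mul (freq α ξ))).congr_deriv ?_
    simp [propagatorDeriv]

lemma continuousOn_propagator (hα : 0 < α) (hα1 : α ≤ 1) (ξ : Space d) :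
    ContinuousOn (fun t => propagator α t ξ) (Ici 0) :=
  (continuousOn_relax hα hα1).comp (by fun_prop) fun _ ht => mul_nonneg (freq_nonneg α ξ) ht

lemma continuousOn_propagatorDeriv (hα : 0 < α) (hα1 : α ≤ 1) (ξ : Space d) :
    ContinuousOn (fun t => propagatorDeriv α t ξ) (Ioi 0) := by
  rcases (freq_nonneg α ξ).eq_or_lt with hzero | hpos
  · simp only [propagatorDeriv, ← hzero, Complex.ofReal_zero, zero_mul]
    exact continuousOn_const
  · exact continuousOn_const.mul ((continuousOn_relaxDeriv hα hα1).comp (by fun_prop)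
      fun _ ht => mul_pos hpos ht)

lemma measurable_relax (α : ℝ) : Measurable (relax α) := by
  have hdensity : Measurable (relaxDensity α) := measurable_relaxDensity α
  refine Measurable.add (by fun_prop) (StronglyMeasurable.integral_prod_right
    (f := fun (τ r : ℝ) => Real.exp (-(τ * r)) • relaxDensity α r)
    (Measurable.stronglyMeasurable ?_)).measurable
  fun_prop

lemma measurable_propagator (hα : 0 < α) :
    Measurable (Function.uncurry (propagator α : ℝ → Space d → ℂ)) := by
  have := (continuous_freq (d := d) hα).measurable
  exact (measurable_relax α).comp (by fun_prop)

lemma measurable_propagatorDeriv (hα : 0 < α) :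
    Measurable (Function.uncurry (propagatorDeriv α : ℝ → Space d → ℂ)) := by
  have := (continuous_freq (d := d) hα).measurable
  have hderiv : Measurable (relaxDeriv α) := Measurable.sub (by fun_prop) (measurable_relaxRem α)
  have hfreq : Measurable fun p : ℝ × Space d => (freq α p.2 : ℂ) := by fun_prop
  exact hfreq.mul (hderiv.comp (by fun_prop))

lemma exists_norm_propagatorDeriv_le (hα : 0 < α) (hα1 : α ≤ 1) : ∃ C : ℝ, 0 < C ∧
    ∀ (t : ℝ) (ξ : Space d), 0 < t →
      ‖propagatorDeriv α t ξ‖ ≤ C * (1 + t ^ (α - 1)) * weight (1 / α) ξ := by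
  obtain ⟨C, hC, hderiv⟩ := exists_norm_relaxDeriv_le hα hα1
  obtain ⟨D, hD, hD_le⟩ := exists_symbol_freq_le (d := d) hα hα1
  refine ⟨C * D, by positivity, fun t ξ ht => ?_⟩
  obtain ⟨hsymbol, hfreq⟩ := hD_le ξ
  have : 0 < weight (1 / α) ξ := one_pos.trans_le (one_le_weight (by positivity) ξ)
  have := Real.rpow_pos_of_pos ht (α - 1)
  rw [propagatorDeriv, norm_mul, Complex.norm_real, Real.norm_of_nonneg (freq_nonneg α ξ)]
  rcases (freq_nonneg α ξ).eq_or_lt with hzero | hpos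
  · rw [← hzero, zero_mul]
    positivity
  · have hrpow : freq α ξ * (freq α ξ * t) ^ (α - 1) = symbol ξ * t ^ (α - 1) := by
      rw [Real.mul_rpow hpos.le ht.le, Real.rpow_sub_one hpos.ne', freq_rpow hα]
      field_simp
    calc freq α ξ * ‖relaxDeriv α (freq α ξ * t)‖
        ≤ freq α ξ * (C * (1 + (freq α ξ * t) ^ (α - 1))) := by
          gcongr
          exact hderiv _ (mul_pos hpos ht)
      _ = C * (freq α ξ + symbol ξ * t ^ (α - 1)) := by
          rw [← hrpow]
          ring
      _ ≤ C * (D * weight (1 / α) ξ + D * weight (1 / α) ξ * t ^ (α - 1)) := by gcongr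
      _ = C * D * (1 + t ^ (α - 1)) * weight (1 / α) ξ := by ring

lemma abelIntegral_comp_mul_left {E : Type*} [NormedAddCommGroup E] [NormedSpace ℝ E] {k : ℝ}
    (hk : 0 < k) (ht : 0 ≤ t) (a : ℝ) (f : ℝ → E) :
    abelIntegral a (fun s => f (k * s)) t = k ^ (-a - 1) • abelIntegral a f (k * t) := by
  have hscale (s : ℝ) (hs : s ∈ Ioo 0 t) :
      (t - s) ^ a • f (k * s) = k ^ (-a) • ((k * t - k * s) ^ a • f (k * s)) := by
    rw [← mul_sub, Real.mul_rpow hk.le (sub_pos.2 hs.2).le, smul_smul, ← mul_assoc,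
      ← Real.rpow_add hk, neg_add_cancel, Real.rpow_zero, one_mul]
  rw [abelIntegral, setIntegral_congr_fun measurableSet_Ioo hscale, integral_smul,
    ← integral_Ioc_eq_integral_Ioo, ← intervalIntegral.integral_of_le ht,
    intervalIntegral.integral_comp_mul_left (fun σ => (k * t - σ) ^ a • f σ) hk.ne', mul_zero,
    intervalIntegral.integral_of_le (by positivity), integral_Ioc_eq_integral_Ioo, smul_smul,
    Real.rpow_sub_one hk.ne', div_eq_mul_inv, abelIntegral]

lemma abelIntegral_propagatorDeriv (hα : 0 < α) (hα1 : α < 1) (ht : 0 < t) (ξ : Space d) :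
    abelIntegral (-α) (fun s => propagatorDeriv α s ξ) t =
      Real.Gamma (1 - α) * (phase α * (symbol ξ * propagator α t ξ)) := by
  rcases (freq_nonneg α ξ).eq_or_lt with hzero | hpos
  · have hsymbol : symbol ξ = 0 := by rw [← freq_rpow hα, ← hzero, Real.zero_rpow hα.ne']
    simp [abelIntegral, propagatorDeriv, ← hzero, hsymbol]
  · have hsmul (s : ℝ) : propagatorDeriv α s ξ = (freq α ξ • relaxDeriv α) (freq α ξ * s) := by
      rw [propagatorDeriv, Pi.smul_apply, Complex.real_smul]
    have hconst : abelIntegral (-α) (freq α ξ • relaxDeriv α) (freq α ξ * t) =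
        freq α ξ • abelIntegral (-α) (relaxDeriv α) (freq α ξ * t) := by
      simp only [abelIntegral, Pi.smul_apply, smul_comm _ (freq α ξ), integral_smul]
    have hexp : freq α ξ ^ (- -α - 1) * freq α ξ = symbol ξ := by
      rw [neg_neg, Real.rpow_sub_one hpos.ne', div_mul_cancel₀ _ hpos.ne', freq_rpow hα]
    simp_rw [hsmul]
    rw [abelIntegral_comp_mul_left hpos ht.le, hconst,
      abelIntegral_relaxDeriv hα hα1 (mul_pos hpos ht), smul_smul, hexp, Complex.real_smul,
      propagator]
    ring

lemma propagatorDeriv_one (t : ℝ) (ξ : Space d) :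
    propagatorDeriv 1 t ξ = phase 1 * (symbol ξ * propagator 1 t ξ) := by
  have hphase : phase 1 = -I := by
    rw [phase, ← Complex.exp_neg_pi_div_two_mul_I]
    congr 1
    push_cast
    ring
  simp [propagatorDeriv, propagator, relaxDeriv, relax, relaxRem, laplace, relaxDensity_one, freq,
    hphase]
  ring

end Propagator

section Solution

open scoped FourierTransform

variable {d : ℕ} {α s t : ℝ}

/-- The Fourier transform of the solution whose initial value has Fourier transform `f`. -/
def fourierSolution (α : ℝ) (f : 𝓢(Space d, ℂ)) (t : ℝ) (ξ : Space d) : ℂ :=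
  propagator α t ξ * f ξ

/-- The time derivative of `fourierSolution`. -/
def fourierSolutionDeriv (α : ℝ) (f : 𝓢(Space d, ℂ)) (t : ℝ) (ξ : Space d) : ℂ :=
  propagatorDeriv α t ξ * f ξ

/-- The solution with initial value `u₀`. -/
def solution (α : ℝ) (u₀ : 𝓢(Space d, ℂ)) (t : ℝ) : L2 d := 𝓕⁻ (toL2 (fourierSolution α (𝓕 u₀) t))

lemma measurable_fourierSolution (hα : 0 < α) (f : 𝓢(Space d, ℂ)) :
    Measurable (Function.uncurry (fourierSolution α f)) :=
  (measurable_propagator hα).mul (f.continuous.measurable.comp measurable_snd)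

lemma measurable_fourierSolutionDeriv (hα : 0 < α) (f : 𝓢(Space d, ℂ)) :
    Measurable (Function.uncurry (fourierSolutionDeriv α f)) :=
  (measurable_propagatorDeriv hα).mul (f.continuous.measurable.comp measurable_snd)

lemma aestronglyMeasurable_fourierSolution (hα : 0 < α) (f : 𝓢(Space d, ℂ)) (t : ℝ) :
    AEStronglyMeasurable (fourierSolution α f t) :=
  (measurable_fourierSolution hα f).of_uncurry_left.aestronglyMeasurable

lemma aestronglyMeasurable_fourierSolutionDeriv (hα : 0 < α) (f : 𝓢(Space d, ℂ)) (t : ℝ) :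
    AEStronglyMeasurable (fourierSolutionDeriv α f t) :=
  (measurable_fourierSolutionDeriv hα f).of_uncurry_left.aestronglyMeasurable

lemma aestronglyMeasurable_symbol_mul_fourierSolution (hα : 0 < α) (f : 𝓢(Space d, ℂ)) (t : ℝ) :
    AEStronglyMeasurable fun ξ => symbol ξ * fourierSolution α f t ξ :=
  (Complex.continuous_ofReal.comp continuous_symbol).aestronglyMeasurable.mul
    (aestronglyMeasurable_fourierSolution hα f t)

lemma exists_norm_fourierSolution_le (hα : 0 < α) (hα1 : α ≤ 1) (f : 𝓢(Space d, ℂ)) : ∃ C : ℝ,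
    ∀ t, 0 ≤ t → ∀ ξ, ‖fourierSolution α f t ξ‖ ≤ C * (weight (1 / α) ξ * ‖f ξ‖) ∧
      ‖symbol ξ * fourierSolution α f t ξ‖ ≤ C * (weight (1 / α) ξ * ‖f ξ‖) := by
  obtain ⟨C, hC, hrelax⟩ := exists_norm_relax_le hα hα1
  obtain ⟨D, hD, hsymbol⟩ := exists_symbol_freq_le (d := d) hα hα1
  refine ⟨D * C, fun t ht ξ => ?_⟩
  have hpropagator : ‖propagator α t ξ‖ ≤ C := hrelax _ (mul_nonneg (freq_nonneg α ξ) ht)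
  have hweight : 1 ≤ weight (1 / α) ξ := one_le_weight (by positivity) ξ
  simp only [fourierSolution, norm_mul, Complex.norm_real, Real.norm_of_nonneg (symbol_nonneg ξ)]
  constructor
  · calc ‖propagator α t ξ‖ * ‖f ξ‖ = 1 * ‖propagator α t ξ‖ * (1 * ‖f ξ‖) := by ring
      _ ≤ D * C * (weight (1 / α) ξ * ‖f ξ‖) := by gcongr
  · calc symbol ξ * (‖propagator α t ξ‖ * ‖f ξ‖)
        ≤ (D * weight (1 / α) ξ) * (C * ‖f ξ‖) := by gcongr; exact (hsymbol ξ).1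
      _ = D * C * (weight (1 / α) ξ * ‖f ξ‖) := by ring

lemma exists_norm_fourierSolutionDeriv_le (hα : 0 < α) (hα1 : α ≤ 1) (f : 𝓢(Space d, ℂ)) : ∃ C : ℝ,
    0 < C ∧ ∀ t, 0 < t → ∀ ξ,
      ‖fourierSolutionDeriv α f t ξ‖ ≤ C * (1 + t ^ (α - 1)) * (weight (1 / α) ξ * ‖f ξ‖) := by
  obtain ⟨C, hC, hderiv⟩ := exists_norm_propagatorDeriv_le (d := d) hα hα1
  refine ⟨C, hC, fun t ht ξ => ?_⟩
  rw [fourierSolutionDeriv, norm_mul, ← mul_assoc]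
  gcongr
  exact hderiv t ξ ht

lemma memLp_fourierSolution (hα : 0 < α) (hα1 : α ≤ 1) (f : 𝓢(Space d, ℂ)) (ht : 0 ≤ t) :
    MemLp (fourierSolution α f t) 2 volume := by
  obtain ⟨C, hC⟩ := exists_norm_fourierSolution_le hα hα1 f
  exact memLp_of_norm_le_mul (memLp_weight_mul f (1 / α) 2)
    (aestronglyMeasurable_fourierSolution hα f t) fun ξ => (hC t ht ξ).1

lemma memLp_symbol_mul_fourierSolution (hα : 0 < α) (hα1 : α ≤ 1) (f : 𝓢(Space d, ℂ))
    (ht : 0 ≤ t) : MemLp (fun ξ => symbol ξ * fourierSolution α f t ξ) 2 volume := by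
  obtain ⟨C, hC⟩ := exists_norm_fourierSolution_le hα hα1 f
  exact memLp_of_norm_le_mul (memLp_weight_mul f (1 / α) 2)
    (aestronglyMeasurable_symbol_mul_fourierSolution hα f t) fun ξ => (hC t ht ξ).2

lemma memLp_fourierSolutionDeriv (hα : 0 < α) (hα1 : α ≤ 1) (f : 𝓢(Space d, ℂ)) (ht : 0 < t) :
    MemLp (fourierSolutionDeriv α f t) 2 volume := by
  obtain ⟨C, -, hC⟩ := exists_norm_fourierSolutionDeriv_le hα hα1 f
  exact memLp_of_norm_le_mul (memLp_weight_mul f (1 / α) 2)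
    (aestronglyMeasurable_fourierSolutionDeriv hα f t) (hC t ht)

lemma continuousOn_toL2_fourierSolution (hα : 0 < α) (hα1 : α ≤ 1) (f : 𝓢(Space d, ℂ)) :
    ContinuousOn (fun t => toL2 (fourierSolution α f t)) (Ici 0) := by
  obtain ⟨C, hC⟩ := exists_norm_fourierSolution_le hα hα1 f
  exact continuousOn_toL2 (memLp_weight_mul f (1 / α) 2)
    (aestronglyMeasurable_fourierSolution hα f) (continuousOn_const (c := C))
    (fun t ht ξ => (hC t ht ξ).1)
    fun ξ => (continuousOn_propagator hα hα1 ξ).mul continuousOn_const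

lemma continuousOn_toL2_symbol_mul_fourierSolution (hα : 0 < α) (hα1 : α ≤ 1) (f : 𝓢(Space d, ℂ)) :
    ContinuousOn (fun t => toL2 fun ξ => symbol ξ * fourierSolution α f t ξ) (Ici 0) := by
  obtain ⟨C, hC⟩ := exists_norm_fourierSolution_le hα hα1 f
  exact continuousOn_toL2 (memLp_weight_mul f (1 / α) 2)
    (aestronglyMeasurable_symbol_mul_fourierSolution hα f) (continuousOn_const (c := C))
    (fun t ht ξ => (hC t ht ξ).2)
    fun ξ => continuousOn_const.mul ((continuousOn_propagator hα hα1 ξ).mul continuousOn_const)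

lemma continuousOn_const_mul_one_add_rpow (C a : ℝ) :
    ContinuousOn (fun t : ℝ => C * (1 + t ^ a)) (Ioi 0) :=
  continuousOn_const.mul (continuousOn_const.add
    (continuousOn_id.rpow_const fun _ ht => Or.inl (ne_of_gt ht)))

lemma continuousOn_toL2_fourierSolutionDeriv (hα : 0 < α) (hα1 : α ≤ 1) (f : 𝓢(Space d, ℂ)) :
    ContinuousOn (fun t => toL2 (fourierSolutionDeriv α f t)) (Ioi 0) := by
  obtain ⟨C, -, hC⟩ := exists_norm_fourierSolutionDeriv_le hα hα1 f
  exact continuousOn_toL2 (memLp_weight_mul f (1 / α) 2)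
    (aestronglyMeasurable_fourierSolutionDeriv hα f) (continuousOn_const_mul_one_add_rpow C (α - 1))
    hC fun ξ => (continuousOn_propagatorDeriv hα hα1 ξ).mul continuousOn_const

lemma fourierSolution_sub (hα : 0 < α) (hα1 : α ≤ 1) (f : 𝓢(Space d, ℂ)) (hs : 0 < s)
    (hst : s ≤ t) (ξ : Space d) : fourierSolution α f t ξ - fourierSolution α f s ξ =
      ∫ r in s..t, fourierSolutionDeriv α f r ξ := by
  have hpos : uIcc s t ⊆ Ioi 0 := fun r hr => hs.trans_le (uIcc_of_le hst ▸ hr).1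
  exact (intervalIntegral.integral_eq_sub_of_hasDerivAt
    (f := fun r => fourierSolution α f r ξ)
    (fun r hr => (hasDerivAt_propagator hα hα1 ξ (hpos hr)).mul_const _)
    (((continuousOn_propagatorDeriv hα hα1 ξ).mul continuousOn_const).mono
      hpos).intervalIntegrable).symm

lemma toL2_fourierSolution_sub (hα : 0 < α) (hα1 : α ≤ 1) (f : 𝓢(Space d, ℂ)) (hs : 0 < s)
    (hst : s ≤ t) : toL2 (fourierSolution α f t) volume - toL2 (fourierSolution α f s) volume =
      ∫ r in s..t, toL2 (fourierSolutionDeriv α f r) := by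
  obtain ⟨C, -, hC⟩ := exists_norm_fourierSolutionDeriv_le hα hα1 f
  have hIcc : Icc s t ⊆ Ioi 0 := fun r hr => hs.trans_le hr.1
  have hbound : IntegrableOn (fun r : ℝ => C * (1 + r ^ (α - 1))) (Ioc s t) :=
    ((continuousOn_const_mul_one_add_rpow C (α - 1)).mono hIcc).integrableOn_Icc.mono_set
      Ioc_subset_Icc_self
  have hU : IntegrableOn (fun r => toL2 (fourierSolutionDeriv α f r)) (Ioc s t) :=
    ((continuousOn_toL2_fourierSolutionDeriv hα hα1 f).mono hIcc).integrableOn_Icc.mono_set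
      Ioc_subset_Icc_self
  rw [intervalIntegral.integral_of_le hst, integral_toL2 measurableSet_Ioc
    (memLp_weight_mul f (1 / α) 2) (measurable_fourierSolutionDeriv hα f) hbound
    (fun r hr => hC r (hs.trans hr.1)) hU,
    ← toL2_sub (memLp_fourierSolution hα hα1 f (hs.le.trans hst))
      (memLp_fourierSolution hα hα1 f hs.le)]
  simp_rw [fourierSolution_sub hα hα1 f hs hst, intervalIntegral.integral_of_le hst]

lemma toL2_fourierSolutionDeriv_one (f : 𝓢(Space d, ℂ)) (ht : 0 ≤ t) :
    toL2 (fourierSolutionDeriv 1 f t) =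
      phase 1 • toL2 fun ξ => symbol ξ * fourierSolution 1 f t ξ := by
  rw [← toL2_const_mul (memLp_symbol_mul_fourierSolution one_pos le_rfl f ht)]
  congr 1
  ext ξ
  rw [fourierSolutionDeriv, propagatorDeriv_one, fourierSolution]
  ring

lemma rpow_smul_toL2_fourierSolutionDeriv (hα : 0 < α) (hα1 : α ≤ 1) (f : 𝓢(Space d, ℂ))
    (hs : 0 < s) : (t - s) ^ (-α) • toL2 (fourierSolutionDeriv α f s) =
      toL2 fun ξ => ((t - s) ^ (-α) : ℝ) * fourierSolutionDeriv α f s ξ := by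
  rw [toL2_const_mul (memLp_fourierSolutionDeriv hα hα1 f hs)]
  exact (Complex.coe_smul _ _).symm

lemma exists_norm_rpow_mul_fourierSolutionDeriv_le (hα : 0 < α) (hα1 : α < 1) (f : 𝓢(Space d, ℂ))
    (t : ℝ) : ∃ b : ℝ → ℝ, IntegrableOn b (Ioo 0 t) ∧ (∀ s ∈ Ioo 0 t, 0 ≤ b s) ∧
      ∀ s ∈ Ioo 0 t, ∀ ξ, ‖((t - s) ^ (-α) : ℝ) * fourierSolutionDeriv α f s ξ‖ ≤
        b s * (weight (1 / α) ξ * ‖f ξ‖) := by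
  obtain ⟨C, hC, hderiv⟩ := exists_norm_fourierSolutionDeriv_le hα hα1.le f
  have hpow (s : ℝ) (hs : s ∈ Ioo 0 t) : 0 ≤ (t - s) ^ (-α) :=
    Real.rpow_nonneg (sub_pos.2 hs.2).le _
  refine ⟨fun s => (t - s) ^ (-α) * (C * (1 + s ^ (α - 1))), ?_, fun s hs => ?_, fun s hs ξ => ?_⟩
  · have hzero : IntegrableOn (fun s : ℝ => (t - s) ^ (-α) * s ^ (0 : ℝ)) (Ioo 0 t) :=
      integrableOn_Ioo_sub_rpow_mul_rpow (by linarith) (by norm_num)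
    have hsing : IntegrableOn (fun s : ℝ => (t - s) ^ (-α) * s ^ (α - 1)) (Ioo 0 t) :=
      integrableOn_Ioo_sub_rpow_mul_rpow (by linarith) (by linarith)
    refine ((hzero.add hsing).const_mul C).congr (ae_of_all _ fun s => ?_)
    simp only [Pi.add_apply, Real.rpow_zero]
    ring
  · have := hpow s hs
    have := Real.rpow_nonneg hs.1.le (α - 1)
    positivity
  · rw [norm_mul, Complex.norm_real, Real.norm_of_nonneg (hpow s hs), mul_assoc]
    exact mul_le_mul_of_nonneg_left (hderiv s hs.1 ξ) (hpow s hs)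

lemma integrableOn_rpow_smul_toL2_fourierSolutionDeriv (hα : 0 < α) (hα1 : α < 1)
    (f : 𝓢(Space d, ℂ)) (t : ℝ) :
    IntegrableOn (fun s => (t - s) ^ (-α) • toL2 (fourierSolutionDeriv α f s)) (Ioo 0 t) := by
  obtain ⟨b, hb, hb0, hle⟩ := exists_norm_rpow_mul_fourierSolutionDeriv_le hα hα1 f t
  have heq (s : ℝ) (hs : s ∈ Ioo 0 t) :=
    rpow_smul_toL2_fourierSolutionDeriv (t := t) hα hα1.le f hs.1
  have hcont : ContinuousOn (fun s => (t - s) ^ (-α) • toL2 (fourierSolutionDeriv α f s))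
      (Ioo 0 t) :=
    ((continuousOn_const.sub continuousOn_id).rpow_const fun s hs =>
      Or.inl (sub_pos.2 hs.2).ne').smul
      ((continuousOn_toL2_fourierSolutionDeriv hα hα1.le f).mono Ioo_subset_Ioi_self)
  refine IntegrableOn.congr_fun ?_ (fun s hs => (heq s hs).symm) measurableSet_Ioo
  exact integrableOn_toL2 measurableSet_Ioo (memLp_weight_mul f (1 / α) 2)
    (fun s => (aestronglyMeasurable_fourierSolutionDeriv hα f s).const_mul _) hb hb0 hle
    ((hcont.congr fun s hs => (heq s hs).symm).aestronglyMeasurable measurableSet_Ioo)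

lemma abelIntegral_toL2_fourierSolutionDeriv (hα : 0 < α) (hα1 : α < 1) (f : 𝓢(Space d, ℂ))
    (ht : 0 < t) : abelIntegral (-α) (fun s => toL2 (fourierSolutionDeriv α f s)) t =
      (Real.Gamma (1 - α) * phase α : ℂ) • toL2 fun ξ => symbol ξ * fourierSolution α f t ξ := by
  obtain ⟨b, hb, -, hle⟩ := exists_norm_rpow_mul_fourierSolutionDeriv_le hα hα1 f t
  have heq (s : ℝ) (hs : s ∈ Ioo 0 t) :=
    rpow_smul_toL2_fourierSolutionDeriv (t := t) hα hα1.le f hs.1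
  have hmeas : Measurable (Function.uncurry fun s ξ =>
      ((t - s) ^ (-α) : ℝ) * fourierSolutionDeriv α f s ξ) :=
    Measurable.mul (by fun_prop) (measurable_fourierSolutionDeriv hα f)
  have hpointwise (ξ : Space d) :
      ∫ s in Ioo 0 t, ((t - s) ^ (-α) : ℝ) * fourierSolutionDeriv α f s ξ =
        (Real.Gamma (1 - α) * phase α : ℂ) * (symbol ξ * fourierSolution α f t ξ) := by
    calc ∫ s in Ioo 0 t, ((t - s) ^ (-α) : ℝ) * fourierSolutionDeriv α f s ξ
        = abelIntegral (-α) (fun s => propagatorDeriv α s ξ) t * f ξ := by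
          simp only [abelIntegral, fourierSolutionDeriv, Complex.real_smul, ← mul_assoc,
            integral_mul_const]
      _ = (Real.Gamma (1 - α) * phase α : ℂ) * (symbol ξ * fourierSolution α f t ξ) := by
          rw [abelIntegral_propagatorDeriv hα hα1 ht, fourierSolution]
          ring
  rw [abelIntegral, setIntegral_congr_fun measurableSet_Ioo heq,
    integral_toL2 measurableSet_Ioo (memLp_weight_mul f (1 / α) 2) hmeas hb hle
      ((integrableOn_rpow_smul_toL2_fourierSolutionDeriv hα hα1 f t).congr_fun heq
        measurableSet_Ioo),
    ← toL2_const_mul (memLp_symbol_mul_fourierSolution hα hα1.le f ht.le)]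
  simp_rw [hpointwise]

lemma hasCaputo_toL2_fourierSolutionDeriv (hα : 0 < α) (hα1 : α ≤ 1) (f : 𝓢(Space d, ℂ))
    (ht : 0 < t) : HasCaputo α (fun s => toL2 (fourierSolutionDeriv α f s)) t
      (phase α • toL2 (fun ξ => symbol ξ * fourierSolution α f t ξ) volume) := by
  rcases hα1.eq_or_lt with rfl | hlt
  · rw [HasCaputo, if_pos rfl, toL2_fourierSolutionDeriv_one f ht.le]
  · rw [HasCaputo, if_neg hlt.ne]
    refine ⟨integrableOn_rpow_smul_toL2_fourierSolutionDeriv hα hlt f t, ?_⟩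
    have hΓ : (Real.Gamma (1 - α) : ℂ) ≠ 0 :=
      Complex.ofReal_ne_zero.2 (Real.Gamma_pos_of_pos (sub_pos.2 hlt)).ne'
    have habel := abelIntegral_toL2_fourierSolutionDeriv hα hlt f ht
    rw [abelIntegral] at habel
    rw [habel]
    refine (Complex.coe_smul _ _).symm.trans ?_
    rw [smul_smul, Complex.ofReal_inv, inv_mul_cancel_left₀ hΓ]

lemma solution_zero (hα : 0 < α) (hα1 : α ≤ 1) (u₀ : 𝓢(Space d, ℂ)) :
    solution α u₀ 0 = u₀.toLp 2 := by
  have hfourier : toL2 (fourierSolution α (𝓕 u₀) 0) = 𝓕 (u₀.toLp 2 : L2 d) := by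
    rw [SchwartzMap.toLp_fourier_eq]
    refine Lp.ext ?_
    filter_upwards [coeFn_toL2 (memLp_fourierSolution hα hα1 (𝓕 u₀) le_rfl),
      (𝓕 u₀).coeFn_toLp 2 (volume : Measure (Space d))] with ξ hleft hright
    rw [hleft, hright, fourierSolution, propagator, mul_zero, relax_zero hα hα1, one_mul]
  rw [solution, hfourier, FourierTransform.fourierInv_fourier_eq]

/-- The inverse Fourier transform on `L²`, as a continuous linear equivalence. -/
def fourierInvL2 (d : ℕ) : L2 d ≃L[ℂ] L2 d :=
  (Lp.fourierTransformₗᵢ (Space d) ℂ).symm.toContinuousLinearEquiv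

lemma fourierInvL2_apply (f : L2 d) : fourierInvL2 d f = 𝓕⁻ f :=
  rfl

lemma solution_eq_fourierInvL2 (α : ℝ) (u₀ : 𝓢(Space d, ℂ)) (t : ℝ) :
    solution α u₀ t = fourierInvL2 d (toL2 (fourierSolution α (𝓕 u₀) t)) :=
  rfl

lemma continuousOn_solution (hα : 0 < α) (hα1 : α ≤ 1) (u₀ : 𝓢(Space d, ℂ)) :
    ContinuousOn (solution α u₀) (Ici 0) :=
  (fourierInvL2 d).continuous.comp_continuousOn (continuousOn_toL2_fourierSolution hα hα1 (𝓕 u₀))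

lemma tendsto_norm_solution_sub (hα : 0 < α) (hα1 : α ≤ 1) (u₀ : 𝓢(Space d, ℂ)) :
    Tendsto (fun t => ‖solution α u₀ t - u₀.toLp 2 volume‖) (𝓝[>] 0) (𝓝 0) := by
  have hcont : Tendsto (solution α u₀) (𝓝[>] 0) (𝓝 (solution α u₀ 0)) :=
    (continuousOn_solution hα hα1 u₀ 0 self_mem_Ici).mono Ioi_subset_Ici_self
  rwa [solution_zero hα hα1, tendsto_iff_norm_sub_tendsto_zero] at hcont

lemma solution_sub (hα : 0 < α) (hα1 : α ≤ 1) (u₀ : 𝓢(Space d, ℂ)) (hs : 0 < s) (hst : s ≤ t) :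
    solution α u₀ t - solution α u₀ s =
      ∫ r in s..t, fourierInvL2 d (toL2 (fourierSolutionDeriv α (𝓕 u₀) r)) := by
  rw [solution_eq_fourierInvL2, solution_eq_fourierInvL2, ← map_sub,
    toL2_fourierSolution_sub hα hα1 (𝓕 u₀) hs hst, intervalIntegral.integral_of_le hst,
    intervalIntegral.integral_of_le hst, ContinuousLinearEquiv.integral_comp_comm]

lemma freeHamiltonian_solution (hα : 0 < α) (hα1 : α ≤ 1) (u₀ : 𝓢(Space d, ℂ)) (ht : 0 ≤ t) :
    FreeHamiltonian (solution α u₀ t)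
      (fourierInvL2 d (toL2 fun ξ => symbol ξ * fourierSolution α (𝓕 u₀) t ξ)) := by
  rw [solution, fourierInvL2_apply, freeHamiltonian_iff, FourierTransform.fourier_fourierInv_eq,
    FourierTransform.fourier_fourierInv_eq]
  filter_upwards [coeFn_toL2 (memLp_fourierSolution hα hα1 (𝓕 u₀) ht),
    coeFn_toL2 (memLp_symbol_mul_fourierSolution hα hα1 (𝓕 u₀) ht)] with ξ hu hw
  rw [hu, hw]

lemma hasCaputo_solution (hα : 0 < α) (hα1 : α ≤ 1) (u₀ : 𝓢(Space d, ℂ)) (ht : 0 < t) :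
    HasCaputo α (fun s => fourierInvL2 d (toL2 (fourierSolutionDeriv α (𝓕 u₀) s))) t
      (phase α • fourierInvL2 d (toL2 fun ξ => symbol ξ * fourierSolution α (𝓕 u₀) t ξ)) := by
  rw [← map_smul]
  exact (hasCaputo_toL2_fourierSolutionDeriv hα hα1 (𝓕 u₀) ht).clm_comp
    ((fourierInvL2 d : L2 d →L[ℂ] L2 d).restrictScalars ℝ)

theorem isSolution_solution (hα : 0 < α) (hα1 : α ≤ 1) (u₀ : 𝓢(Space d, ℂ)) :
    IsSolution α α (u₀.toLp 2) (solution α u₀) := by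
  have hΦ : Continuous (fourierInvL2 d) := (fourierInvL2 d).continuous
  have hu := (continuousOn_solution hα hα1 u₀).mono Ioi_subset_Ici_self
  have hw := (hΦ.comp_continuousOn
    (continuousOn_toL2_symbol_mul_fourierSolution hα hα1 (𝓕 u₀))).mono Ioi_subset_Ici_self
  have hv := hΦ.comp_continuousOn (continuousOn_toL2_fourierSolutionDeriv hα hα1 (𝓕 u₀))
  exact ⟨_, _, hu.locallyIntegrableOn measurableSet_Ioi, hw.locallyIntegrableOn measurableSet_Ioi,
    ae_of_all _ fun t ht => freeHamiltonian_solution hα hα1 u₀ ht.le,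
    hv.locallyIntegrableOn measurableSet_Ioi,
    fun s t hs hst => solution_sub hα hα1 u₀ hs hst,
    ae_of_all _ fun t ht => ⟨_, hasCaputo_solution hα hα1 u₀ ht,
      (neg_I_cpow_smul_add_eq_zero_iff α _ _).2 rfl⟩,
    tendsto_norm_solution_sub hα hα1 u₀⟩

end Solution

section PropagatorGradient

variable {d : ℕ} {α t : ℝ}

lemma exists_norm_relax_sub_one_le (hα : 0 < α) (hα1 : α ≤ 1) : ∃ C : ℝ, 0 < C ∧
    ∀ τ : ℝ, 0 ≤ τ → ‖relax α τ - 1‖ ≤ C * (τ + τ ^ α) := by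
  obtain ⟨C, hC, hderiv⟩ := exists_norm_relaxDeriv_le hα hα1
  refine ⟨C / α, by positivity, fun τ hτ => ?_⟩
  have hrpow : IntervalIntegrable (fun σ : ℝ => σ ^ (α - 1)) volume 0 τ :=
    intervalIntegral.intervalIntegrable_rpow' (by linarith)
  have hbound : IntervalIntegrable (fun σ : ℝ => C * (1 + σ ^ (α - 1))) volume 0 τ :=
    (intervalIntegrable_const.add hrpow).const_mul C
  have hfi : IntervalIntegrable (relaxDeriv α) volume 0 τ := by
    refine hbound.mono_fun ?_ ?_ <;> rw [uIoc_of_le hτ]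
    · exact ((continuousOn_relaxDeriv hα hα1).mono Ioc_subset_Ioi_self).aestronglyMeasurable
        measurableSet_Ioc
    · filter_upwards [ae_restrict_mem measurableSet_Ioc] with σ hσ
      exact (hderiv σ hσ.1).trans (le_abs_self _)
  have hftc : ∫ σ in (0 : ℝ)..τ, relaxDeriv α σ = relax α τ - 1 := by
    rw [← relax_zero hα hα1]
    exact intervalIntegral.integral_eq_sub_of_hasDerivAt_of_le hτ
      ((continuousOn_relax hα hα1).mono Icc_subset_Ici_self)
      (fun σ hσ => hasDerivAt_relax hα hα1 hσ.1) hfi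
  have hτα : τ ≤ τ / α := le_div_self hτ hα hα1
  calc ‖relax α τ - 1‖ = ‖∫ σ in (0 : ℝ)..τ, relaxDeriv α σ‖ := by rw [hftc]
    _ ≤ ∫ σ in (0 : ℝ)..τ, C * (1 + σ ^ (α - 1)) :=
        intervalIntegral.norm_integral_le_of_norm_le hτ
          (ae_of_all _ fun σ hσ => hderiv σ hσ.1) hbound
    _ = C * (τ + τ ^ α / α) := by
        rw [intervalIntegral.integral_const_mul,
          intervalIntegral.integral_add intervalIntegrable_const hrpow,
          integral_rpow (Or.inl (by linarith))]
        simp [Real.zero_rpow hα.ne']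
    _ ≤ C * (τ / α + τ ^ α / α) := by gcongr
    _ = C / α * (τ + τ ^ α) := by ring

lemma exists_mul_norm_relaxRem_le (hα : 0 < α) (hα1 : α ≤ 1) : ∃ C : ℝ, 0 < C ∧
    ∀ τ : ℝ, 0 ≤ τ → τ * ‖relaxRem α τ‖ ≤ C ∧ τ * ‖relaxRem α τ‖ ≤ C * τ ^ α := by
  obtain ⟨C, hC, hrem⟩ := exists_norm_relaxRem_le hα hα1
  refine ⟨C, hC, fun τ hτ => ?_⟩
  rcases hτ.eq_or_lt with rfl | hpos
  · simp only [zero_mul]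
    exact ⟨hC.le, by positivity⟩
  obtain ⟨hinv, hpow⟩ := hrem τ hpos
  constructor
  · calc τ * ‖relaxRem α τ‖ ≤ τ * (C * τ⁻¹) := by gcongr
      _ = C := by field_simp
  · calc τ * ‖relaxRem α τ‖ ≤ τ * (C * τ ^ (α - 1)) := by gcongr
      _ = C * τ ^ α := by
          rw [Real.rpow_sub_one hpos.ne']
          field_simp

/-- The gradient of `freq α` at `ξ` is `freqSlope α ξ • ξ`. -/
def freqSlope (α : ℝ) (ξ : Space d) : ℝ :=
  2 / α * (2 * π) ^ (2 / α) * ‖ξ‖ ^ (2 / α - 2)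

lemma freqSlope_nonneg (hα : 0 < α) (ξ : Space d) : 0 ≤ freqSlope α ξ := by
  unfold freqSlope
  positivity

lemma measurable_freqSlope (α : ℝ) : Measurable (freqSlope α : Space d → ℝ) := by
  unfold freqSlope
  fun_prop

lemma freq_eq (α : ℝ) (ξ : Space d) : freq α ξ = (2 * π) ^ (2 / α) * ‖ξ‖ ^ (2 / α) := by
  rw [freq, symbol, ← Real.rpow_natCast, ← Real.rpow_mul (by positivity),
    ← Real.mul_rpow (by positivity) (norm_nonneg _)]
  congr 1
  push_cast
  ring

lemma freqSlope_mul_norm_sq (hα : 0 < α) (ξ : Space d) :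
    freqSlope α ξ * ‖ξ‖ ^ 2 = 2 / α * freq α ξ := by
  rcases eq_or_ne ξ 0 with rfl | hξ
  · simp [freq_eq, Real.zero_rpow (div_pos two_pos hα).ne']
  rw [freqSlope, freq_eq, mul_assoc _ _ (‖ξ‖ ^ 2), ← Real.rpow_natCast,
    ← Real.rpow_add (norm_pos_iff.2 hξ), Nat.cast_ofNat, sub_add_cancel]
  ring

lemma exists_freqSlope_le (hα : 0 < α) (hα1 : α ≤ 1) : ∃ C : ℝ, 0 < C ∧
    ∀ ξ : Space d, freqSlope α ξ ≤ C * weight (1 / α) ξ ∧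
      freqSlope α ξ * ‖ξ‖ ≤ C * weight (1 / α) ξ := by
  have htwo : 2 ≤ 2 / α := le_div_self two_pos.le hα hα1
  have hdouble : 2 * (1 / α) = 2 / α := by ring
  refine ⟨2 / α * (2 * π) ^ (2 / α), by positivity, fun ξ => ⟨?_, ?_⟩⟩
  · rw [freqSlope]
    gcongr
    exact norm_rpow_le_weight (by linarith) (by linarith) ξ
  · have hnorm : ‖ξ‖ ^ (2 / α - 2) * ‖ξ‖ = ‖ξ‖ ^ (2 / α - 2 + 1) :=
      (Real.rpow_add_one' (norm_nonneg _) (by linarith)).symm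
    rw [freqSlope, mul_assoc, hnorm]
    gcongr
    exact norm_rpow_le_weight (by linarith) (by linarith) ξ

lemma hasFDerivAt_freq (hα : 0 < α) (hα1 : α ≤ 1) (ξ : Space d) :
    HasFDerivAt (freq α) (freqSlope α ξ • innerSL ℝ ξ) ξ := by
  have hexp : 1 < 2 / α := by
    rw [lt_div_iff₀ hα]
    linarith
  rw [funext (freq_eq (d := d) α)]
  refine ((hasFDerivAt_norm_rpow ξ hexp).const_mul ((2 * π) ^ (2 / α))).congr_fderiv ?_
  rw [smul_smul, freqSlope]
  congr 1
  ring

/-- The oscillating part of the gradient of `propagator α t`, up to the factor `ξ`. -/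
def oscGrad (α t : ℝ) (ξ : Space d) : ℂ :=
  (t * freqSlope α ξ : ℝ) * (-(I / α) * Complex.exp (-((freq α ξ * t : ℝ) * I)))

/-- The decaying part of the gradient of `propagator α t`, up to the factor `ξ`. -/
def remGrad (α t : ℝ) (ξ : Space d) : ℂ :=
  -((t * freqSlope α ξ : ℝ) * relaxRem α (freq α ξ * t))

lemma oscGrad_add_remGrad (α t : ℝ) (ξ : Space d) :
    oscGrad α t ξ + remGrad α t ξ = (t * freqSlope α ξ : ℝ) * relaxDeriv α (freq α ξ * t) := by
  rw [oscGrad, remGrad, relaxDeriv]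
  ring

lemma norm_oscGrad (hα : 0 < α) (ht : 0 ≤ t) (ξ : Space d) :
    ‖oscGrad α t ξ‖ = t * freqSlope α ξ / α := by
  rw [oscGrad, norm_mul, norm_mul, norm_exp_neg_mul_I, Complex.norm_real,
    Real.norm_of_nonneg (mul_nonneg ht (freqSlope_nonneg hα ξ)), norm_neg, norm_div,
    Complex.norm_I, Complex.norm_real, Real.norm_of_nonneg hα.le]
  ring

lemma norm_remGrad_mul_norm_sq (hα : 0 < α) (ht : 0 ≤ t) (ξ : Space d) :
    ‖remGrad α t ξ‖ * ‖ξ‖ ^ 2 = 2 / α * (freq α ξ * t * ‖relaxRem α (freq α ξ * t)‖) := by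
  rw [remGrad, norm_neg, norm_mul, Complex.norm_real,
    Real.norm_of_nonneg (mul_nonneg ht (freqSlope_nonneg hα ξ))]
  linear_combination t * ‖relaxRem α (freq α ξ * t)‖ * freqSlope_mul_norm_sq hα ξ

lemma exists_norm_remGrad_le (hα : 0 < α) (hα1 : α ≤ 1) : ∃ C : ℝ, 0 < C ∧
    ∀ (t : ℝ) (ξ : Space d), 0 ≤ t →
      ‖remGrad α t ξ‖ * ‖ξ‖ ^ 2 ≤ C ∧ ‖remGrad α t ξ‖ * ‖ξ‖ ≤ C * t ^ α * ‖ξ‖ := by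
  obtain ⟨C, hC, hrem⟩ := exists_mul_norm_relaxRem_le hα hα1
  have hone : (1 : ℝ) ≤ (2 * π) ^ 2 := by nlinarith [Real.pi_gt_three]
  refine ⟨2 / α * C * (2 * π) ^ 2, by positivity, fun t ξ ht => ?_⟩
  obtain ⟨hbdd, hpow⟩ := hrem (freq α ξ * t) (mul_nonneg (freq_nonneg α ξ) ht)
  have hsq := norm_remGrad_mul_norm_sq hα ht ξ
  constructor
  · calc ‖remGrad α t ξ‖ * ‖ξ‖ ^ 2 ≤ 2 / α * C * 1 := by
          rw [hsq, mul_one]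
          gcongr
      _ ≤ 2 / α * C * (2 * π) ^ 2 := by gcongr
  · rcases eq_or_ne ξ 0 with rfl | hξ
    · simp
    refine le_of_mul_le_mul_right ?_ (norm_pos_iff.2 hξ)
    calc ‖remGrad α t ξ‖ * ‖ξ‖ * ‖ξ‖
        = 2 / α * (freq α ξ * t * ‖relaxRem α (freq α ξ * t)‖) := by
          rw [← hsq]
          ring
      _ ≤ 2 / α * (C * (freq α ξ * t) ^ α) := by gcongr
      _ = 2 / α * C * (2 * π) ^ 2 * t ^ α * ‖ξ‖ * ‖ξ‖ := by
          rw [Real.mul_rpow (freq_nonneg α ξ) ht, freq_rpow hα, symbol]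
          ring

lemma exists_norm_propagator_sub_one_le (hα : 0 < α) (hα1 : α ≤ 1) (ht : 0 ≤ t) : ∃ C : ℝ,
    ∀ ξ : Space d, ‖ξ‖ ≤ 1 → ‖propagator α t ξ - 1‖ ≤ C * ‖ξ‖ ^ 2 := by
  obtain ⟨C, hC, hrelax⟩ := exists_norm_relax_sub_one_le hα hα1
  refine ⟨C * ((2 * π) ^ (2 / α) * t + (2 * π) ^ 2 * t ^ α), fun ξ hξ => ?_⟩
  have htwo : (2 : ℝ) ≤ 2 / α := le_div_self two_pos.le hα hα1
  have hpow : ‖ξ‖ ^ (2 / α) ≤ ‖ξ‖ ^ 2 := by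
    rw [← Real.rpow_natCast]
    exact Real.rpow_le_rpow_of_exponent_ge_of_imp (norm_nonneg _) hξ (by exact_mod_cast htwo)
      fun _ h => absurd h (by positivity)
  calc ‖propagator α t ξ - 1‖ ≤ C * (freq α ξ * t + (freq α ξ * t) ^ α) :=
        hrelax _ (mul_nonneg (freq_nonneg α ξ) ht)
    _ = C * ((2 * π) ^ (2 / α) * ‖ξ‖ ^ (2 / α) * t +
          (2 * π) ^ 2 * ‖ξ‖ ^ 2 * t ^ α) := by
        rw [Real.mul_rpow (freq_nonneg α ξ) ht, freq_rpow hα, freq_eq, symbol, mul_pow]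
    _ ≤ C * ((2 * π) ^ (2 / α) * ‖ξ‖ ^ 2 * t +
          (2 * π) ^ 2 * ‖ξ‖ ^ 2 * t ^ α) := by gcongr
    _ = C * ((2 * π) ^ (2 / α) * t + (2 * π) ^ 2 * t ^ α) * ‖ξ‖ ^ 2 := by ring

lemma hasFDerivAt_propagator_zero (hα : 0 < α) (hα1 : α ≤ 1) (ht : 0 ≤ t) :
    HasFDerivAt (propagator α t : Space d → ℂ) (0 : Space d →L[ℝ] ℂ) 0 := by
  obtain ⟨C, hC⟩ := exists_norm_propagator_sub_one_le (d := d) hα hα1 ht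
  have hbigO : (fun ξ : Space d => propagator α t ξ - 1) =O[𝓝 0] fun ξ => ‖ξ - 0‖ ^ 2 := by
    refine IsBigO.of_bound C ?_
    filter_upwards [Metric.ball_mem_nhds (0 : Space d) one_pos] with ξ hξ
    rw [sub_zero, norm_pow, norm_norm]
    exact hC ξ (mem_ball_zero_iff.1 hξ).le
  simpa only [sub_add_cancel] using (hbigO.hasFDerivAt (𝕜 := ℝ) one_lt_two).add_const 1

lemma hasLineDerivAt_propagator (hα : 0 < α) (hα1 : α ≤ 1) (ht : 0 < t) (ξ v : Space d) :
    HasLineDerivAt ℝ (propagator α t)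
      ((oscGrad α t ξ + remGrad α t ξ) * (inner ℝ ξ v : ℝ)) ξ v := by
  rcases eq_or_ne ξ 0 with rfl | hξ
  · simpa using (hasFDerivAt_propagator_zero hα hα1 ht.le).hasLineDerivAt v
  · have hfreq : 0 < freq α ξ := by
      have := norm_pos_iff.2 hξ
      rw [freq_eq]
      positivity
    have hcomp := (hasDerivAt_relax hα hα1 (mul_pos hfreq ht)).hasFDerivAt.comp ξ
      ((hasFDerivAt_freq hα hα1 ξ).mul_const t)
    refine (hcomp.hasLineDerivAt v).congr_deriv ?_
    rw [oscGrad_add_remGrad]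
    simp
    ring

end PropagatorGradient

section SolutionGradient

open scoped LineDeriv

variable {d : ℕ} {α t : ℝ} {v : Space d}

/-- The oscillating part of the derivative of `fourierSolution α f t` in the direction `v`. -/
def oscTerm (α : ℝ) (f : 𝓢(Space d, ℂ)) (v : Space d) (t : ℝ) (ξ : Space d) : ℂ :=
  oscGrad α t ξ * (inner ℝ ξ v : ℝ) * f ξ

/-- The remaining part of the derivative of `fourierSolution α f t` in the direction `v`. -/
def remTerm (α : ℝ) (f : 𝓢(Space d, ℂ)) (v : Space d) (t : ℝ) (ξ : Space d) : ℂ :=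
  remGrad α t ξ * (inner ℝ ξ v : ℝ) * f ξ + propagator α t ξ * (∂_{v} f) ξ

/-- The derivative of `fourierSolution α f t` in the direction `v`. -/
def gradTerm (α : ℝ) (f : 𝓢(Space d, ℂ)) (v : Space d) (t : ℝ) (ξ : Space d) : ℂ :=
  oscTerm α f v t ξ + remTerm α f v t ξ

lemma measurable_oscTerm (hα : 0 < α) (f : 𝓢(Space d, ℂ)) (v : Space d) (t : ℝ) :
    Measurable (oscTerm α f v t) := by
  have := (continuous_freq (d := d) hα).measurable
  have := measurable_freqSlope (d := d) α
  have := f.continuous.measurable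
  unfold oscTerm oscGrad
  fun_prop

lemma measurable_remTerm (hα : 0 < α) (f : 𝓢(Space d, ℂ)) (v : Space d) (t : ℝ) :
    Measurable (remTerm α f v t) := by
  have := (continuous_freq (d := d) hα).measurable
  have := measurable_freqSlope (d := d) α
  have := f.continuous.measurable
  have := (∂_{v} f).continuous.measurable
  have : Measurable fun ξ : Space d => relaxRem α (freq α ξ * t) :=
    (measurable_relaxRem α).comp (by fun_prop)
  have : Measurable (propagator α t : Space d → ℂ) := (measurable_propagator hα).of_uncurry_left
  unfold remTerm remGrad
  fun_prop

lemma hasLineDerivAt_fourierSolution (hα : 0 < α) (hα1 : α ≤ 1) (f : 𝓢(Space d, ℂ)) (ht : 0 < t)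
    (ξ v : Space d) : HasLineDerivAt ℝ (fourierSolution α f t) (gradTerm α f v t ξ) ξ v := by
  have hf : HasLineDerivAt ℝ f ((∂_{v} f) ξ) ξ v := by
    rw [SchwartzMap.lineDerivOp_apply_eq_fderiv]
    exact f.differentiableAt.hasFDerivAt.hasLineDerivAt v
  have hmul := HasDerivAt.mul (hasLineDerivAt_propagator hα hα1 ht ξ v) hf
  simp only [zero_smul, add_zero] at hmul
  refine hmul.congr_deriv ?_
  rw [gradTerm, oscTerm, remTerm]
  ring

lemma norm_ofReal_inner_le (ξ : Space d) (hv : ‖v‖ ≤ 1) : ‖((inner ℝ ξ v : ℝ) : ℂ)‖ ≤ ‖ξ‖ := by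
  rw [Complex.norm_real]
  exact (norm_inner_le_norm ξ v).trans (mul_le_of_le_one_right (norm_nonneg _) hv)

lemma norm_oscTerm_le (hα : 0 < α) (f : 𝓢(Space d, ℂ)) (ht : 0 ≤ t) (ξ : Space d) (hv : ‖v‖ ≤ 1) :
    ‖oscTerm α f v t ξ‖ ≤ t / α * (freqSlope α ξ * ‖ξ‖) * ‖f ξ‖ := by
  have := freqSlope_nonneg hα ξ
  calc ‖oscTerm α f v t ξ‖
      = t * freqSlope α ξ / α * ‖((inner ℝ ξ v : ℝ) : ℂ)‖ * ‖f ξ‖ := by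
        rw [oscTerm, norm_mul, norm_mul, norm_oscGrad hα ht]
    _ ≤ t * freqSlope α ξ / α * ‖ξ‖ * ‖f ξ‖ := by
        gcongr
        exact norm_ofReal_inner_le ξ hv
    _ = t / α * (freqSlope α ξ * ‖ξ‖) * ‖f ξ‖ := by ring

lemma exists_norm_remTerm_le (hα : 0 < α) (hα1 : α ≤ 1) : ∃ C : ℝ, 0 < C ∧
    ∀ (f : 𝓢(Space d, ℂ)) (t : ℝ) (ξ v : Space d), 0 ≤ t → ‖v‖ ≤ 1 →
      ‖remTerm α f v t ξ‖ ≤ ‖remGrad α t ξ‖ * ‖ξ‖ * ‖f ξ‖ + C * ‖(∂_{v} f) ξ‖ := by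
  obtain ⟨C, hC, hrelax⟩ := exists_norm_relax_le hα hα1
  refine ⟨C, hC, fun f t ξ v ht hv => (norm_add_le _ _).trans ?_⟩
  rw [norm_mul, norm_mul, norm_mul]
  gcongr
  · exact norm_ofReal_inner_le ξ hv
  · exact hrelax _ (mul_nonneg (freq_nonneg α ξ) ht)

lemma memLp_oscTerm (hα : 0 < α) (hα1 : α ≤ 1) (f : 𝓢(Space d, ℂ)) (hv : ‖v‖ ≤ 1) (ht : 0 ≤ t) :
    MemLp (oscTerm α f v t) 2 volume := by
  obtain ⟨C, -, hslope⟩ := exists_freqSlope_le (d := d) hα hα1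
  refine memLp_of_norm_le_mul (b := t / α * C) (memLp_weight_mul f (1 / α) 2)
    (measurable_oscTerm hα f v t).aestronglyMeasurable
    fun ξ => (norm_oscTerm_le hα f ht ξ hv).trans ?_
  have := (hslope ξ).2
  rw [mul_assoc (t / α), mul_assoc (t / α), ← mul_assoc C]
  gcongr

lemma memLp_remTerm (hα : 0 < α) (hα1 : α ≤ 1) (f : 𝓢(Space d, ℂ)) (hv : ‖v‖ ≤ 1) (ht : 0 ≤ t) :
    MemLp (remTerm α f v t) 2 volume := by
  obtain ⟨C, hC, hrem⟩ := exists_norm_remTerm_le (d := d) hα hα1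
  obtain ⟨D, hD, hgrad⟩ := exists_norm_remGrad_le (d := d) hα hα1
  have h1α : 1 ≤ 1 / α := (one_le_div hα).2 hα1
  have : 0 ≤ t ^ α := Real.rpow_nonneg ht α
  have hbound (ξ : Space d) : ‖remTerm α f v t ξ‖ ≤
      (D * t ^ α + C) * (weight (1 / α) ξ * ‖f ξ‖ + weight (1 / α) ξ * ‖(∂_{v} f) ξ‖) := by
    have hnorm : ‖ξ‖ ≤ weight (1 / α) ξ := by
      simpa using norm_rpow_le_weight zero_le_one (by linarith : 1 ≤ 2 * (1 / α)) ξ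
    have hweight : 1 ≤ weight (1 / α) ξ := one_le_weight (by positivity) ξ
    have hremGrad : ‖remGrad α t ξ‖ * ‖ξ‖ ≤ D * t ^ α * weight (1 / α) ξ :=
      (hgrad t ξ ht).2.trans (by gcongr)
    have hremGrad_le : ‖remGrad α t ξ‖ * ‖ξ‖ ≤ (D * t ^ α + C) * weight (1 / α) ξ :=
      hremGrad.trans (mul_le_mul_of_nonneg_right (le_add_of_nonneg_right hC.le) (by positivity))
    have hC_le : C ≤ (D * t ^ α + C) * weight (1 / α) ξ :=
      (le_add_of_nonneg_left (by positivity)).trans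
        (le_mul_of_one_le_right (by positivity) hweight)
    refine (hrem f t ξ v ht hv).trans ?_
    rw [mul_add, ← mul_assoc, ← mul_assoc]
    exact add_le_add (mul_le_mul_of_nonneg_right hremGrad_le (norm_nonneg _))
      (mul_le_mul_of_nonneg_right hC_le (norm_nonneg _))
  exact memLp_of_norm_le_mul
    ((memLp_weight_mul f (1 / α) 2).add (memLp_weight_mul (∂_{v} f) (1 / α) 2))
    (measurable_remTerm hα f v t).aestronglyMeasurable hbound

lemma memLp_gradTerm (hα : 0 < α) (hα1 : α ≤ 1) (f : 𝓢(Space d, ℂ)) (hv : ‖v‖ ≤ 1) (ht : 0 ≤ t) :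
    MemLp (gradTerm α f v t) 2 volume :=
  (memLp_oscTerm hα hα1 f hv ht).add (memLp_remTerm hα hα1 f hv ht)

lemma abs_norm_add_sq_sub_le {E : Type*} [SeminormedAddCommGroup E] (x y : E) :
    |‖x + y‖ ^ 2 - ‖x‖ ^ 2| ≤ 2 * (‖x‖ * ‖y‖) + ‖y‖ ^ 2 := by
  have hsub : |‖x + y‖ - ‖x‖| ≤ ‖y‖ := by simpa using abs_norm_sub_norm_le (x + y) x
  calc |‖x + y‖ ^ 2 - ‖x‖ ^ 2| = (‖x + y‖ + ‖x‖) * |‖x + y‖ - ‖x‖| := by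
        rw [sq_sub_sq, abs_mul, abs_of_nonneg (by positivity : 0 ≤ ‖x + y‖ + ‖x‖)]
    _ ≤ (‖x‖ + ‖y‖ + ‖x‖) * ‖y‖ := by
        gcongr
        exact norm_add_le x y
    _ = 2 * (‖x‖ * ‖y‖) + ‖y‖ ^ 2 := by ring

/-- Up to a constant, the density of the error which the replacement of `gradTerm` by `oscTerm`
causes in the mean-square displacement. -/
def errorDensity (α : ℝ) (f : 𝓢(Space d, ℂ)) (v ξ : Space d) : ℝ :=
  (weight (1 / α) ξ * ‖f ξ‖) ^ 2 + (weight (1 / α) ξ * ‖(∂_{v} f) ξ‖) ^ 2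

lemma integrable_errorDensity (α : ℝ) (f : 𝓢(Space d, ℂ)) (v : Space d) :
    Integrable (errorDensity α f v) :=
  (memLp_weight_mul f (1 / α) 2).integrable_sq.add
    (memLp_weight_mul (∂_{v} f) (1 / α) 2).integrable_sq

lemma weight_mul_le_errorDensity (hα : 0 < α) (f : 𝓢(Space d, ℂ)) (v ξ : Space d) :
    weight (1 / α) ξ * (‖f ξ‖ ^ 2 + ‖(∂_{v} f) ξ‖ ^ 2) ≤ errorDensity α f v ξ := by
  have hweight : weight (1 / α) ξ ≤ weight (1 / α) ξ ^ 2 :=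
    le_self_pow₀ (one_le_weight (by positivity) ξ) two_ne_zero
  rw [errorDensity, mul_pow, mul_pow, ← mul_add]
  gcongr

lemma norm_sq_add_norm_sq_le_errorDensity (hα : 0 < α) (f : 𝓢(Space d, ℂ)) (v ξ : Space d) :
    ‖f ξ‖ ^ 2 + ‖(∂_{v} f) ξ‖ ^ 2 ≤ errorDensity α f v ξ :=
  (le_mul_of_one_le_left (by positivity) (one_le_weight (by positivity) ξ)).trans
    (weight_mul_le_errorDensity hα f v ξ)

lemma exists_norm_oscTerm_mul_norm_remTerm_le (hα : 0 < α) (hα1 : α ≤ 1) : ∃ K : ℝ, 0 < K ∧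
    ∀ (f : 𝓢(Space d, ℂ)) (t : ℝ) (ξ v : Space d), 0 ≤ t → ‖v‖ ≤ 1 →
      ‖oscTerm α f v t ξ‖ * ‖remTerm α f v t ξ‖ ≤ K * t * errorDensity α f v ξ := by
  obtain ⟨M, hM, hrem⟩ := exists_norm_remTerm_le (d := d) hα hα1
  obtain ⟨C, hC, hgrad⟩ := exists_norm_remGrad_le (d := d) hα hα1
  obtain ⟨B, hB, hslope⟩ := exists_freqSlope_le (d := d) hα hα1
  refine ⟨1 / α * B * (C + M), by positivity, fun f t ξ v ht hv => ?_⟩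
  obtain ⟨hslope, hslope_mul⟩ := hslope ξ
  have := freqSlope_nonneg hα ξ
  have : 1 ≤ weight (1 / α) ξ := one_le_weight (by positivity) ξ
  have hsq : ‖f ξ‖ ^ 2 ≤ ‖f ξ‖ ^ 2 + ‖(∂_{v} f) ξ‖ ^ 2 := le_add_of_nonneg_right (sq_nonneg _)
  have hmul : ‖f ξ‖ * ‖(∂_{v} f) ξ‖ ≤ ‖f ξ‖ ^ 2 + ‖(∂_{v} f) ξ‖ ^ 2 := by
    nlinarith [sq_nonneg (‖f ξ‖ - ‖(∂_{v} f) ξ‖)]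
  calc ‖oscTerm α f v t ξ‖ * ‖remTerm α f v t ξ‖
      ≤ t / α * (freqSlope α ξ * ‖ξ‖) * ‖f ξ‖ *
          (‖remGrad α t ξ‖ * ‖ξ‖ * ‖f ξ‖ + M * ‖(∂_{v} f) ξ‖) := by
        gcongr
        · exact norm_oscTerm_le hα f ht ξ hv
        · exact hrem f t ξ v ht hv
    _ = t / α * (freqSlope α ξ * (‖remGrad α t ξ‖ * ‖ξ‖ ^ 2) * ‖f ξ‖ ^ 2 +
          freqSlope α ξ * ‖ξ‖ * M * (‖f ξ‖ * ‖(∂_{v} f) ξ‖)) := by ring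
    _ ≤ t / α * (B * weight (1 / α) ξ * C * (‖f ξ‖ ^ 2 + ‖(∂_{v} f) ξ‖ ^ 2) +
          B * weight (1 / α) ξ * M * (‖f ξ‖ ^ 2 + ‖(∂_{v} f) ξ‖ ^ 2)) := by
        gcongr
        exact (hgrad t ξ ht).1
    _ = 1 / α * B * (C + M) * t *
          (weight (1 / α) ξ * (‖f ξ‖ ^ 2 + ‖(∂_{v} f) ξ‖ ^ 2)) := by ring
    _ ≤ 1 / α * B * (C + M) * t * errorDensity α f v ξ := by
        gcongr
        exact weight_mul_le_errorDensity hα f v ξ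

lemma exists_norm_remGrad_mul_norm_sq_le (hα : 0 < α) (hα1 : α ≤ 1) : ∃ C : ℝ, 0 < C ∧
    ∀ (t : ℝ) (ξ : Space d), 1 ≤ t → (‖remGrad α t ξ‖ * ‖ξ‖) ^ 2 ≤ C ^ 2 * t := by
  obtain ⟨C, hC, hgrad⟩ := exists_norm_remGrad_le (d := d) hα hα1
  refine ⟨C, hC, fun t ξ ht => ?_⟩
  obtain ⟨hbdd, hpow⟩ := hgrad t ξ (zero_le_one.trans ht)
  calc (‖remGrad α t ξ‖ * ‖ξ‖) ^ 2 = ‖remGrad α t ξ‖ * ‖ξ‖ * (‖remGrad α t ξ‖ * ‖ξ‖) := sq _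
    _ ≤ C * t ^ α * ‖ξ‖ * (‖remGrad α t ξ‖ * ‖ξ‖) := mul_le_mul_of_nonneg_right hpow (by positivity)
    _ = C * t ^ α * (‖remGrad α t ξ‖ * ‖ξ‖ ^ 2) := by ring
    _ ≤ C * t * C := by
        have : t ^ α ≤ t := Real.rpow_le_self_of_one_le ht hα1
        gcongr
    _ = C ^ 2 * t := by ring

lemma exists_norm_remTerm_sq_le (hα : 0 < α) (hα1 : α ≤ 1) : ∃ K : ℝ, 0 < K ∧
    ∀ (f : 𝓢(Space d, ℂ)) (t : ℝ) (ξ v : Space d), 1 ≤ t → ‖v‖ ≤ 1 →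
      ‖remTerm α f v t ξ‖ ^ 2 ≤ K * t * errorDensity α f v ξ := by
  obtain ⟨M, hM, hrem⟩ := exists_norm_remTerm_le (d := d) hα hα1
  obtain ⟨C, hC, hgrad⟩ := exists_norm_remGrad_mul_norm_sq_le (d := d) hα hα1
  refine ⟨2 * (C ^ 2 + M ^ 2), by positivity, fun f t ξ v ht hv => ?_⟩
  have hgrad := hgrad t ξ ht
  have hsq : M ^ 2 ≤ M ^ 2 * t := le_mul_of_one_le_right (sq_nonneg M) ht
  calc ‖remTerm α f v t ξ‖ ^ 2
      ≤ (‖remGrad α t ξ‖ * ‖ξ‖ * ‖f ξ‖ + M * ‖(∂_{v} f) ξ‖) ^ 2 :=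
        pow_le_pow_left₀ (norm_nonneg _) (hrem f t ξ v (zero_le_one.trans ht) hv) 2
    _ ≤ 2 * ((‖remGrad α t ξ‖ * ‖ξ‖ * ‖f ξ‖) ^ 2 + (M * ‖(∂_{v} f) ξ‖) ^ 2) := by
        linarith [sq_nonneg (‖remGrad α t ξ‖ * ‖ξ‖ * ‖f ξ‖ - M * ‖(∂_{v} f) ξ‖)]
    _ = 2 * ((‖remGrad α t ξ‖ * ‖ξ‖) ^ 2 * ‖f ξ‖ ^ 2 + M ^ 2 * ‖(∂_{v} f) ξ‖ ^ 2) := by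
        rw [mul_pow, mul_pow M]
    _ ≤ 2 * (C ^ 2 * t * ‖f ξ‖ ^ 2 + M ^ 2 * t * ‖(∂_{v} f) ξ‖ ^ 2) := by gcongr
    _ ≤ 2 * ((C ^ 2 + M ^ 2) * t * ‖f ξ‖ ^ 2 + (C ^ 2 + M ^ 2) * t * ‖(∂_{v} f) ξ‖ ^ 2) := by
        gcongr
        · exact le_add_of_nonneg_right (sq_nonneg M)
        · exact le_add_of_nonneg_left (sq_nonneg C)
    _ = 2 * (C ^ 2 + M ^ 2) * t * (‖f ξ‖ ^ 2 + ‖(∂_{v} f) ξ‖ ^ 2) := by ring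
    _ ≤ 2 * (C ^ 2 + M ^ 2) * t * errorDensity α f v ξ :=
        mul_le_mul_of_nonneg_left (norm_sq_add_norm_sq_le_errorDensity hα f v ξ) (by positivity)

lemma exists_abs_norm_gradTerm_sq_sub_le (hα : 0 < α) (hα1 : α ≤ 1) : ∃ K : ℝ, 0 < K ∧
    ∀ (f : 𝓢(Space d, ℂ)) (t : ℝ) (ξ v : Space d), 1 ≤ t → ‖v‖ ≤ 1 →
      |‖gradTerm α f v t ξ‖ ^ 2 - ‖oscTerm α f v t ξ‖ ^ 2| ≤ K * t * errorDensity α f v ξ := by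
  obtain ⟨K, hK, hcross⟩ := exists_norm_oscTerm_mul_norm_remTerm_le (d := d) hα hα1
  obtain ⟨L, hL, hrem⟩ := exists_norm_remTerm_sq_le (d := d) hα hα1
  refine ⟨2 * K + L, by positivity, fun f t ξ v ht hv => ?_⟩
  calc |‖gradTerm α f v t ξ‖ ^ 2 - ‖oscTerm α f v t ξ‖ ^ 2|
      ≤ 2 * (‖oscTerm α f v t ξ‖ * ‖remTerm α f v t ξ‖) + ‖remTerm α f v t ξ‖ ^ 2 :=
        abs_norm_add_sq_sub_le _ _
    _ ≤ 2 * (K * t * errorDensity α f v ξ) + L * t * errorDensity α f v ξ :=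
        add_le_add (mul_le_mul_of_nonneg_left (hcross f t ξ v (zero_le_one.trans ht) hv)
          zero_le_two) (hrem f t ξ v ht hv)
    _ = (2 * K + L) * t * errorDensity α f v ξ := by ring

end SolutionGradient

section MeanSquareDisplacement

open scoped FourierTransform LineDeriv

variable {d : ℕ} {α t : ℝ}

lemma lineDeriv_toL2 {g g' : Space d → ℂ} {v : Space d} (hg : MemLp g 2 volume)
    (hg' : MemLp g' 2 volume) (h : ∀ ξ, HasLineDerivAt ℝ g (g' ξ) ξ v) :
    ∂_{v} (Lp.toTemperedDistribution (toL2 g volume)) =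
      Lp.toTemperedDistribution (toL2 g' volume) := by
  ext φ
  have hφ (ξ : Space d) : HasLineDerivAt ℝ φ ((∂_{v} φ) ξ) ξ v := by
    rw [SchwartzMap.lineDerivOp_apply_eq_fderiv]
    exact φ.differentiableAt.hasFDerivAt.hasLineDerivAt v
  have hparts : ∫ x, φ x * g' x = -∫ x, (∂_{v} φ) x * g x :=
    integral_bilinear_hasLineDerivAt_right_eq_neg_left_of_integrable
      (B := ContinuousLinearMap.mul ℝ ℂ) (((∂_{v} φ).memLp 2 volume).integrable_mul hg)
      ((φ.memLp 2 volume).integrable_mul hg') ((φ.memLp 2 volume).integrable_mul hg)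
      (fun ξ _ => hφ ξ) fun ξ _ => h ξ
  rw [TemperedDistribution.lineDerivOp_apply_apply, Lp.toTemperedDistribution_apply,
    Lp.toTemperedDistribution_apply]
  calc ∫ x, (-∂_{v} φ) x • toL2 g volume x = ∫ x, -((∂_{v} φ) x * g x) :=
        integral_congr_ae (by
          filter_upwards [coeFn_toL2 hg] with x hx
          rw [hx, smul_eq_mul, neg_apply, neg_mul])
    _ = ∫ x, φ x * g' x := by rw [integral_neg, hparts]
    _ = ∫ x, φ x • toL2 g' volume x :=
        integral_congr_ae (by filter_upwards [coeFn_toL2 hg'] with x hx; rw [hx, smul_eq_mul])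

lemma sum_norm_inner_single_sq (x : Space d) (c z : ℂ) :
    ∑ j, ‖c * ((inner ℝ x (EuclideanSpace.single j (1 : ℝ)) : ℝ) : ℂ) * z‖ ^ 2 =
      ‖c‖ ^ 2 * (‖x‖ ^ 2 * ‖z‖ ^ 2) := by
  rw [EuclideanSpace.real_norm_sq_eq, Finset.sum_mul, Finset.mul_sum]
  refine Finset.sum_congr rfl fun j _ => ?_
  rw [EuclideanSpace.inner_single_right, one_mul, RCLike.conj_to_real, norm_mul, norm_mul,
    Complex.norm_real, mul_pow, mul_pow, Real.norm_eq_abs, sq_abs, mul_assoc]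

section

variable {f : L2 d} {F : Fin d → L2 d}

lemma norm_sq_mul_norm_sq_ae_eq
    (h : ∀ j, F j =ᵐ[volume] fun x =>
      (-(2 * π * I) * (inner ℝ x (EuclideanSpace.single j (1 : ℝ)) : ℝ)) * f x) :
    (fun x => ‖x‖ ^ 2 * ‖f x‖ ^ 2) =ᵐ[volume]
      fun x => ((2 * π) ^ 2)⁻¹ * ∑ j, ‖F j x‖ ^ 2 := by
  have hnorm : ‖-(2 * π * I)‖ = 2 * π := by simp [abs_of_pos Real.pi_pos]
  filter_upwards [eventually_all.2 h] with x hx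
  simp only [hx]
  rw [sum_norm_inner_single_sq, hnorm, inv_mul_cancel_left₀ (by positivity)]

lemma finiteMSD_of_ae_eq
    (h : ∀ j, F j =ᵐ[volume] fun x =>
      (-(2 * π * I) * (inner ℝ x (EuclideanSpace.single j (1 : ℝ)) : ℝ)) * f x) :
    FiniteMSD f :=
  ((integrable_finsetSum _ fun j _ => integrable_norm_sq (F j)).const_mul _).congr
    (norm_sq_mul_norm_sq_ae_eq h).symm

lemma msd_eq_sum_norm_sq
    (h : ∀ j, F j =ᵐ[volume] fun x =>
      (-(2 * π * I) * (inner ℝ x (EuclideanSpace.single j (1 : ℝ)) : ℝ)) * f x) :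
    msd f = ((2 * π) ^ 2)⁻¹ * ∑ j, ‖F j‖ ^ 2 := by
  rw [msd, integral_congr_ae (norm_sq_mul_norm_sq_ae_eq h), integral_const_mul,
    integral_finsetSum _ fun j _ => integrable_norm_sq (F j)]
  simp only [norm_sq_eq_integral]

end

lemma norm_single_one_le (j : Fin d) : ‖(EuclideanSpace.single j (1 : ℝ) : Space d)‖ ≤ 1 := by
  simp

lemma fourierInv_gradTerm_ae_eq (hα : 0 < α) (hα1 : α ≤ 1) (u₀ : 𝓢(Space d, ℂ)) (ht : 0 < t)
    (j : Fin d) :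
    (𝓕⁻ (toL2 (gradTerm α (𝓕 u₀) (EuclideanSpace.single j (1 : ℝ)) t) volume) : L2 d) =ᵐ[volume]
      fun x => (-(2 * π * I) * (inner ℝ x (EuclideanSpace.single j (1 : ℝ)) : ℝ)) *
        solution α u₀ t x :=
  fourierInv_lineDeriv_ae (lineDeriv_toL2 (memLp_fourierSolution hα hα1 (𝓕 u₀) ht.le)
    (memLp_gradTerm hα hα1 (𝓕 u₀) (norm_single_one_le j) ht.le)
    fun ξ => hasLineDerivAt_fourierSolution hα hα1 (𝓕 u₀) ht ξ _)

lemma finiteMSD_solution (hα : 0 < α) (hα1 : α ≤ 1) (u₀ : 𝓢(Space d, ℂ)) (ht : 0 < t) :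
    FiniteMSD (solution α u₀ t) :=
  finiteMSD_of_ae_eq (fourierInv_gradTerm_ae_eq hα hα1 u₀ ht)

lemma msd_solution (hα : 0 < α) (hα1 : α ≤ 1) (u₀ : 𝓢(Space d, ℂ)) (ht : 0 < t) :
    msd (solution α u₀ t) = ((2 * π) ^ 2)⁻¹ *
      ∑ j, ∫ ξ, ‖gradTerm α (𝓕 u₀) (EuclideanSpace.single j (1 : ℝ)) t ξ‖ ^ 2 := by
  rw [msd_eq_sum_norm_sq (fourierInv_gradTerm_ae_eq hα hα1 u₀ ht)]
  congr 1
  refine Finset.sum_congr rfl fun j _ => ?_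
  rw [← Lp.norm_fourier_eq, FourierTransform.fourier_fourierInv_eq, norm_sq_eq_integral]
  refine integral_congr_ae ?_
  filter_upwards [coeFn_toL2 (memLp_gradTerm hα hα1 (𝓕 u₀) (norm_single_one_le j) ht.le)] with ξ hξ
  rw [hξ]

lemma freqSlope_mul_norm (hα : 0 < α) (hα1 : α ≤ 1) (ξ : Space d) :
    freqSlope α ξ * ‖ξ‖ = 2 / α * (2 * π) * (2 * π * ‖ξ‖) ^ ((2 - α) / α) := by
  have hpos : 0 < (2 - α) / α := div_pos (by linarith) hα
  have hsub : 2 / α - 2 + 1 = (2 - α) / α := by field_simp; ring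
  have hadd : (2 - α) / α + 1 = 2 / α := by field_simp; ring
  rw [freqSlope, mul_assoc, ← Real.rpow_add_one' (norm_nonneg _) (by rw [hsub]; exact hpos.ne'),
    hsub, Real.mul_rpow (by positivity) (norm_nonneg _), ← hadd,
    Real.rpow_add_one (by positivity)]
  ring

/-- The density, on the Fourier side, of the coefficient of `t ^ 2` in the mean-square
displacement. -/
def ballisticDensity (α : ℝ) (f : 𝓢(Space d, ℂ)) (ξ : Space d) : ℝ :=
  4 / α ^ 4 * ((2 * π * ‖ξ‖) ^ ((2 - α) / α) * ‖f ξ‖) ^ 2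

lemma sum_norm_oscTerm_sq (hα : 0 < α) (hα1 : α ≤ 1) (f : 𝓢(Space d, ℂ)) (ht : 0 ≤ t)
    (ξ : Space d) :
    ((2 * π) ^ 2)⁻¹ * ∑ j, ‖oscTerm α f (EuclideanSpace.single j (1 : ℝ)) t ξ‖ ^ 2 =
      ballisticDensity α f ξ * t ^ 2 := by
  simp only [oscTerm, sum_norm_inner_single_sq, norm_oscGrad hα ht]
  calc ((2 * π) ^ 2)⁻¹ * ((t * freqSlope α ξ / α) ^ 2 * (‖ξ‖ ^ 2 * ‖f ξ‖ ^ 2))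
      = ((2 * π) ^ 2)⁻¹ * (t / α) ^ 2 * (freqSlope α ξ * ‖ξ‖) ^ 2 * ‖f ξ‖ ^ 2 := by ring
    _ = ballisticDensity α f ξ * t ^ 2 := by
        rw [freqSlope_mul_norm hα hα1, ballisticDensity]
        field_simp
        ring

lemma integral_ballisticDensity_mul_sq (hα : 0 < α) (hα1 : α ≤ 1) (f : 𝓢(Space d, ℂ))
    (ht : 0 ≤ t) :
    (∫ ξ, ballisticDensity α f ξ) * t ^ 2 =
      ((2 * π) ^ 2)⁻¹ *
        ∑ j, ∫ ξ, ‖oscTerm α f (EuclideanSpace.single j (1 : ℝ)) t ξ‖ ^ 2 := by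
  rw [← integral_finsetSum _ fun j _ =>
      (memLp_oscTerm hα hα1 f (norm_single_one_le j) ht).integrable_norm_pow two_ne_zero,
    ← integral_const_mul, ← integral_mul_const]
  simp only [sum_norm_oscTerm_sq hα hα1 f ht]

lemma exists_abs_msd_solution_sub_le (hα : 0 < α) (hα1 : α ≤ 1) (u₀ : 𝓢(Space d, ℂ)) :
    ∃ K : ℝ, ∀ t : ℝ, 1 ≤ t →
      |msd (solution α u₀ t) - (∫ ξ, ballisticDensity α (𝓕 u₀) ξ) * t ^ 2| ≤ K * t := by
  obtain ⟨K, -, hK⟩ := exists_abs_norm_gradTerm_sq_sub_le (d := d) hα hα1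
  set e : Fin d → Space d := fun j => EuclideanSpace.single j (1 : ℝ)
  have he (j : Fin d) : ‖e j‖ ≤ 1 := norm_single_one_le j
  refine ⟨((2 * π) ^ 2)⁻¹ * ∑ j, K * ∫ ξ, errorDensity α (𝓕 u₀) (e j) ξ, fun t ht => ?_⟩
  have ht0 : 0 < t := one_pos.trans_le ht
  have hbound (j : Fin d) :
      |(∫ ξ, ‖gradTerm α (𝓕 u₀) (e j) t ξ‖ ^ 2) - ∫ ξ, ‖oscTerm α (𝓕 u₀) (e j) t ξ‖ ^ 2| ≤
        K * (∫ ξ, errorDensity α (𝓕 u₀) (e j) ξ) * t := by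
    rw [← integral_sub
        ((memLp_gradTerm hα hα1 (𝓕 u₀) (he j) ht0.le).integrable_norm_pow two_ne_zero)
        ((memLp_oscTerm hα hα1 (𝓕 u₀) (he j) ht0.le).integrable_norm_pow two_ne_zero),
      ← Real.norm_eq_abs, mul_right_comm, ← integral_const_mul]
    exact norm_integral_le_of_norm_le ((integrable_errorDensity α (𝓕 u₀) (e j)).const_mul (K * t))
      (ae_of_all _ fun ξ => hK (𝓕 u₀) t ξ (e j) ht (he j))
  rw [integral_ballisticDensity_mul_sq hα hα1 _ ht0.le, msd_solution hα hα1 u₀ ht0, ← mul_sub,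
    ← Finset.sum_sub_distrib, abs_mul, abs_of_nonneg (by positivity), mul_assoc, Finset.sum_mul]
  gcongr
  exact (Finset.abs_sum_le_sum_abs _ _).trans (Finset.sum_le_sum fun j _ => hbound j)

end MeanSquareDisplacement

section BallisticCoefficient

open scoped FourierTransform

variable {d : ℕ} {α : ℝ}

lemma fourier_two_pi_smul (u₀ : 𝓢(Space d, ℂ)) (ξ : Space d) :
    fourier u₀ ((2 * π) • ξ) = (((2 * π) ^ (-(d : ℝ) / 2) : ℝ) : ℂ) * 𝓕 u₀ ξ := by
  rw [fourier, SchwartzMap.fourier_coe, Real.fourier_eq']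
  congr 2
  ext x
  rw [smul_eq_mul, inner_smul_right]
  congr 2
  push_cast
  ring

lemma norm_fourier_two_pi_smul_sq (u₀ : 𝓢(Space d, ℂ)) (ξ : Space d) :
    ‖fourier u₀ ((2 * π) • ξ)‖ ^ 2 = ((2 * π) ^ d)⁻¹ * ‖𝓕 u₀ ξ‖ ^ 2 := by
  have hpi : 0 < 2 * π := by positivity
  have hsq : ((2 * π) ^ (-(d : ℝ) / 2)) ^ 2 = ((2 * π) ^ d)⁻¹ := by
    rw [← Real.rpow_natCast, ← Real.rpow_mul hpi.le, ← Real.rpow_natCast, ← Real.rpow_neg hpi.le]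
    congr 1
    push_cast
    ring
  rw [fourier_two_pi_smul, norm_mul, Complex.norm_real,
    Real.norm_of_nonneg (Real.rpow_nonneg hpi.le _), mul_pow, hsq]

lemma ballisticCoeff_eq_integral (α : ℝ) (u₀ : 𝓢(Space d, ℂ)) :
    ballisticCoeff α u₀ = ∫ ξ, ballisticDensity α (𝓕 u₀) ξ := by
  have hpi : 0 < 2 * π := by positivity
  have hscale := Measure.integral_comp_smul (volume : Measure (Space d))
    (fun ξ => (‖ξ‖ ^ ((2 - α) / α) * ‖fourier u₀ ξ‖) ^ 2) (2 * π)
  have hcomp (ξ : Space d) :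
      (‖(2 * π) • ξ‖ ^ ((2 - α) / α) * ‖fourier u₀ ((2 * π) • ξ)‖) ^ 2 =
        ((2 * π) ^ d)⁻¹ * ((2 * π * ‖ξ‖) ^ ((2 - α) / α) * ‖𝓕 u₀ ξ‖) ^ 2 := by
    rw [mul_pow, norm_fourier_two_pi_smul_sq, norm_smul, Real.norm_of_nonneg hpi.le]
    ring
  simp only [hcomp] at hscale
  rw [integral_const_mul, finrank_euclideanSpace_fin, abs_of_pos (by positivity), smul_eq_mul]
    at hscale
  simp only [ballisticCoeff, ballisticDensity]
  rw [integral_const_mul, mul_left_cancel₀ (by positivity) hscale]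

lemma continuous_ballisticDensity (hα : 0 < α) (hα1 : α ≤ 1) (f : 𝓢(Space d, ℂ)) :
    Continuous (ballisticDensity α f) := by
  have hexp : 0 ≤ (2 - α) / α := div_nonneg (by linarith) hα.le
  have : Continuous fun ξ : Space d => (2 * π * ‖ξ‖) ^ ((2 - α) / α) :=
    (by fun_prop : Continuous fun ξ : Space d => 2 * π * ‖ξ‖).rpow_const fun _ => Or.inr hexp
  have := f.continuous
  unfold ballisticDensity
  fun_prop

lemma integrable_ballisticDensity (hα : 0 < α) (hα1 : α ≤ 1) (f : 𝓢(Space d, ℂ)) :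
    Integrable (ballisticDensity α f) := by
  have hsum := (integrable_finsetSum Finset.univ fun j _ =>
    (memLp_oscTerm hα hα1 f (norm_single_one_le j) zero_le_one).integrable_norm_pow
      two_ne_zero).const_mul ((2 * π) ^ 2)⁻¹
  refine hsum.congr (ae_of_all _ fun ξ => ?_)
  simpa using sum_norm_oscTerm_sq hα hα1 f zero_le_one ξ

lemma ballisticDensity_nonneg (α : ℝ) (f : 𝓢(Space d, ℂ)) (ξ : Space d) :
    0 ≤ ballisticDensity α f ξ := by
  unfold ballisticDensity
  positivity

lemma exists_ballisticDensity_ne_zero (hd : 1 ≤ d) (hα : α ≠ 0) {f : 𝓢(Space d, ℂ)} (hf : f ≠ 0) :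
    ∃ ξ, ballisticDensity α f ξ ≠ 0 := by
  have : Nonempty (Fin d) := ⟨⟨0, hd⟩⟩
  obtain ⟨ξ₀, hξ₀⟩ : ∃ ξ, f ξ ≠ 0 := by
    by_contra! h
    exact hf (SchwartzMap.ext h)
  obtain ⟨ξ, hfξ, hξ⟩ := (dense_compl_singleton (0 : Space d)).inter_open_nonempty _
    f.continuous.isOpen_support ⟨ξ₀, hξ₀⟩
  have : 0 < ‖ξ‖ := norm_pos_iff.2 hξ
  have : 0 < ‖f ξ‖ := norm_pos_iff.2 hfξ
  refine ⟨ξ, ne_of_gt ?_⟩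
  unfold ballisticDensity
  positivity

lemma fourier_ne_zero {u₀ : 𝓢(Space d, ℂ)} (hu₀ : u₀ ≠ 0) : (𝓕 u₀ : 𝓢(Space d, ℂ)) ≠ 0 := by
  contrapose! hu₀
  rw [← FourierTransform.fourierInv_fourier_eq (F := 𝓢(Space d, ℂ)) u₀, hu₀,
    FourierTransform.fourierInv_zero]

lemma ballisticCoeff_pos (hd : 1 ≤ d) (hα : 0 < α) (hα1 : α ≤ 1) {u₀ : 𝓢(Space d, ℂ)}
    (hu₀ : u₀ ≠ 0) : 0 < ballisticCoeff α u₀ := by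
  rw [ballisticCoeff_eq_integral, integral_pos_iff_support_of_nonneg
    (ballisticDensity_nonneg α (𝓕 u₀)) (integrable_ballisticDensity hα hα1 (𝓕 u₀))]
  exact (continuous_ballisticDensity hα hα1 (𝓕 u₀)).isOpen_support.measure_pos _
    (exists_ballisticDensity_ne_zero hd hα.ne' (fourier_ne_zero hu₀))

end BallisticCoefficient

end TFSE

end

theorem mainTheorem1 (d : ℕ) (hd : 1 ≤ d) (α β : ℝ) (hα : 0 < α) (hα1 : α ≤ 1) (hαβ : α = β)
    (u₀ : 𝓢(TFSE.Space d, ℂ)) :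
    ∃ u : ℝ → TFSE.L2 d,
      TFSE.IsSolution α β (u₀.toLp 2) u ∧
      (∀ u' : ℝ → TFSE.L2 d, TFSE.IsSolution α β (u₀.toLp 2) u' → EqOn u' u (Ioi 0)) ∧
      (∀ t : ℝ, 0 < t → TFSE.FiniteMSD (u t)) ∧
      (fun t : ℝ => TFSE.msd (u t) - TFSE.ballisticCoeff α u₀ * t ^ 2) =O[atTop]
        (fun t : ℝ => t) ∧
      (u₀ ≠ 0 → 0 < TFSE.ballisticCoeff α u₀) := by
  subst hαβ
  have hsol := TFSE.isSolution_solution hα hα1 u₀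
  refine ⟨TFSE.solution α u₀, hsol, fun u' hu' => TFSE.IsSolution.eqOn hα hα1 hu' hsol,
    fun t ht => TFSE.finiteMSD_solution hα hα1 u₀ ht, ?_, TFSE.ballisticCoeff_pos hd hα hα1⟩
  obtain ⟨K, hK⟩ := TFSE.exists_abs_msd_solution_sub_le hα hα1 u₀
  refine IsBigO.of_bound K ?_
  filter_upwards [eventually_ge_atTop 1] with t ht
  rw [TFSE.ballisticCoeff_eq_integral, Real.norm_eq_abs, Real.norm_of_nonneg (zero_le_one.trans ht)]
  exact hK t ht
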